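/- **Conventions.** A topos is a category equivalent to the category of sheaves of sets on a small site; a topos morphism $E\to E'$ is an adjoint pair whose left adjoint $E'\to E$ (the inverse image) is left exact; a point of $E$ is a topos morphism $\mathrm{Set}\to E$, and its inverse image $E\to\mathrm{Set}$ is its fiber functor. Coverings are those of the canonical topology. An object $X$ is *connected* if whenever $X=X_1\amalg X_2$, one of $X_1,X_2$ is initial; it is *constant* if it is a sum of copies of the final object $*$; an object $U$ *trivializes* $F$ if $F\times U\to U$ is a constant object of the slice over $U$; $F$ is *locally constant* if the objects trivializing it cover $*$. An object $Y$ is *Galois* if it is connected, locally constant, and $\coprod_{\varphi\in\mathrm{Aut}\,Y}Y\to Y\times Y$, $(y,\varphi)\mapsto(y,\varphi(y))$ is an isomorphism. A class of objects *generates* a category if any two distinct morphisms $f,g:x\to y$ are distinguished by some morphism $z\to x$ with $z$ in the class. A topos is *connected* if its final object is, *locally connected* if it is generated by its connected objects, *Galois* if it is generated by its Galois objects. $\mathrm{SLC}\,E$ is the full subcategory of $E$ of the sums of locally constant objects. For a covering sieve $R$ of $*$ in $E$, let $\mathrm{LC}(E,R)$ be the full subcategory of the objects trivialized by all the connected objects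 of $R$. For a point $p$ of $\mathrm{SLC}\,E$, the fundamental progroup is $\pi_1(E,p)=\text{“}\varprojlim_R\text{”}\,\mathrm{Aut}(p|_{\mathrm{LC}(E,R)})$, where $p|_{\mathrm{LC}(E,R)}$ is the fiber functor of $p$ restricted to $\mathrm{LC}(E,R)$. A morphism of progroups is an element of $\mathrm{Hom}(\text{“}\varprojlim\text{”}G_i,\text{“}\varprojlim\text{”}H_j)=\varprojlim_j\varinjlim_i\mathrm{Hom}(G_i,H_j)$, a group is also regarded as a constant progroup, and a sequence $1\to G\to H\to K\to1$ of progroups is exact if it is isomorphic to a filtered projective system of short exact sequences of groups. **Theorem 6.1.** Let $\mathcal T$ be a connected, locally connected topos, $x$ a point of $\mathrm{SLC}\,\mathcal T$, $\mathcal F:\mathrm{SLC}\,\mathcal T\to\mathrm{Set}$ its fiber functor, and $Y$ a Galois object of $\mathrm{SLC}\,\mathcal T$. (i) The slice $(\mathrm{SLC}\,\mathcal T)/Y$ is a Galois topos, and for each $a\in\mathcal F(Y)$ the functor $(Z\xrightarrow{\;\pi\;} Y)\mapsto\{z\in\mathcal F(Z):\mathcal F(\pi)(z)=a\}$ is the fiber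 functor of a point of $(\mathrm{SLC}\,\mathcal T)/Y$, again denoted $a$. (ii) The functor $\mathrm{SLC}\,\mathcal T\to(\mathrm{SLC}\,\mathcal T)/Y$, $X\mapsto(X\times Y\to Y)$ exists and is the inverse image functor of a topos morphism $(\mathrm{SLC}\,\mathcal T)/Y\to\mathrm{SLC}\,\mathcal T$. (iii) For each $a\in\mathcal F(Y)$, write $\pi_1(Y,a)=\pi_1((\mathrm{SLC}\,\mathcal T)/Y,a)$. The morphism of (ii) maps the point $a$ to $x$ (via the isomorphisms from the fiber of $X\times Y\to Y$ at $a$ to $\mathcal F(X)$ given by the first projection), and there is a short exact sequence of progroups $$1\longrightarrow\pi_1(Y,a)\longrightarrow\pi_1(\mathcal T,x)\longrightarrow\mathrm{Aut}\,Y\longrightarrow1,$$ in which the first arrow is induced by the topos morphism of (ii), and the second maps $\sigma$ to the automorphism $\varphi$ of $Y$ such that $\mathcal F(\varphi)(a)=\sigma^{-1}\cdot a$. -/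

import Mathlib

open CategoryTheory Limits

universe w

noncomputable section

namespace GaloisTopos

/-! ### Toposes and their morphisms -/

section Topos

/-- A (Grothendieck) topos: a category equivalent to the category of sheaves of sets on a
small site. -/
class IsTopos (E : Type (w + 1)) [LargeCategory.{w} E] : Prop where
  exists_site : ∃ (C : Type w) (_ : SmallCategory C) (J : GrothendieckTopology C),
    Nonempty (E ≌ Sheaf J (Type w))

instance IsTopos.hasFiniteLimits (E : Type (w + 1)) [LargeCategory.{w} E] [IsTopos E] :
    HasFiniteLimits E := by
  obtain ⟨C, _, J, ⟨e⟩⟩ := IsTopos.exists_site (E := E)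
  exact ⟨fun K _ _ => Adjunction.hasLimitsOfShape_of_equivalence e.functor⟩

/-- A topos morphism `E ⟶ E'`: a pair of adjoint functors whose left adjoint, the inverse image
functor `E' ⥤ E`, is left exact. -/
structure ToposMorphism (E : Type (w + 1)) [LargeCategory.{w} E]
    (E' : Type (w + 1)) [LargeCategory.{w} E'] where
  inverseImage : E' ⥤ E
  directImage : E ⥤ E'
  adj : inverseImage ⊣ directImage
  preservesFiniteLimits : PreservesFiniteLimits inverseImage

/-- A point of `E`: a topos morphism from the topos of sets to `E`. Its inverse image functor
`E ⥤ Type w` is the corresponding fiber functor. -/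
abbrev Point (E : Type (w + 1)) [LargeCategory.{w} E] := ToposMorphism (Type w) E

end Topos

/-! ### Connected, constant, locally constant and Galois objects -/

section Objects

variable {E : Type (w + 1)} [LargeCategory.{w} E]

/-- `X` is connected: in every decomposition of `X` as a sum of two objects, one of the two is
initial. -/
def IsConnectedObject (X : E) : Prop :=
  ∀ (X₁ X₂ : E) (i₁ : X₁ ⟶ X) (i₂ : X₂ ⟶ X), Nonempty (IsColimit (BinaryCofan.mk i₁ i₂)) →
    Nonempty (IsInitial X₁) ∨ Nonempty (IsInitial X₂)

/-- `X` is constant: it is a sum of copies of a final object, indexed by some (small) set. -/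
def IsConstantObject {D : Type (w + 1)} [LargeCategory.{w} D] (X : D) : Prop :=
  ∃ (I : Type w) (t : D) (ι : I → (t ⟶ X)),
    Nonempty (IsTerminal t) ∧ Nonempty (IsColimit (Cofan.mk X ι))

/-- `U` trivializes `F`: the restriction `F × U ⟶ U` is a constant object of the slice over `U`.
(The product is taken to be any product of `F` and `U`; they are all isomorphic.) -/
def Trivializes (U F : E) : Prop :=
  ∃ (P : E) (fst : P ⟶ F) (snd : P ⟶ U),
    Nonempty (IsLimit (BinaryFan.mk fst snd)) ∧ IsConstantObject (Over.mk snd)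

/-- `F` is locally constant: the objects which trivialize `F` cover the final object, for the
canonical topology. -/
def IsLocallyConstantObject (F : E) : Prop :=
  (Sheaf.canonicalTopology E).CoversTop (fun U : {U : E // Trivializes U F} => U.1)

/-- `Y` is a Galois object: it is connected and locally constant, and the morphism
`Y × (Aut Y) ⟶ Y × Y`, `(y, φ) ↦ (y, φ y)` is an isomorphism. As `Y × (Aut Y)` is the sum of
copies of `Y` indexed by the set `Aut Y`, this says that the morphisms `(𝟙, φ) : Y ⟶ Y × Y`, for
`φ` in `Aut Y`, exhibit `Y × Y` as the sum of these copies. -/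
structure IsGaloisObject (Y : E) : Prop where
  connected : IsConnectedObject Y
  locallyConstant : IsLocallyConstantObject Y
  exists_product : ∃ (P : E) (fst snd : P ⟶ Y) (h : IsLimit (BinaryFan.mk fst snd)),
    Nonempty (IsColimit (Cofan.mk P
      (fun φ : Aut Y => h.lift (BinaryFan.mk (𝟙 Y) φ.hom))))

variable (E)

/-- `E` is connected: its final object is. -/
def IsConnectedTopos [HasTerminal E] : Prop := IsConnectedObject (⊤_ E)

/-- `E` is locally connected: it is generated by its connected objects. -/
def IsLocallyConnectedTopos : Prop :=
  ObjectProperty.IsSeparating (fun X : E => IsConnectedObject X)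

/-- A Galois topos: a topos generated by its Galois objects. -/
structure IsGaloisTopos : Prop where
  isTopos : IsTopos E
  separating : ObjectProperty.IsSeparating (fun X : E => IsGaloisObject X)

/-- The objects which are sums of (small) families of locally constant objects. -/
def isSLC : ObjectProperty E := fun X =>
  ∃ (I : Type w) (Z : I → E) (ι : ∀ i, Z i ⟶ X),
    (∀ i, IsLocallyConstantObject (Z i)) ∧ Nonempty (IsColimit (Cofan.mk X ι))

/-- The full subcategory of sums of locally constant objects. -/
abbrev SLC : Type (w + 1) := (isSLC E).FullSubcategory

end Objects

/-! ### Progroups -/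

section ProGroups

/-- A progroup: a functor from a (small) cofiltered category to groups. -/
structure ProGrp where
  I : Type w
  [category : SmallCategory I]
  [cofiltered : IsCofiltered I]
  diagram : I ⥤ GrpCat.{w}

attribute [instance] ProGrp.category ProGrp.cofiltered

namespace ProGrp

/-- The functor `K ↦ colim_i Hom (G_i, K)` which is pro-represented by `G = "lim" G_i`. -/
def homFrom (G : ProGrp.{w}) : GrpCat.{w} ⥤ Type w :=
  colimit (G.diagram.op ⋙ coyoneda)

/-- The class in `colim_i Hom (G_i, K)` of a morphism `G_i ⟶ K`. -/
def germ (G : ProGrp.{w}) {i : G.I} {K : GrpCat.{w}} (φ : G.diagram.obj i ⟶ K) :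
    G.homFrom.obj K :=
  (colimit.ι (G.diagram.op ⋙ coyoneda) (Opposite.op i)).app K φ

/-- Morphisms of progroups `G ⟶ H` are the natural transformations
`colim_j Hom (H_j, -) ⟶ colim_i Hom (G_i, -)`, so that, by the Yoneda lemma,
`Hom (G, H) = lim_j colim_i Hom (G_i, H_j)`. -/
instance : Category ProGrp.{w} where
  Hom G H := H.homFrom ⟶ G.homFrom
  id G := 𝟙 G.homFrom
  comp f g := NatTrans.vcomp g f

/-- The `j`-th component, in `colim_i Hom (G_i, H_j)`, of a morphism of progroups. -/
def component {G H : ProGrp.{w}} (f : G ⟶ H) (j : H.I) : G.homFrom.obj (H.diagram.obj j) :=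
  NatTrans.app (F := H.homFrom) (G := G.homFrom) f (H.diagram.obj j) (H.germ (𝟙 _))

/-- The group morphism `φ : G_i ⟶ H_j` represents the `j`-th component of `f : G ⟶ H`. -/
def Represents {G H : ProGrp.{w}} (f : G ⟶ H) {i : G.I} {j : H.I}
    (φ : G.diagram.obj i ⟶ H.diagram.obj j) : Prop :=
  component f j = G.germ φ

/-- The progroup given by a functor. -/
abbrev of {J : Type w} [SmallCategory J] [IsCofiltered J] (A : J ⥤ GrpCat.{w}) : ProGrp.{w} :=
  { I := J, diagram := A }

/-- The morphism of progroups given by a natural transformation. -/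
def ofNatTrans {J : Type w} [SmallCategory J] [IsCofiltered J] {A B : J ⥤ GrpCat.{w}}
    (α : A ⟶ B) : of A ⟶ of B :=
  show (of B).homFrom ⟶ (of A).homFrom from
    colimMap (Functor.whiskerRight (NatTrans.op α) coyoneda)

/-- A group, seen as a (constant) progroup. -/
def const (K : GrpCat.{w}) : ProGrp.{w} := of ((Functor.const (Discrete PUnit.{w + 1})).obj K)

/-- The sequence of progroups `1 ⟶ G ⟶ H ⟶ K ⟶ 1` is exact: up to isomorphism of progroups, it is
"lim" of a projective system of short exact sequences of groups
`1 ⟶ A_j ⟶ B_j ⟶ C_j ⟶ 1`. -/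
def IsShortExact {G H K : ProGrp.{w}} (f : G ⟶ H) (g : H ⟶ K) : Prop :=
  ∃ (J : Type w) (_ : SmallCategory J) (_ : IsCofiltered J) (A B C : J ⥤ GrpCat.{w})
    (α : A ⟶ B) (β : B ⟶ C) (eG : G ≅ of A) (eH : H ≅ of B) (eK : K ≅ of C),
    (∀ j, Function.Injective (α.app j).hom ∧
      (α.app j).hom.range = (β.app j).hom.ker ∧
      Function.Surjective (β.app j).hom) ∧
    f ≫ eH.hom = eG.hom ≫ ofNatTrans α ∧
    g ≫ eK.hom = eH.hom ≫ ofNatTrans β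

end ProGrp

end ProGroups

/-! ### The fundamental progroup -/

section FundamentalGroup

variable (E : Type (w + 1)) [LargeCategory.{w} E] [HasTerminal E]

/-- The covering sieves of the final object, for the canonical topology, ordered by inclusion. -/
abbrev CoveringSieve : Type (w + 1) := (Sheaf.canonicalTopology E).Cover (⊤_ E)

variable {E}

/-- The objects which are trivialized by the connected objects of the sieve `R`. -/
def isLC (R : CoveringSieve E) : ObjectProperty E := fun X =>
  ∀ (U : E) (f : U ⟶ ⊤_ E), R.1 f → IsConnectedObject U → Trivializes U X

lemma isLC_mono {R' R : CoveringSieve E} (h : R' ≤ R) : isLC R ≤ isLC R' :=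
  fun _ hX U f hf hU => hX U f ((show R'.1 ≤ R.1 from h) _ hf) hU

/-- The category of the objects trivialized by the connected objects of `R`, as a full subcategory
of `SLC E`. -/
abbrev LC (R : CoveringSieve E) : Type (w + 1) :=
  ((isLC R).inverseImage (isSLC E).ι).FullSubcategory

/-- The inclusion of `LC R` in `SLC E`. -/
abbrev LC.incl (R : CoveringSieve E) : LC R ⥤ SLC E :=
  ((isLC R).inverseImage (isSLC E).ι).ι

/-- For `R'` finer than `R`, the inclusion of `LC R` in `LC R'`. -/
abbrev LC.inclOfLE {R' R : CoveringSieve E} (h : R' ≤ R) : LC R ⥤ LC R' :=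
  ObjectProperty.ιOfLE (fun X hX => isLC_mono h X.obj hX)

variable (p : SLC E ⥤ Type w)

/-- The group of automorphisms of the point of `LC R` given by the point of `SLC E` whose fiber
functor is `p`. -/
def pi1Level (R : CoveringSieve E) : GrpCat.{w + 1} := GrpCat.of (Aut (LC.incl R ⋙ p))

/-- The action of an element of `pi1Level p R` on the fiber at `p` of an object of `LC R`. -/
def pi1Level.act {p : SLC E ⥤ Type w} {R : CoveringSieve E} (σ : pi1Level p R) (X : SLC E)
    (hX : isLC R X.obj) : p.obj X → p.obj X :=
  fun z => (show Aut (LC.incl R ⋙ p) from σ).hom.app ⟨X, hX⟩ z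

/-- The restriction morphism from the automorphisms of the point of `LC R'` to those of the point of
`LC R`, for `R'` finer than `R`. -/
def pi1Level.restrict {R' R : CoveringSieve E} (h : R' ≤ R) : pi1Level p R' ⟶ pi1Level p R :=
  GrpCat.ofHom (((Functor.whiskeringLeft _ _ (Type w)).obj (LC.inclOfLE h)).mapAut
    (LC.incl R' ⋙ p))

/-- The fundamental progroup of `E` at the base point whose fiber functor is `p : SLC E ⥤ Type w`:
the projective system, indexed by the covering sieves `R` of the final object, of the automorphism
groups of the points of `LC R` given by `p`. -/
def pi1 : ProGrp.{w + 1} where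
  I := CoveringSieve E
  diagram :=
    { obj := pi1Level p
      map := fun h => pi1Level.restrict p (leOfHom h)
      map_id := fun _ => rfl
      map_comp := fun _ _ => rfl }

end FundamentalGroup

/-! ### Slices -/

section Slices

variable {E : Type (w + 1)} [LargeCategory.{w} E]

/-- For a functor `F : E ⥤ Type w` and `a` in `F Y`, the functor which maps `Z ⟶ Y` to the fiber
above `a` of `F Z → F Y`. -/
def fiberAt (F : E ⥤ Type w) {Y : E} (a : F.obj Y) : Over Y ⥤ Type w where
  obj Z := {z : F.obj Z.left // F.map Z.hom z = a}
  map {Z Z'} f := TypeCat.ofHom fun z => ⟨F.map f.left z.1, by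
    have h := congrArg (fun k => F.map k z.1) (Over.w f)
    simp only [Functor.map_comp, types_comp_apply] at h
    exact h.trans z.2⟩
  map_id Z := by
    ext z
    simp
  map_comp f g := by
    ext z
    simp

/-- A choice of the functor `X ↦ (X × Y ⟶ Y)` from `E` to the slice over `Y`, together with the
first projections `X × Y ⟶ X`. -/
structure ProductFunctor (Y : E) where
  functor : E ⥤ Over Y
  fst (X : E) : (functor.obj X).left ⟶ X
  fst_naturality {X X' : E} (f : X ⟶ X') : (functor.map f).left ≫ fst X' = fst X ≫ f
  isLimit (X : E) : IsLimit
    (BinaryFan.mk (P := (functor.obj X).left) (X := X) (Y := Y) (fst X) (functor.obj X).hom)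

/-- The comparison map from the fiber of `X × Y ⟶ Y` at `a` to the fiber of `X`, given by the first
projection. -/
def ProductFunctor.fiberComparison {Y : E} (P : ProductFunctor Y) (F : E ⥤ Type w)
    (a : F.obj Y) : P.functor ⋙ fiberAt F a ⟶ F where
  app X := TypeCat.ofHom fun z => F.map (P.fst X) z.1
  naturality X X' f := by
    ext z
    have h := congrArg (fun k => F.map k z.1) (P.fst_naturality f)
    simp only [Functor.map_comp, types_comp_apply] at h
    exact h

end Slices

/-! ### Morphisms between fundamental progroups -/

section Induced

/-- Let `E` and `E'` be toposes, `u : SLC E ⥤ E'` the inverse image functor of a topos morphism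
`m : E' ⟶ SLC E`, `p` the fiber functor of a point of `SLC E`, `q` that of a point of `E'`, and `θ`
an identification of the fiber functor `u ⋙ q` of the image by `m` of the latter point with `p`.
`f : π₁ (E', q) ⟶ π₁ (E, p)` is the morphism induced by `m`: for each covering sieve `R` of `E`, `u`
maps the objects of `LC R` to objects of `LC S`, for some covering sieve `S` of `E'`, and the
component of `f` at `R` is represented by the morphism which maps an automorphism `σ` of the
restriction of `q` to `LC S` to the automorphism `σ_{u (-)}` of the restriction of `p`
to `LC R`. -/
def IsInducedBy {E : Type (w + 1)} [LargeCategory.{w} E] [HasTerminal E]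
    {E' : Type (w + 1)} [LargeCategory.{w} E'] [HasTerminal E']
    (u : SLC E ⥤ E') (p : SLC E ⥤ Type w) (q : E' ⥤ Type w) (θ : u ⋙ q ⟶ p)
    (f : pi1 ((isSLC E').ι ⋙ q) ⟶ pi1 p) : Prop :=
  ∀ R : CoveringSieve E, ∃ (S : CoveringSieve E')
    (φ : pi1Level ((isSLC E').ι ⋙ q) S ⟶ pi1Level p R),
    ProGrp.Represents f (i := S) (j := R) φ ∧
    ∀ (X : SLC E) (hX : isLC R X.obj),
      ∃ (h : isSLC E' (u.obj X)) (hS : isLC S (u.obj X)),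
        ∀ (σ : pi1Level ((isSLC E').ι ⋙ q) S) (z : q.obj (u.obj X)),
          θ.app X (pi1Level.act σ ⟨u.obj X, h⟩ hS z) =
            pi1Level.act (φ.hom σ) X hX (θ.app X z)

/-- The group of automorphisms of `Y`, as a constant progroup. -/
def autProGrp {E : Type (w + 1)} [LargeCategory.{w} E] (Y : E) : ProGrp.{w + 1} :=
  ProGrp.const (GrpCat.of (ULift.{w + 1} (Aut Y)))

/-- `g : π₁ (E, p) ⟶ Aut Y` is the morphism given by the action on `a` in `p Y`: it is represented,
for some covering sieve `R` whose connected objects trivialize `Y`, by the group morphism which maps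
`σ` to the automorphism `φ` of `Y` such that `p φ a = σ⁻¹ a`, i.e., `p φ (σ a) = a`. -/
def IsOrbitMorphism {E : Type (w + 1)} [LargeCategory.{w} E] [HasTerminal E]
    (p : SLC E ⥤ Type w) (Y : SLC E) (a : p.obj Y) (g : pi1 p ⟶ autProGrp Y) : Prop :=
  ∃ (R : CoveringSieve E) (hR : isLC R Y.obj)
    (φ : pi1Level p R ⟶ GrpCat.of (ULift.{w + 1} (Aut Y))),
    ProGrp.Represents g (i := R) (j := (⟨PUnit.unit⟩ : Discrete PUnit.{w + 2})) φ ∧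
    ∀ σ : pi1Level p R, p.map (φ.hom σ).down.hom (pi1Level.act σ Y hR a) = a

end Induced

end GaloisTopos

end

/-! Everything is tested on connected, non-initial objects (`IsConn`). Such a `V` splits `X` when
Hom(V, X) does not change on passing to connected objects over `V`; by
`isLocallyConstantObject_iff`, `X` is locally constant exactly when the objects which split it
separate morphisms. Sums of locally constant objects satisfy unique continuation
(`HasInjectiveRestrictions`): two morphisms from a connected object agree as soon as they agree on
one connected object over it. Hence `SLC` is stable under pullbacks, sums and direct summands.

The heart of the matter is the existence of enough Galois objects. Take a small separating family
`u` of connected objects and the free groupoid on the full subcategory which it spans. The colimit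
of the `u k` over all paths from `k` to a base index imitates the classical universal cover: its
points on `u k` are exactly these paths (`IsUniversalCover.eq_of_eq`, `IsUniversalCover.bijective`),
it is connected, and by monodromy it splits itself and every sum of locally constant objects split
by the whole family. Letting the family vary among the separating subfamilies of a fixed one yields
a small family of Galois objects generating `SLC` (`exists_small_isGal`).

The Galois objects over `Y` form a site for the atomic topology, and the slice over `Y` is its
category of sheaves: an atomic sheaf is a sum of orbits, each of them the quotient of a Galois
object by a group of automorphisms (`IsGal.exists_quotient`, `IsGaloisSite.isTopos`). `SLC` itself
is the slice over its final object. All objects of the slice are again sums of locally constant ones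
(`isSLC_over`). The fiber functor at `a` has a right adjoint, pulled back from the bundle on the
fiber of `Y` which is a given set above `a` and a point elsewhere.

For the exact sequence, fix a Galois object above `Y` and consider the objects which it splits. On
them the fiber functor is represented by this Galois object once a point of its fiber is chosen
(`Splits.bijective_fiber`), so automorphisms of the fiber functor can move any point of the fiber to
any other. Those coming from the slice are the ones which fix `a` (`mem_range_stabilizerInclusion`).
As `Aut Y` is simply transitive on the fiber of `Y`, the stabilizer of `a` is the kernel of the
orbit morphism, and this morphism is surjective. It remains to pass to the limit: the sieves
generated by Galois objects are cofinal among the covering sieves of the slice, and downstairs among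
the covering sieves compared through what they trivialize. -/

noncomputable section

namespace GaloisTopos

/-! ### Jointly epimorphic families of sheaves are universally effective -/

section JointlyEpi

/-- A family of morphisms with the same target is jointly epimorphic. -/
def JointlyEpi {D : Type*} [Category* D] {X : D} {ι : Type*} {U : ι → D}
    (f : ∀ i, U i ⟶ X) : Prop :=
  ∀ ⦃Z : D⦄ (g h : X ⟶ Z), (∀ i, f i ≫ g = f i ≫ h) → g = h

variable {C : Type w} [SmallCategory C] {J : GrothendieckTopology C}

/-- The subpresheaf generated by the images of a family of morphisms. -/
def unionRange {X : Sheaf J (Type w)} {ι : Type*} {U : ι → Sheaf J (Type w)}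
    (f : ∀ i, U i ⟶ X) : Subfunctor X.obj where
  obj c := {s | ∃ i u, (f i).hom.app c u = s}
  map {c d} g := by
    rintro _ ⟨i, u, rfl⟩
    exact ⟨i, (U i).obj.map g u, NatTrans.naturality_apply (f i).hom g u⟩

/-- All the `f i` factor through the sheafified union of their images, whose inclusion is thus both
a monomorphism and an epimorphism. A topos is balanced, so the inclusion is an isomorphism and every
section is locally in some image. -/
lemma sieveOfSection_unionRange_mem {X : Sheaf J (Type w)} {ι : Type*}
    {U : ι → Sheaf J (Type w)} (f : ∀ i, U i ⟶ X) (hf : JointlyEpi f) {c : Cᵒᵖ}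
    (s : X.obj.obj c) : (unionRange f).sieveOfSection s ∈ J c.unop := by
  let I : Sheaf J (Type w) := ⟨((unionRange f).sheafify J).toFunctor, by
    rw [isSheaf_iff_isSheaf_of_type]
    apply Subfunctor.sheafify_isSheaf
    rw [← isSheaf_iff_isSheaf_of_type]
    exact X.2⟩
  let m : I ⟶ X := ⟨Subfunctor.ι _⟩
  have : Mono m := (sheafToPresheaf J _).mono_of_mono_map (by
    change Mono (Subfunctor.ι _); infer_instance)
  have hle := (unionRange f).le_sheafify J
  have hr (i) : Subfunctor.range (f i).hom ≤ (unionRange f).sheafify J := by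
    rintro c _ ⟨u, rfl⟩
    exact hle c ⟨i, u, rfl⟩
  let l (i) : U i ⟶ I := ⟨Subfunctor.lift (f i).hom (hr i)⟩
  have hl (i) : l i ≫ m = f i := by
    ext : 1
    exact Subfunctor.lift_ι _ (hr i)
  have : Epi m := ⟨fun g h e => hf g h fun i => by rw [← hl, Category.assoc, e, Category.assoc]⟩
  have : IsIso m := isIso_of_mono_of_epi m
  have h2 : (inv m).hom ≫ m.hom = 𝟙 _ := congrArg (fun k => k.hom) (IsIso.inv_hom_id m)
  have h3 : m.hom.app c ((inv m).hom.app c s) = s :=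
    ConcreteCategory.congr_hom (NatTrans.congr_app h2 c) s
  have := ((inv m).hom.app c s).2
  rw [← h3]
  exact this


/-- Sheafified representables turn sections into morphisms, so that hypotheses on morphisms, which
make sense in any category, can be applied to sections. -/
lemma exists_representing (J : GrothendieckTopology C) (c : Cᵒᵖ) :
    ∃ (Z : Sheaf J (Type w)) (e : Z.obj.obj c),
      ∀ U : Sheaf J (Type w), Function.Bijective (fun a : Z ⟶ U => a.hom.app c e) := by
  let A := sheafificationAdjunction J (Type w)
  refine ⟨(presheafToSheaf J (Type w)).obj (yoneda.obj c.unop),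
    (A.unit.app (yoneda.obj c.unop)).app c (𝟙 c.unop), fun U => ?_⟩
  have h : (fun a : (presheafToSheaf J (Type w)).obj (yoneda.obj c.unop) ⟶ U =>
      a.hom.app c ((A.unit.app (yoneda.obj c.unop)).app c (𝟙 c.unop))) =
      ((A.homEquiv (yoneda.obj c.unop) U).trans yonedaEquiv) := by
    funext a
    simp only [Equiv.trans_apply, Adjunction.homEquiv_unit]
    rfl
  rw [h]
  exact Equiv.bijective _

/-- A section of `X` lifts locally to some `U i`, where `x i` prescribes its value; `hx` makes this
value independent of the lift, and the sheaf `W` glues the values. -/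
lemma Sheaf.exists_glue {X W : Sheaf J (Type w)} {ι : Type*} {U : ι → Sheaf J (Type w)}
    (f : ∀ i, U i ⟶ X) (hf : JointlyEpi f) (x : ∀ i, U i ⟶ W)
    (hx : ∀ (Z : Sheaf J (Type w)) (i j : ι) (a : Z ⟶ U i) (b : Z ⟶ U j),
      a ≫ f i = b ≫ f j → a ≫ x i = b ≫ x j) :
    ∃ g : X ⟶ W, ∀ i, f i ≫ g = x i := by
  have hx' {c : Cᵒᵖ} (i j) (u : (U i).obj.obj c) (v : (U j).obj.obj c)
      (h : (f i).hom.app c u = (f j).hom.app c v) :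
      (x i).hom.app c u = (x j).hom.app c v := by
    obtain ⟨Z, e, he⟩ := exists_representing J c
    obtain ⟨a, rfl⟩ := (he _).2 u
    obtain ⟨b, rfl⟩ := (he _).2 v
    exact congrArg (fun k : Z ⟶ W => k.hom.app c e) (hx Z i j a b ((he X).1 h))
  -- The value is characterized by all its restrictions along all local lifts, so that uniqueness
  -- gives naturality in `c`.
  have key : ∀ (c : Cᵒᵖ) (s : X.obj.obj c), ∃! t : W.obj.obj c, ∀ (d : Cᵒᵖ) (g : c ⟶ d) (i)
      (u : (U i).obj.obj d), (f i).hom.app d u = X.obj.map g s →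
        (x i).hom.app d u = W.obj.map g t := by
    intro c s
    have hW := (isSheaf_iff_isSheaf_of_type J _).1 W.2 _
      (sieveOfSection_unionRange_mem f hf s)
    have hw (d : C) (g : d ⟶ c.unop) (hg : ((unionRange f).sieveOfSection s).arrows g) :
      ∃ (i : ι) (u : (U i).obj.obj (Opposite.op d)),
        (f i).hom.app _ u = X.obj.map g.op s := hg
    choose i u hu using hw
    obtain ⟨t, ht, ht'⟩ := hW (fun d g hg => (x (i d g hg)).hom.app _ (u d g hg)) (by
      intro d₁ d₂ e g₁ g₂ h₁ h₂ h₁₂ h₂₂ hcomp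
      rw [← NatTrans.naturality_apply, ← NatTrans.naturality_apply]
      apply hx'
      rw [NatTrans.naturality_apply, NatTrans.naturality_apply, hu, hu,
        ← Functor.map_comp_apply, ← Functor.map_comp_apply, ← op_comp, ← op_comp, hcomp])
    refine ⟨t, fun d g i' u' hu' => ?_, fun t' h' => ht' t' fun d g hg => ?_⟩
    · have hg : ((unionRange f).sieveOfSection s).arrows g.unop := ⟨i', u', hu'⟩
      refine Eq.trans ?_ (ht g.unop hg).symm
      exact hx' _ _ _ _ (hu'.trans (hu d.unop g.unop hg).symm)
    · exact (h' _ g.op _ _ (hu d g hg)).symm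
  choose t ht ht' using key
  refine ⟨⟨{ app := fun c => TypeCat.ofHom (t c), naturality := ?_ }⟩, fun i => ?_⟩
  · intro c d g
    ext s
    refine (ht' d (X.obj.map g s) (W.obj.map g (t c s)) fun d' g' i u hu => ?_).symm
    rw [← Functor.map_comp_apply]
    exact ht _ _ _ _ _ _ (hu.trans (Functor.map_comp_apply ..).symm)
  · ext c u
    have := ht c ((f i).hom.app c u) c (𝟙 c) i u (by simp)
    simpa using this.symm

lemma Sheaf.jointlyEpi_pullback {X Y : Sheaf J (Type w)} {ι : Type*} {U : ι → Sheaf J (Type w)}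
    (f : ∀ i, U i ⟶ X) (hf : JointlyEpi f) (y : Y ⟶ X) {Z : Sheaf J (Type w)} (g h : Y ⟶ Z)
    (H : ∀ (W : Sheaf J (Type w)) (i : ι) (a : W ⟶ Y) (b : W ⟶ U i),
      a ≫ y = b ≫ f i → a ≫ g = a ≫ h) : g = h := by
  ext c s
  refine ((isSheaf_iff_isSheaf_of_type J _).1 Z.2 _
      (sieveOfSection_unionRange_mem f hf (y.hom.app c s))).isSeparatedFor.ext fun d e he => ?_
  obtain ⟨i, u, hu⟩ := he
  obtain ⟨V, v, hV⟩ := exists_representing J (Opposite.op d)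
  obtain ⟨b, hb⟩ := (hV _).2 u
  obtain ⟨a, ha⟩ := (hV _).2 (Y.obj.map e.op s)
  have := congrArg (fun k : V ⟶ Z => k.hom.app _ v) (H V i a b ((hV X).1 ?_))
  · change Z.obj.map e.op (g.hom.app c s) = Z.obj.map e.op (h.hom.app c s)
    rw [← NatTrans.naturality_apply, ← NatTrans.naturality_apply, ← ha]
    exact this
  · change y.hom.app _ (a.hom.app _ v) = (f i).hom.app _ (b.hom.app _ v)
    dsimp only at ha hb
    rw [ha, hb, hu, NatTrans.naturality_apply]

end JointlyEpi

/-! ### Exactness properties of a topos and its canonical topology -/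

section ToposExactness

variable {D : Type (w + 1)} [LargeCategory.{w} D] [IsTopos D]

instance : HasColimitsOfSize.{w, w} D := by
  obtain ⟨C, _, J, ⟨e⟩⟩ := IsTopos.exists_site (E := D)
  exact ⟨fun K _ => Adjunction.hasColimitsOfShape_of_equivalence e.functor⟩

instance : FinitaryExtensive D := by
  obtain ⟨C, _, J, ⟨e⟩⟩ := IsTopos.exists_site (E := D)
  exact finitaryExtensive_of_preserves_and_reflects_isomorphism e.functor

-- Cartesian closedness enters in two places: products with a fixed object commute with
-- presentations by generators and relations, and product with `Y` has a right adjoint with values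
-- in sections.
variable (D) in
lemma nonempty_cartesianClosed :
    Nonempty (Σ' (_ : CartesianMonoidalCategory D), MonoidalClosed D) := by
  obtain ⟨C, _, J, ⟨e⟩⟩ := IsTopos.exists_site (E := D)
  let : CartesianMonoidalCategory D := .ofHasFiniteProducts
  let h : MonoidalClosed (Sheaf J (Type w)) := inferInstance
  exact ⟨⟨inferInstance, @cartesianClosedOfEquiv _ _ _ _ _ _ e.symm h⟩⟩

omit [IsTopos D] in
lemma jointlyEpi_map_equivalence {D' : Type*} [Category* D'] (e : D ≌ D') {X : D} {ι : Type*}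
    {U : ι → D} {f : ∀ i, U i ⟶ X} (hf : JointlyEpi f) :
    JointlyEpi (fun i => e.functor.map (f i)) := by
  intro Z g h H
  refine (e.toAdjunction.homEquiv _ _).injective (hf _ _ fun i => ?_)
  rw [← Adjunction.homEquiv_naturality_left, ← Adjunction.homEquiv_naturality_left]
  exact congrArg _ (H i)

theorem JointlyEpi.exists_glue {X W : D} {ι : Type*} {U : ι → D}
    {f : ∀ i, U i ⟶ X} (hf : JointlyEpi f) (x : ∀ i, U i ⟶ W)
    (hx : ∀ (Z : D) (i j : ι) (a : Z ⟶ U i) (b : Z ⟶ U j),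
      a ≫ f i = b ≫ f j → a ≫ x i = b ≫ x j) :
    ∃ g : X ⟶ W, ∀ i, f i ≫ g = x i := by
  obtain ⟨C, _, J, ⟨e⟩⟩ := IsTopos.exists_site (E := D)
  obtain ⟨g, hg⟩ := Sheaf.exists_glue _ (jointlyEpi_map_equivalence e hf)
    (fun i => e.functor.map (x i)) (by
      intro Z i j a b hab
      let k := e.functor.objObjPreimageIso Z
      obtain ⟨a', ha'⟩ := e.functor.map_surjective (k.hom ≫ a)
      obtain ⟨b', hb'⟩ := e.functor.map_surjective (k.hom ≫ b)
      have := congrArg e.functor.map (hx _ i j a' b' (e.functor.map_injective (by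
        simp [ha', hb', hab])))
      simpa [ha', hb'] using this)
  obtain ⟨g, rfl⟩ := e.functor.map_surjective g
  exact ⟨g, fun i => e.functor.map_injective (by simpa using hg i)⟩

/-- All commutative squares are used instead of fiber products, so that nothing has to be chosen. -/
theorem JointlyEpi.pullback {X Y : D} {ι : Type*} {U : ι → D}
    {f : ∀ i, U i ⟶ X} (hf : JointlyEpi f) (y : Y ⟶ X) :
    JointlyEpi (fun p : Σ (W : D) (i : ι), {p : (W ⟶ Y) × (W ⟶ U i) // p.1 ≫ y = p.2 ≫ f i} =>
      p.2.2.1.1) := by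
  intro Z g h H
  obtain ⟨C, _, J, ⟨e⟩⟩ := IsTopos.exists_site (E := D)
  refine e.functor.map_injective (Sheaf.jointlyEpi_pullback _ (jointlyEpi_map_equivalence e hf)
    (e.functor.map y) _ _ ?_)
  intro Z i a b hab
  let k := e.functor.objObjPreimageIso Z
  obtain ⟨a', ha'⟩ := e.functor.map_surjective (k.hom ≫ a)
  obtain ⟨b', hb'⟩ := e.functor.map_surjective (k.hom ≫ b)
  have := congrArg e.functor.map (H ⟨_, i, (a', b'), e.functor.map_injective (by
        simp [ha', hb', hab])⟩)
  simpa [ha'] using this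

/-- Jointly epimorphic sieves remain so under pullback and are effective, so every representable
presheaf is a sheaf for them. With the converse below, they are exactly the covering sieves. -/
theorem mem_canonicalTopology {X : D} (S : Sieve X)
    (hS : JointlyEpi (fun p : Σ W, {f : W ⟶ X // S f} => p.2.1)) :
    S ∈ Sheaf.canonicalTopology D X := by
  refine Sheaf.mem_finestTopology_of_forall_isSheafFor ?_
  rintro _ ⟨W, rfl⟩ Y y
  have hy : JointlyEpi (fun p : Σ W, {f : W ⟶ Y // S.pullback y f} => p.2.1) := by
    intro Z g h H
    refine hS.pullback y g h fun p => ?_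
    refine H ⟨p.1, p.2.2.1.1, ?_⟩
    change S _
    rw [p.2.2.2]
    exact S.downward_closed p.2.1.2.2 _
  intro x hx
  obtain ⟨g, hg⟩ := hy.exists_glue (fun p => x p.2.1 p.2.2) (by
    intro Z i j a b hab
    exact hx a b i.2.2 j.2.2 hab)
  refine ⟨g, fun V f hf => hg ⟨V, f, hf⟩, fun g' hg' => ?_⟩
  exact hy _ _ fun p => (hg' p.2.1 p.2.2).trans (hg p).symm

omit [IsTopos D] in
theorem jointlyEpi_of_mem_canonicalTopology {X : D} {S : Sieve X}
    (hS : S ∈ Sheaf.canonicalTopology D X) :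
    JointlyEpi (fun p : Σ W, {f : W ⟶ X // S f} => p.2.1) := by
  intro Z g h H
  exact (Sheaf.isSheaf_yoneda_obj Z S hS).isSeparatedFor.ext fun V f hf => H ⟨V, f, hf⟩

variable (D) in
theorem exists_small_separating : ∃ (κ : Type w) (G : κ → D), ∀ ⦃X Z : D⦄ (g h : X ⟶ Z),
    (∀ k (c : G k ⟶ X), c ≫ g = c ≫ h) → g = h := by
  obtain ⟨C, _, J, ⟨e⟩⟩ := IsTopos.exists_site (E := D)
  choose V v hV using fun c : C => exists_representing J (Opposite.op c)
  refine ⟨C, fun c => e.inverse.obj (V c), fun X Z g h H => e.functor.map_injective ?_⟩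
  ext c s
  obtain ⟨a, rfl⟩ := (hV c.unop _).2 s
  obtain ⟨b, hb⟩ := e.functor.map_surjective (e.counit.app _ ≫ a)
  have := congrArg e.functor.map (H c.unop b)
  simp only [Functor.map_comp, hb, Category.assoc] at this
  exact congrArg (fun k : V c.unop ⟶ _ => k.hom.app c (v c.unop)) ((cancel_epi _).1 this)

/-- A jointly epimorphic family contains a small jointly epimorphic family. -/
theorem JointlyEpi.exists_small {X : D} {ι : Type*} {U : ι → D} {f : ∀ i, U i ⟶ X}
    (hf : JointlyEpi f) : ∃ (κ : Type w) (r : κ → ι), JointlyEpi (fun k => f (r k)) := by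
  obtain ⟨κ, G, hG⟩ := exists_small_separating D
  -- The index set consists of the morphisms from generators which factor through some member of the
  -- family; one such member is chosen for each.
  refine ⟨{p : Σ k, (G k ⟶ X) // ∃ i a, a ≫ f i = p.2}, fun p => p.2.choose, fun Z g h H => ?_⟩
  refine hf g h fun i => hG _ _ fun k c => ?_
  let p : {p : Σ k, (G k ⟶ X) // ∃ i a, a ≫ f i = p.2} := ⟨⟨k, c ≫ f i⟩, i, c, rfl⟩
  obtain ⟨a, ha⟩ := p.2.choose_spec
  rw [← Category.assoc, ← Category.assoc]
  change p.1.2 ≫ g = p.1.2 ≫ h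
  rw [← ha, Category.assoc, Category.assoc, H]

end ToposExactness

/-! ### Connected objects, their points, and splitting -/

section Points

variable {D : Type (w + 1)} [LargeCategory.{w} D]

/-- `V` is connected and is not initial. -/
structure IsConn (V : D) : Prop where
  connected : IsConnectedObject V
  not_isInitial : ¬ Nonempty (IsInitial V)

lemma IsLocallyConnectedTopos.isConn_isSeparating (hl : IsLocallyConnectedTopos D) :
    ObjectProperty.IsSeparating (fun X : D => IsConn X) := by
  intro X Z f g H
  refine hl f g fun V hV c => ?_
  by_cases h : Nonempty (IsInitial V)
  · exact h.some.hom_ext _ _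
  · exact H V ⟨hV, h⟩ c

lemma _root_.CategoryTheory.ObjectProperty.IsSeparating.jointlyEpi {P : ObjectProperty D}
    (hP : P.IsSeparating) (X : D) :
    JointlyEpi (fun p : Σ V : {V // P V}, (V.1 ⟶ X) => p.2) :=
  fun _ _ _ H => hP _ _ fun V hV c => H ⟨⟨V, hV⟩, c⟩

variable [IsTopos D]

/-- A morphism can be defined on the points with values in a separating class of objects. -/
theorem exists_hom_of_points {P : ObjectProperty D} (hP : P.IsSeparating) {X W : D}
    (φ : ∀ V, P V → (V ⟶ X) → (V ⟶ W))
    (hφ : ∀ V V' hV hV' (a : V ⟶ V') (c : V' ⟶ X), φ V hV (a ≫ c) = a ≫ φ V' hV' c) :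
    ∃ g : X ⟶ W, ∀ V hV c, c ≫ g = φ V hV c := by
  obtain ⟨g, hg⟩ := (hP.jointlyEpi X).exists_glue (fun p => φ p.1.1 p.1.2 p.2) (by
    intro Z i j a b h
    refine hP _ _ fun V hV c => ?_
    rw [← Category.assoc, ← Category.assoc, ← hφ _ _ hV, ← hφ _ _ hV, Category.assoc,
      Category.assoc, h])
  exact ⟨g, fun V hV c => hg ⟨⟨V, hV⟩, c⟩⟩

theorem isIso_of_points {P : ObjectProperty D} (hP : P.IsSeparating) {X W : D} (f : X ⟶ W)
    (hf : ∀ V, P V → Function.Bijective (fun c : V ⟶ X => c ≫ f)) : IsIso f := by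
  choose φ hφ using fun V hV => (hf V hV).2
  dsimp only at hφ
  obtain ⟨g, hg⟩ := exists_hom_of_points hP φ (by
    intro V V' hV hV' a c
    apply (hf V hV).1
    dsimp only
    rw [hφ, Category.assoc, hφ])
  refine ⟨g, hP _ _ fun V hV c => (hf V hV).1 ?_, hP _ _ fun V hV c => ?_⟩
  · dsimp only
    rw [← Category.assoc, hg _ hV, hφ, Category.comp_id]
  · rw [← Category.assoc, hg _ hV, hφ, Category.comp_id]

lemma IsConn.of_hom {V W : D} (hV : ¬ Nonempty (IsInitial V)) (f : V ⟶ W) :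
    ¬ Nonempty (IsInitial W) := by
  rintro ⟨h⟩
  have := h.isIso_to f
  exact hV ⟨h.ofIso (asIso f).symm⟩

lemma binaryCofan_disjoint {X Y Z : D} {i₁ : X ⟶ Z} {i₂ : Y ⟶ Z}
    (h : IsColimit (BinaryCofan.mk i₁ i₂)) {V : D} (hV : ¬ Nonempty (IsInitial V))
    (a : V ⟶ X) (b : V ⟶ Y) : a ≫ i₁ ≠ b ≫ i₂ := by
  intro e
  have := FinitaryExtensive.isPullback_initial_to_binaryCofan h
  exact IsConn.of_hom hV (this.lift a b e) ⟨initialIsInitial⟩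

/-- Sums are universal, so `V` is the sum of its pullbacks along `i₁` and `i₂`. One of these is
initial, hence the projection from the other is invertible. -/
lemma IsConn.binaryCofan_factor {X Y Z : D} {i₁ : X ⟶ Z} {i₂ : Y ⟶ Z}
    (h : IsColimit (BinaryCofan.mk i₁ i₂)) {V : D} (hV : IsConn V) (f : V ⟶ Z) :
    (∃ a, a ≫ i₁ = f) ∨ (∃ b, b ≫ i₂ = f) := by
  obtain ⟨hc⟩ := ((BinaryCofan.isVanKampen_iff _).1 (FinitaryExtensive.vanKampen _ h)
    (BinaryCofan.mk (pullback.fst f i₁) (pullback.fst f i₂)) (pullback.snd f i₁)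
    (pullback.snd f i₂) f pullback.condition.symm pullback.condition.symm).2
      ⟨.of_hasPullback _ _, .of_hasPullback _ _⟩
  rcases hV.connected _ _ _ _ ⟨hc⟩ with ⟨⟨h1⟩⟩ | ⟨⟨h1⟩⟩
  · have : IsIso (pullback.fst f i₂) := (BinaryCofan.isColimit_iff_isIso_inr h1 _).1 ⟨hc⟩
    exact .inr ⟨inv (pullback.fst f i₂) ≫ pullback.snd f i₂, by simp [← pullback.condition]⟩
  · have : IsIso (pullback.fst f i₁) := (BinaryCofan.isColimit_iff_isIso_inl h1 _).1 ⟨hc⟩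
    exact .inl ⟨inv (pullback.fst f i₁) ≫ pullback.snd f i₁, by simp [← pullback.condition]⟩

/-- Collapsing all the other summands to a point compares `ι i` with a coprojection of a binary sum,
which is a monomorphism. -/
lemma mono_of_isColimit_cofan {I : Type w} {Z : I → D} {X : D} {ι : ∀ i, Z i ⟶ X}
    (h : IsColimit (Cofan.mk X ι)) (i : I) : Mono (ι i) := by
  classical
  let r : X ⟶ Z i ⨿ ⊤_ D := Cofan.IsColimit.desc h fun j =>
    if e : j = i then eqToHom (congrArg Z e) ≫ coprod.inl else terminal.from _ ≫ coprod.inr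
  have hr : ι i ≫ r = coprod.inl := by
    refine (Cofan.IsColimit.fac h _ i).trans ?_
    simp
  have : Mono (ι i ≫ r) := hr ▸ inferInstance
  exact mono_of_mono (ι i) r

lemma cofan_disjoint {I : Type w} {Z : I → D} {X : D} {ι : ∀ i, Z i ⟶ X}
    (h : IsColimit (Cofan.mk X ι)) {V : D} (hV : ¬ Nonempty (IsInitial V)) {i j : I}
    (a : V ⟶ Z i) (b : V ⟶ Z j) (e : a ≫ ι i = b ≫ ι j) : i = j := by
  classical
  by_contra hij
  let r : X ⟶ (⊤_ D) ⨿ (⊤_ D) := Cofan.IsColimit.desc h fun k =>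
    if k = i then terminal.from _ ≫ coprod.inl else terminal.from _ ≫ coprod.inr
  have hi : ι i ≫ r = terminal.from _ ≫ coprod.inl :=
    (Cofan.IsColimit.fac h _ i).trans (by simp)
  have hj : ι j ≫ r = terminal.from _ ≫ coprod.inr :=
    (Cofan.IsColimit.fac h _ j).trans (by simp [Ne.symm hij])
  refine binaryCofan_disjoint (coprodIsCoprod (⊤_ D) (⊤_ D)) hV (a ≫ terminal.from _)
    (b ≫ terminal.from _) ?_
  rw [Category.assoc, Category.assoc, ← hi, ← hj, ← Category.assoc, e, Category.assoc]

/-- The points of a sum with values in a connected object. -/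
theorem IsConn.bijective_cofan {I : Type w} {Z : I → D} {X : D} {ι : ∀ i, Z i ⟶ X}
    (h : IsColimit (Cofan.mk X ι)) {V : D} (hV : IsConn V) :
    Function.Bijective (fun p : Σ i, (V ⟶ Z i) => p.2 ≫ ι p.1) := by
  classical
  constructor
  · rintro ⟨i, a⟩ ⟨j, b⟩ e
    obtain rfl := cofan_disjoint h hV.not_isInitial a b e
    have := mono_of_isColimit_cofan h i
    exact congrArg _ ((cancel_mono (ι i)).1 e)
  · intro f
    -- `r i` is the characteristic function of the summand `Z i`. As `V` is connected, `f ≫ r i`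
    -- takes a single value; if it were "outside" for every `i`, the preimages of the `Z i`, which
    -- cover `V`, would all be initial.
    let r (i : I) : X ⟶ (⊤_ D) ⨿ (⊤_ D) := Cofan.IsColimit.desc h fun k =>
      if k = i then terminal.from _ ≫ coprod.inl else terminal.from _ ≫ coprod.inr
    have hr (i) : ι i ≫ r i = terminal.from _ ≫ coprod.inl :=
      (Cofan.IsColimit.fac h _ i).trans (by simp)
    have hr' (i j) (hij : j ≠ i) : ι j ≫ r i = terminal.from _ ≫ coprod.inr :=
      (Cofan.IsColimit.fac h _ j).trans (by simp [hij])
    have hepi : JointlyEpi ι := fun Z' g g' H => Cofan.IsColimit.hom_ext h _ _ H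
    have hepi' := hepi.pullback f
    have hdis (W : D) (a : W ⟶ ⊤_ D) (b : W ⟶ ⊤_ D)
        (e : a ≫ coprod.inl (Y := ⊤_ D) = b ≫ coprod.inr) : Nonempty (IsInitial W) := by
      by_contra hW
      exact binaryCofan_disjoint (coprodIsCoprod (⊤_ D) (⊤_ D)) hW a b e
    obtain ⟨i, hi⟩ : ∃ i, ∃ a, a ≫ coprod.inl = f ≫ r i := by
      by_contra! H
      have H' (i) : f ≫ r i = terminal.from _ ≫ coprod.inr := by
        rcases hV.binaryCofan_factor (coprodIsCoprod (⊤_ D) (⊤_ D)) (f ≫ r i) with ⟨a, ha⟩ | ⟨b, hb⟩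
        · exact absurd ha (H i a)
        · rw [← hb]; congr 1; exact Subsingleton.elim _ _
      refine binaryCofan_disjoint (coprodIsCoprod (⊤_ D) (⊤_ D)) hV.not_isInitial
        (terminal.from _) (terminal.from _) (hepi' _ _ ?_)
      rintro ⟨W, i, ⟨a, b⟩, e⟩
      refine (hdis W (b ≫ terminal.from _) (a ≫ terminal.from _) ?_).some.hom_ext _ _
      rw [Category.assoc, ← hr i, Category.assoc, ← H' i, ← Category.assoc, ← e, Category.assoc]
    obtain ⟨a₀, ha₀⟩ := hi
    -- For the index just found, the preimage of `Z i` alone covers `V`; the local lifts glue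
    -- because `ι i` is a monomorphism.
    have hepi'' : JointlyEpi (fun p : Σ W, {p : (W ⟶ V) × (W ⟶ Z i) // p.1 ≫ f = p.2 ≫ ι i} =>
        p.2.1.1) := by
      intro Z' g g' H
      refine hepi' _ _ ?_
      rintro ⟨W, j, ⟨a, b⟩, e⟩
      by_cases hij : j = i
      · subst hij
        exact H ⟨W, ⟨a, b⟩, e⟩
      · refine (hdis W (a ≫ a₀) (b ≫ terminal.from _) ?_).some.hom_ext _ _
        rw [Category.assoc, ha₀, Category.assoc, ← hr' i j hij, ← Category.assoc, e, Category.assoc]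
    have := mono_of_isColimit_cofan h i
    obtain ⟨g, hg⟩ := hepi''.exists_glue (fun p => p.2.1.2) (by
      intro W p q a b hab
      rw [← cancel_mono (ι i), Category.assoc, ← p.2.2, Category.assoc, ← q.2.2,
        ← Category.assoc, hab, Category.assoc])
    refine ⟨⟨i, g⟩, hepi'' _ _ fun p => ?_⟩
    dsimp only
    rw [← Category.assoc, hg, p.2.2]

/-- Locally constant functions on a connected object are constant. -/
theorem IsConn.exists_eq_of_locally_const (hl : IsLocallyConnectedTopos D) {V : D}
    (hV : IsConn V) {ι : Type*} {U : ι → D}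
    {f : ∀ i, U i ⟶ V} (hf : JointlyEpi f) {S : Type w} (s : ι → S)
    (hs : ∀ (W : D) (_ : IsConn W) (i j : ι) (a : W ⟶ U i) (b : W ⟶ U j),
      a ≫ f i = b ≫ f j → s i = s j) :
    ∃ s₀, ∀ i, IsConn (U i) → s i = s₀ := by
  let X : D := ∐ fun _ : S => ⊤_ D
  -- The function `s` becomes a morphism from `V` to the constant object on `S`, and a connected `V`
  -- meets only one summand. Two members with a non-trivial overlap need only be compared on
  -- connected objects.
  obtain ⟨g, hg⟩ := hf.exists_glue (W := X)
    (fun i => terminal.from _ ≫ Sigma.ι (fun _ : S => ⊤_ D) (s i)) (by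
      intro Z i j a b hab
      refine hl.isConn_isSeparating _ _ fun W hW c => ?_
      rw [hs W hW i j (c ≫ a) (c ≫ b) (by simp [hab])]
      simp only [← Category.assoc]
      congr 1
      exact Subsingleton.elim _ _)
  obtain ⟨⟨s₀, t⟩, ht⟩ := (hV.bijective_cofan (coproductIsCoproduct (fun _ : S => ⊤_ D))).2 g
  refine ⟨s₀, fun i hi => ?_⟩
  refine cofan_disjoint (coproductIsCoproduct (fun _ : S => ⊤_ D)) hi.not_isInitial
    (terminal.from _) (f i ≫ t) ?_
  refine (hg i).symm.trans ?_
  rw [← ht, Category.assoc]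

/-- A cofan is a sum if it is so on the points with values in connected objects. -/
theorem nonempty_isColimit_cofan (hl : IsLocallyConnectedTopos D) {I : Type w} {Z : I → D} {X : D}
    (ι : ∀ i, Z i ⟶ X)
    (h : ∀ V, IsConn V → Function.Bijective (fun p : Σ i, (V ⟶ Z i) => p.2 ≫ ι p.1)) :
    Nonempty (IsColimit (Cofan.mk X ι)) := by
  have : IsIso (Sigma.desc ι) := by
    refine isIso_of_points hl.isConn_isSeparating _ fun V hV => ?_
    have h1 := hV.bijective_cofan (coproductIsCoproduct Z)
    refine (Function.Bijective.of_comp_iff _ h1).1 ?_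
    convert h V hV using 2 with p
    simp
  let e := asIso (Sigma.desc ι)
  exact ⟨IsColimit.ofIsoColimit (coproductIsCoproduct Z) (Cofan.ext e (by simp [e]))⟩

/-- The object `V` splits `X`: the points of `X` with values in `V` are the same as those with values
in any connected object above `V`. -/
def Splits (V X : D) : Prop :=
  ∀ (W : D), IsConn W → ∀ f : W ⟶ V, Function.Bijective (fun s : V ⟶ X => f ≫ s)

omit [IsTopos D] in
lemma Splits.of_hom {V V' X : D} (hV' : IsConn V') (h : Splits V X) (a : V' ⟶ V) :
    Splits V' X := by
  intro W hW f
  have h1 := h V' hV' a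
  have h2 := h W hW (f ≫ a)
  refine (Function.Bijective.of_comp_iff _ h1).1 ?_
  convert h2 using 2 with s
  simp

/-- The final object of the slice is the identity of `U`, and the forgetful functor preserves and
reflects sums. Constancy over `U` thus means being a sum of sections of the projection. -/
lemma trivializes_iff_exists_cofan {U F : D} : Trivializes U F ↔
    ∃ (P : D) (fst : P ⟶ F) (snd : P ⟶ U) (_ : IsLimit (BinaryFan.mk fst snd)) (I : Type w)
      (s : I → (U ⟶ P)), (∀ i, s i ≫ snd = 𝟙 U) ∧
        Nonempty (IsColimit (Cofan.mk (f := fun _ => U) P s)) := by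
  constructor
  · rintro ⟨P, fst, snd, ⟨h⟩, I, t, ι, ⟨ht⟩, ⟨hι⟩⟩
    let e : Over.mk (𝟙 U) ≅ t := Over.mkIdTerminal.uniqueUpToIso ht
    refine ⟨P, fst, snd, h, I, fun i => (e.hom ≫ ι i).left, fun i => Over.w (e.hom ≫ ι i), ?_⟩
    have h1 : IsColimit (Cofan.mk (Over.mk snd) fun i => e.hom ≫ ι i) :=
      (IsColimit.precomposeHomEquiv (Discrete.natIso fun _ => e) _).symm hι |>.ofIsoColimit
        (Cocone.ext (Iso.refl _) (by rintro ⟨i⟩; simp))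
    exact ⟨isColimitMapCoconeCofanMkEquiv (Over.forget U) _ _
      (isColimitOfPreserves (Over.forget U) h1)⟩
  · rintro ⟨P, fst, snd, h, I, s, hs, ⟨hι⟩⟩
    refine ⟨P, fst, snd, ⟨h⟩, I, Over.mk (𝟙 U), fun i => Over.homMk (s i) (hs i),
      ⟨Over.mkIdTerminal⟩, ⟨?_⟩⟩
    exact isColimitOfReflects (Over.forget U)
      ((isColimitMapCoconeCofanMkEquiv (Over.forget U) (fun _ => Over.mk (𝟙 U)) _).symm hι)

/-- If `U` trivializes `F`, all connected objects over `U` split `F`. -/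
theorem Trivializes.splits {U F V : D} (h : Trivializes U F) (hV : IsConn V) (v : V ⟶ U) :
    Splits V F := by
  obtain ⟨P, fst, snd, hP, I, s, hs, ⟨hι⟩⟩ := trivializes_iff_exists_cofan.1 h
  -- The points of `F` on any connected object over `U` are indexed by the same set `I`, compatibly
  -- with restriction.
  have key (W : D) (hW : IsConn W) (w : W ⟶ U) :
      Function.Bijective (fun i : I => w ≫ s i ≫ fst) := by
    have hb := hW.bijective_cofan hι
    constructor
    · intro i j e
      refine cofan_disjoint hι hW.not_isInitial w w ?_
      refine BinaryFan.IsLimit.hom_ext hP (by simpa using e) ?_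
      change (w ≫ s i) ≫ snd = (w ≫ s j) ≫ snd
      simp [hs]
    · intro x
      obtain ⟨⟨i, a⟩, ha⟩ := hb.2 (hP.lift (BinaryFan.mk x w))
      have h1 : hP.lift (BinaryFan.mk x w) ≫ fst = x := hP.fac _ ⟨WalkingPair.left⟩
      have h2 : hP.lift (BinaryFan.mk x w) ≫ snd = w := hP.fac _ ⟨WalkingPair.right⟩
      dsimp only at ha
      rw [← ha, Category.assoc, hs, Category.comp_id] at h2
      rw [← ha, Category.assoc, h2] at h1
      exact ⟨i, h1⟩
  intro W hW f
  refine (Function.Bijective.of_comp_iff _ (key V hV v)).1 ?_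
  convert key W hW (f ≫ v) using 2 with i
  simp

omit [IsTopos D] in
lemma exists_binaryProduct [HasFiniteLimits D] (X Y : D) :
    ∃ (P : D) (fst : P ⟶ X) (snd : P ⟶ Y), Nonempty (IsLimit (BinaryFan.mk fst snd)) :=
  ⟨X ⨯ Y, prod.fst, prod.snd, ⟨prodIsProd X Y⟩⟩

/-- If `U` splits `F`, the product `F × U` is the sum of the graphs of the morphisms `U ⟶ F`. -/
theorem Splits.nonempty_isColimit (hl : IsLocallyConnectedTopos D) {U F : D} (h : Splits U F)
    {P : D} {fst : P ⟶ F} {snd : P ⟶ U} (hP : IsLimit (BinaryFan.mk fst snd)) :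
    Nonempty (IsColimit (Cofan.mk (f := fun _ : U ⟶ F => U) P
      fun s => hP.lift (BinaryFan.mk s (𝟙 U)))) := by
  have h1 (s : U ⟶ F) : hP.lift (BinaryFan.mk s (𝟙 U)) ≫ fst = s := hP.fac _ ⟨WalkingPair.left⟩
  have h2 (s : U ⟶ F) : hP.lift (BinaryFan.mk s (𝟙 U)) ≫ snd = 𝟙 U :=
    hP.fac _ ⟨WalkingPair.right⟩
  refine nonempty_isColimit_cofan hl _ fun V hV => ⟨?_, fun x => ?_⟩
  · rintro ⟨s, a⟩ ⟨t, b⟩ e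
    obtain rfl : a = b := by
      simpa only [Category.assoc, h2, Category.comp_id] using congrArg (· ≫ snd) e
    obtain rfl : s = t := (h V hV a).1 (by
      simpa only [Category.assoc, h1] using congrArg (· ≫ fst) e)
    rfl
  · obtain ⟨s, hs⟩ := (h V hV (x ≫ snd)).2 (x ≫ fst)
    dsimp only at hs
    refine ⟨⟨s, x ≫ snd⟩, BinaryFan.IsLimit.hom_ext hP ?_ ?_⟩
    · change ((x ≫ snd) ≫ _) ≫ fst = x ≫ fst
      rw [Category.assoc, h1, hs]
    · change ((x ≫ snd) ≫ _) ≫ snd = x ≫ snd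
      rw [Category.assoc, h2, Category.comp_id]

theorem Splits.trivializes (hl : IsLocallyConnectedTopos D) {U F : D} (h : Splits U F) :
    Trivializes U F := by
  obtain ⟨P, fst, snd, ⟨hP⟩⟩ := exists_binaryProduct F U
  exact trivializes_iff_exists_cofan.2 ⟨P, fst, snd, hP, (U ⟶ F), _,
    fun s => hP.fac _ ⟨WalkingPair.right⟩, h.nonempty_isColimit hl hP⟩

lemma splits_of_isInitial {U F : D} (hU : IsInitial U) : Splits U F :=
  fun _ hW f => (IsConn.of_hom hW.not_isInitial f ⟨hU⟩).elim

variable (D) in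
/-- The connected objects which split `F`. -/
def splitting (F : D) : ObjectProperty D := fun V => IsConn V ∧ Splits V F

/-- A trivializing cover can be refined by connected objects, which split `F`; conversely a
splitting object trivializes `F`, with constant fiber Hom(U, F). -/
theorem isLocallyConstantObject_iff (hl : IsLocallyConnectedTopos D) {F : D} :
    IsLocallyConstantObject F ↔ (splitting D F).IsSeparating := by
  constructor
  · intro h X Z g g' H
    refine jointlyEpi_of_mem_canonicalTopology (h X) _ _ ?_
    rintro ⟨W, f, ⟨⟨U, hU⟩, ⟨a⟩⟩⟩
    refine hl.isConn_isSeparating _ _ fun V hV c => ?_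
    rw [← Category.assoc, ← Category.assoc]
    exact H V ⟨hV, hU.splits hV (c ≫ a)⟩ _
  · intro h X
    refine mem_canonicalTopology _ fun Z g g' H => h _ _ fun V hV c => ?_
    exact H ⟨V, c, ⟨V, hV.2.trivializes hl⟩, ⟨𝟙 V⟩⟩

end Points

/-! ### Unique continuation, and stability of sums of locally constant objects -/

section SumsOfLocallyConstant

variable {D : Type (w + 1)} [LargeCategory.{w} D] [IsTopos D]

/-- Otherwise nothing would distinguish the two constant morphisms from `V` to `1 ⨿ 1`, contrary to
the disjointness of sums. This argument recurs below whenever a non-initial object has to receive a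
morphism. -/
lemma exists_hom_of_isSeparating {P : ObjectProperty D} (hP : P.IsSeparating) {V : D}
    (hV : ¬ Nonempty (IsInitial V)) : ∃ W, P W ∧ Nonempty (W ⟶ V) := by
  by_contra! H
  refine binaryCofan_disjoint (coprodIsCoprod (⊤_ D) (⊤_ D)) hV (terminal.from _)
    (terminal.from _) (hP _ _ fun W hW c => ?_)
  exact ((H W hW).false c).elim

omit [IsTopos D] in
lemma isSeparating_inf {P Q : ObjectProperty D} (hP : P.IsSeparating) (hQ : Q.IsSeparating)
    {R : ObjectProperty D} (h : ∀ V W, P V → Q W → (W ⟶ V) → R W) : R.IsSeparating :=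
  fun _ _ _ _ H => hP _ _ fun V hV c => hQ _ _ fun W hW d => by
    simpa using H W (h V W hV hW d) (d ≫ c)

/-- Propagation along a connected object: the truth value of `p` is a locally constant function,
hence it is the same on all connected members of the cover. -/
lemma IsConn.forall_of_locally_const (hl : IsLocallyConnectedTopos D) {V : D}
    (hV : IsConn V) {ι : Type*} {U : ι → D} {f : ∀ i, U i ⟶ V} (hf : JointlyEpi f) (p : ι → Prop)
    (hp : ∀ (W : D) (_ : IsConn W) (i j : ι) (a : W ⟶ U i) (b : W ⟶ U j),
      a ≫ f i = b ≫ f j → p i → p j) {i₀ : ι} (hi₀ : IsConn (U i₀)) (h₀ : p i₀) :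
    ∀ i, IsConn (U i) → p i := by
  obtain ⟨s₀, hs⟩ := hV.exists_eq_of_locally_const hl hf (fun i => ULift.up.{w} (p i))
    (fun W hW i j a b e => congrArg _ (propext ⟨hp W hW i j a b e, hp W hW j i b a e.symm⟩))
  intro i hi
  have := congrArg ULift.down ((hs i hi).trans (hs i₀ hi₀).symm)
  exact this.mpr h₀

/-- The class of objects `Z` whose points are determined by their restrictions. -/
def HasInjectiveRestrictions (Z : D) : Prop :=
  ∀ V W : D, IsConn V → IsConn W → ∀ f : V ⟶ W, Function.Injective (fun s : W ⟶ Z => f ≫ s)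

/-- On objects splitting `Z`, agreement of `s` and `t` can be tested on any connected object above.
So it is a locally constant condition on `W`; it holds somewhere because of `V`, hence everywhere.
-/
theorem HasInjectiveRestrictions.of_isLocallyConstantObject (hl : IsLocallyConnectedTopos D)
    {Z : D} (hZ : IsLocallyConstantObject Z) : HasInjectiveRestrictions Z := by
  intro V W hV hW f s t hst
  have hsep := (isLocallyConstantObject_iff hl).1 hZ
  obtain ⟨U, hU, ⟨u⟩⟩ := exists_hom_of_isSeparating hsep hV.not_isInitial
  have hp := hW.forall_of_locally_const hl (hsep.jointlyEpi W)
    (fun p => p.2 ≫ s = p.2 ≫ t) (by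
      intro X hX i j a b hab
      rw [← (i.1.2.2 X hX a).1.eq_iff, ← (j.1.2.2 X hX b).1.eq_iff]
      simp only [← Category.assoc, hab, imp_self]) (i₀ := ⟨⟨U, hU⟩, u ≫ f⟩) hU.1
      (by simpa using congrArg (u ≫ ·) hst)
  exact hsep _ _ fun X hX c => hp ⟨⟨X, hX⟩, c⟩ hX.1

theorem isSLC.hasInjectiveRestrictions (hl : IsLocallyConnectedTopos D) {Z : D}
    (hZ : isSLC D Z) : HasInjectiveRestrictions Z := by
  obtain ⟨I, Z', ι, hZ', ⟨h⟩⟩ := hZ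
  intro V W hV hW f s t hst
  obtain ⟨⟨i, s⟩, rfl⟩ := (hW.bijective_cofan h).2 s
  obtain ⟨⟨j, t⟩, rfl⟩ := (hW.bijective_cofan h).2 t
  simp only [← Category.assoc] at hst
  obtain rfl : i = j := cofan_disjoint h hV.not_isInitial _ _ hst
  have := mono_of_isColimit_cofan h i
  have := HasInjectiveRestrictions.of_isLocallyConstantObject hl (hZ' i) V W hV hW f
    ((cancel_mono (ι i)).1 hst)
  rw [this]

omit [IsTopos D] in
theorem isSLC.of_cofan {I : Type w} {Z : I → D} {X : D} {ι : ∀ i, Z i ⟶ X}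
    (h : IsColimit (Cofan.mk X ι)) (hZ : ∀ i, isSLC D (Z i)) : isSLC D X := by
  choose K Z' κ hZ' hκ using hZ
  refine ⟨Σ i, K i, fun p => Z' p.1 p.2, fun p => κ p.1 p.2 ≫ ι p.1, fun p => hZ' _ _, ⟨?_⟩⟩
  refine Cofan.IsColimit.mk _ (fun s => Cofan.IsColimit.desc h fun i =>
    Cofan.IsColimit.desc (hκ i).some fun k => s.inj ⟨i, k⟩) ?_ ?_
  · rintro s ⟨i, k⟩
    refine (Category.assoc _ _ _).trans ?_
    have h1 := Cofan.IsColimit.fac h (fun i =>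
      Cofan.IsColimit.desc (hκ i).some fun k => s.inj ⟨i, k⟩) i
    have h2 := Cofan.IsColimit.fac (hκ i).some (fun k => s.inj ⟨i, k⟩) k
    exact (congrArg _ h1).trans h2
  · intro s m hm
    refine Cofan.IsColimit.hom_ext h _ _ fun i => Cofan.IsColimit.hom_ext (hκ i).some _ _ fun k => ?_
    have h1 := Cofan.IsColimit.fac h (fun i =>
      Cofan.IsColimit.desc (hκ i).some fun k => s.inj ⟨i, k⟩) i
    have h2 := Cofan.IsColimit.fac (hκ i).some (fun k => s.inj ⟨i, k⟩) k
    refine Eq.trans ?_ ((congrArg _ h1).trans h2).symm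
    refine Eq.trans ?_ (hm ⟨i, k⟩)
    exact (Category.assoc _ _ _).symm

omit [IsTopos D] in
theorem isSLC.of_isLocallyConstantObject {X : D} (hX : IsLocallyConstantObject X) : isSLC D X :=
  ⟨PUnit, fun _ => X, fun _ => 𝟙 X, fun _ => hX, ⟨Cofan.IsColimit.mk _ (fun s => s.inj ⟨⟩)
    (fun s _ => Category.id_comp _) (fun s m hm => by
      refine Eq.trans ?_ (hm ⟨⟩)
      exact (Category.id_comp _).symm)⟩⟩

theorem isSLC_of_isTerminal (hl : IsLocallyConnectedTopos D) {X : D} (hX : IsTerminal X) :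
    isSLC D X := by
  refine .of_isLocallyConstantObject ((isLocallyConstantObject_iff hl).2 fun A B g h H =>
    hl.isConn_isSeparating _ _ fun V hV c => H V ⟨hV, fun W hW f => ?_⟩ c)
  exact ⟨fun _ _ _ => hX.hom_ext _ _, fun x => ⟨hX.from _, hX.hom_ext _ _⟩⟩

/-- `P` is the sum of the fiber products of the summands, and an object which splits both factors
splits their fiber product: the two extended points agree in `Z` by unique continuation, without `Z`
having to be split. -/
theorem isSLC.of_isPullback (hl : IsLocallyConnectedTopos D) {P X Y Z : D} {fst : P ⟶ X}
    {snd : P ⟶ Y} {f : X ⟶ Z} {g : Y ⟶ Z} (h : IsPullback fst snd f g) (hX : isSLC D X)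
    (hY : isSLC D Y) (hZ : isSLC D Z) : isSLC D P := by
  obtain ⟨I, X', ι, hX', ⟨hι⟩⟩ := hX
  obtain ⟨K, Y', κ, hY', ⟨hκ⟩⟩ := hY
  have hZ' := hZ.hasInjectiveRestrictions hl
  let m (p : I × K) : pullback (ι p.1 ≫ f) (κ p.2 ≫ g) ⟶ P :=
    h.lift (pullback.fst _ _ ≫ ι p.1) (pullback.snd _ _ ≫ κ p.2) (by
      simp only [Category.assoc, pullback.condition])
  have hm1 (p) : m p ≫ fst = pullback.fst _ _ ≫ ι p.1 := h.lift_fst _ _ _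
  have hm2 (p) : m p ≫ snd = pullback.snd _ _ ≫ κ p.2 := h.lift_snd _ _ _
  refine ⟨I × K, _, m, fun p => ?_, nonempty_isColimit_cofan hl _ fun V hV => ⟨?_, fun x => ?_⟩⟩
  · refine (isLocallyConstantObject_iff hl).2 (isSeparating_inf
      ((isLocallyConstantObject_iff hl).1 (hX' p.1))
      ((isLocallyConstantObject_iff hl).1 (hY' p.2)) ?_)
    intro V U hV hU a
    refine ⟨hU.1, fun W hW c => ⟨fun s t hst => ?_, fun x => ?_⟩⟩
    · have h1 := hV.2.of_hom hU.1 a W hW c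
      have h2 := hU.2 W hW c
      refine pullback.hom_ext (h1.1 ?_) (h2.1 ?_)
      · simpa using congrArg (· ≫ pullback.fst _ _) hst
      · simpa using congrArg (· ≫ pullback.snd _ _) hst
    · obtain ⟨s, hs⟩ := (hV.2.of_hom hU.1 a W hW c).2 (x ≫ pullback.fst _ _)
      obtain ⟨t, ht⟩ := (hU.2 W hW c).2 (x ≫ pullback.snd _ _)
      dsimp only at hs ht
      refine ⟨pullback.lift s t (hZ' W U hW hU.1 c ?_), ?_⟩
      · dsimp only
        rw [reassoc_of% hs, reassoc_of% ht, pullback.condition]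
      · refine pullback.hom_ext ?_ ?_
        · rw [Category.assoc, pullback.lift_fst, hs]
        · rw [Category.assoc, pullback.lift_snd, ht]
  · rintro ⟨p, a⟩ ⟨q, b⟩ e
    dsimp only at e
    have e1 : (a ≫ pullback.fst _ _) ≫ ι p.1 = (b ≫ pullback.fst _ _) ≫ ι q.1 := by
      rw [Category.assoc, Category.assoc, ← hm1, ← hm1, reassoc_of% e]
    have e2 : (a ≫ pullback.snd _ _) ≫ κ p.2 = (b ≫ pullback.snd _ _) ≫ κ q.2 := by
      rw [Category.assoc, Category.assoc, ← hm2, ← hm2, reassoc_of% e]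
    obtain rfl : p = q := Prod.ext (cofan_disjoint hι hV.not_isInitial _ _ e1)
      (cofan_disjoint hκ hV.not_isInitial _ _ e2)
    have := mono_of_isColimit_cofan hι p.1
    have := mono_of_isColimit_cofan hκ p.2
    exact congrArg _ (pullback.hom_ext ((cancel_mono (ι p.1)).1 e1) ((cancel_mono (κ p.2)).1 e2))
  · obtain ⟨⟨i, a⟩, ha⟩ := (hV.bijective_cofan hι).2 (x ≫ fst)
    obtain ⟨⟨k, b⟩, hb⟩ := (hV.bijective_cofan hκ).2 (x ≫ snd)
    dsimp only at ha hb
    refine ⟨⟨(i, k), pullback.lift a b ?_⟩, h.hom_ext ?_ ?_⟩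
    · rw [reassoc_of% ha, reassoc_of% hb, h.w]
    · simp only [Category.assoc, hm1, ← ha]
      rw [pullback.lift_fst_assoc]
    · simp only [Category.assoc, hm2, ← hb]
      rw [pullback.lift_snd_assoc]

end SumsOfLocallyConstant

/-! ### Limits, sums and connected objects of `SLC T` -/

section Category

variable {T : Type (w + 1)} [LargeCategory.{w} T] [IsTopos T] [hl : Fact (IsLocallyConnectedTopos T)]

instance : (isSLC T).IsClosedUnderLimitsOfShape WalkingCospan where
  limitsOfShape_le := by
    rintro X ⟨p⟩
    refine isSLC.of_isPullback hl.out (fst := p.π.app .left) (snd := p.π.app .right)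
      (f := p.diag.map WalkingCospan.Hom.inl) (g := p.diag.map WalkingCospan.Hom.inr) ?_
      (p.prop_diag_obj _) (p.prop_diag_obj _) (p.prop_diag_obj _)
    refine ⟨⟨?_⟩, ⟨?_⟩⟩
    · rw [← NatTrans.naturality, ← NatTrans.naturality]; rfl
    · exact ((IsLimit.postcomposeHomEquiv (diagramIsoCospan p.diag) _).symm
        p.isLimit).ofIsoLimit (PullbackCone.isoMk _)

instance : (isSLC T).IsClosedUnderLimitsOfShape (Discrete PEmpty.{1}) where
  limitsOfShape_le := by
    rintro X ⟨p⟩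
    exact isSLC_of_isTerminal hl.out (isLimitEquivIsTerminalOfIsEmpty T _ p.isLimit)

omit hl in
instance (I : Type w) : (isSLC T).IsClosedUnderColimitsOfShape (Discrete I) where
  colimitsOfShape_le := by
    rintro X ⟨p⟩
    refine isSLC.of_cofan (Z := fun i => p.diag.obj ⟨i⟩) (ι := fun i => p.ι.app ⟨i⟩) ?_
      (fun i => p.prop_diag_obj _)
    exact (IsColimit.precomposeHomEquiv (Discrete.natIsoFunctor (F := p.diag)).symm _).symm p.isColimit
      |>.ofIsoColimit (Cocone.ext (Iso.refl _) (by rintro ⟨i⟩; simp))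

instance : HasPullbacks (SLC T) := hasLimitsOfShape_of_closedUnderLimits _ _
instance : HasTerminal (SLC T) := hasLimitsOfShape_of_closedUnderLimits _ _
instance : HasFiniteLimits (SLC T) := hasFiniteLimits_of_hasTerminal_and_pullbacks
omit hl in
instance (I : Type w) : HasColimitsOfShape (Discrete I) (SLC T) :=
  hasColimitsOfShape_of_closedUnderColimits _ _
instance : PreservesFiniteLimits (isSLC T).ι :=
  preservesFiniteLimits_of_preservesTerminal_and_pullbacks _

omit hl in
/-- The sums in `SLC T` are those of `T`. -/
lemma isColimit_cofan_slc_iff {I : Type w} {Z : I → SLC T} {X : SLC T} {ι : ∀ i, Z i ⟶ X} :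
    Nonempty (IsColimit (Cofan.mk X ι)) ↔
      Nonempty (IsColimit (Cofan.mk X.obj fun i => (ι i).hom)) := by
  constructor
  · rintro ⟨h⟩
    exact ⟨isColimitMapCoconeCofanMkEquiv (isSLC T).ι _ _
      (isColimitOfPreserves (isSLC T).ι h)⟩
  · rintro ⟨h⟩
    exact ⟨isColimitOfReflects (isSLC T).ι
      ((isColimitMapCoconeCofanMkEquiv (isSLC T).ι Z _).symm h)⟩

omit hl in
lemma isColimit_binaryCofan_slc_iff {X Y Z : SLC T} {i : X ⟶ Z} {j : Y ⟶ Z} :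
    Nonempty (IsColimit (BinaryCofan.mk i j)) ↔
      Nonempty (IsColimit (BinaryCofan.mk i.hom j.hom)) := by
  have : PreservesColimitsOfShape (Discrete WalkingPair) (isSLC T).ι :=
    preservesColimitsOfShape_of_equiv (Discrete.equivalence (Equiv.ulift.{w}.trans (Equiv.refl _))) _
  constructor
  · rintro ⟨h⟩
    exact ⟨isColimitMapCoconeBinaryCofanEquiv (isSLC T).ι _ _
      (isColimitOfPreserves (isSLC T).ι h)⟩
  · rintro ⟨h⟩
    exact ⟨isColimitOfReflects (isSLC T).ι
      ((isColimitMapCoconeBinaryCofanEquiv (isSLC T).ι _ _).symm h)⟩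

omit hl in
lemma isSLC_bot : isSLC T (⊥_ T) :=
  ⟨PEmpty, fun i => i.elim, fun i => i.elim, fun i => i.elim, ⟨Cofan.IsColimit.mk _
    (fun _ => initial.to _) (fun _ i => i.elim) (fun _ _ _ => initialIsInitial.hom_ext _ _)⟩⟩

omit hl in
lemma nonempty_isInitial_slc_iff {X : SLC T} :
    Nonempty (IsInitial X) ↔ Nonempty (IsInitial X.obj) := by
  constructor
  · rintro ⟨h⟩
    let f := h.to ⟨⊥_ T, isSLC_bot⟩
    have := initialIsInitial.isIso_to f.hom
    exact ⟨initialIsInitial.ofIso (asIso f.hom).symm⟩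
  · rintro ⟨h⟩
    exact ⟨IsInitial.ofUniqueHom (fun Y => ⟨h.to _⟩) fun Y m => by
      ext; exact h.hom_ext _ _⟩

/-- Each summand of `Z` is intersected with `X`. An object `V` splitting the summand is connected,
so a point on it lies in `X` or in `Y`, and not in `Y` if its restriction lies in `X`. -/
theorem isSLC.of_binaryCofan {X Y Z : T} {i : X ⟶ Z} {j : Y ⟶ Z}
    (h : IsColimit (BinaryCofan.mk i j)) (hZ : isSLC T Z) : isSLC T X := by
  obtain ⟨I, Z', ι, hZ', ⟨hι⟩⟩ := hZ
  have hmi : Mono i := FinitaryExtensive.mono_inl_of_isColimit h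
  refine ⟨I, fun k => pullback i (ι k), fun k => pullback.fst _ _, fun k => ?_,
    nonempty_isColimit_cofan hl.out _ fun V hV => ⟨?_, fun x => ?_⟩⟩
  · have := mono_of_isColimit_cofan hι k
    have hk := (isLocallyConstantObject_iff hl.out).1 (hZ' k)
    refine (isLocallyConstantObject_iff hl.out).2 fun A B g g' H => hk _ _ fun V hV c =>
      H V ⟨hV.1, fun W hW f => ⟨fun s t e => ?_, fun y => ?_⟩⟩ c
    · rw [← cancel_mono (pullback.snd i (ι k))]
      refine (hV.2 W hW f).1 ?_
      simpa using congrArg (· ≫ pullback.snd _ _) e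
    · obtain ⟨s, hs⟩ := (hV.2 W hW f).2 (y ≫ pullback.snd _ _)
      dsimp only at hs
      rcases hV.1.binaryCofan_factor h (s ≫ ι k) with ⟨a, ha⟩ | ⟨b, hb⟩
      · refine ⟨pullback.lift a s ha, (cancel_mono (pullback.snd i (ι k))).1 ?_⟩
        rw [Category.assoc, pullback.lift_snd, hs]
      · refine (binaryCofan_disjoint h hW.not_isInitial (y ≫ pullback.fst _ _) (f ≫ b) ?_).elim
        rw [Category.assoc, Category.assoc, hb, reassoc_of% hs, pullback.condition]
  · rintro ⟨k, a⟩ ⟨l, b⟩ e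
    dsimp only at e
    have e' : (a ≫ pullback.snd _ _) ≫ ι k = (b ≫ pullback.snd _ _) ≫ ι l := by
      simp only [Category.assoc, ← pullback.condition]
      rw [reassoc_of% e]
    obtain rfl := cofan_disjoint hι hV.not_isInitial _ _ e'
    have := mono_of_isColimit_cofan hι k
    exact congrArg _ ((cancel_mono (pullback.fst i (ι k))).1 e)
  · obtain ⟨⟨k, a⟩, ha⟩ := (hV.bijective_cofan hι).2 (x ≫ i)
    exact ⟨⟨k, pullback.lift x a ha.symm⟩, pullback.lift_fst _ _ _⟩

/-- An object of `SLC T` is connected if and only if it is so in `T`. -/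
theorem isConnectedObject_slc_iff {X : SLC T} : IsConnectedObject X ↔ IsConnectedObject X.obj := by
  constructor
  · rintro h X₁ X₂ i₁ i₂ ⟨hi⟩
    have := h ⟨X₁, isSLC.of_binaryCofan hi X.2⟩
      ⟨X₂, isSLC.of_binaryCofan (BinaryCofan.isColimitFlip hi) X.2⟩ ⟨i₁⟩ ⟨i₂⟩
      (isColimit_binaryCofan_slc_iff.2 ⟨hi⟩)
    rwa [nonempty_isInitial_slc_iff, nonempty_isInitial_slc_iff] at this
  · intro h X₁ X₂ i₁ i₂ hi
    rw [nonempty_isInitial_slc_iff, nonempty_isInitial_slc_iff]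
    exact h _ _ _ _ (isColimit_binaryCofan_slc_iff.1 hi)

theorem isConn_slc_iff {X : SLC T} : IsConn X ↔ IsConn X.obj :=
  ⟨fun h => ⟨isConnectedObject_slc_iff.1 h.1, fun h' => h.2 (nonempty_isInitial_slc_iff.2 h')⟩,
    fun h => ⟨isConnectedObject_slc_iff.2 h.1, fun h' => h.2 (nonempty_isInitial_slc_iff.1 h')⟩⟩

/-- A morphism from a non-initial sum of locally constant objects to a connected one is an
epimorphism. -/
theorem epi_of_isConn {A B : T} (f : A ⟶ B) (hA : isSLC T A) (hA' : ¬ Nonempty (IsInitial A))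
    (hB : IsConn B) (hB' : HasInjectiveRestrictions B) : Epi f := by
  obtain ⟨I, Z, ι, hZ, ⟨hι⟩⟩ := hA
  obtain ⟨V, hV, ⟨a⟩⟩ := exists_hom_of_isSeparating hl.out.isConn_isSeparating hA'
  obtain ⟨⟨i, a'⟩, -⟩ := (hV.bijective_cofan hι).2 a
  have hsep := (isLocallyConstantObject_iff hl.out).1 (hZ i)
  obtain ⟨U, hU, ⟨u⟩⟩ := exists_hom_of_isSeparating hsep hV.not_isInitial
  -- The points of `B` on objects splitting `Z i` all lift to `Z i`: a lift over a common
  -- restriction extends by splitting, and it remains a lift by unique continuation in `B`.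
  have hp := hB.forall_of_locally_const hl.out (hsep.jointlyEpi B)
    (fun p => ∃ g, g ≫ ι i ≫ f = p.2) (by
      rintro W hW p q c d e ⟨g, hg⟩
      obtain ⟨g', hg'⟩ := (q.1.2.2 W hW d).2 (c ≫ g)
      dsimp only at hg'
      refine ⟨g', hB' W _ hW q.1.2.1 d ?_⟩
      simp only [← e, ← hg, ← Category.assoc, hg']) (i₀ := ⟨⟨U, hU⟩, (u ≫ a') ≫ ι i ≫ f⟩) hU.1
      ⟨_, rfl⟩
  refine ⟨fun g h e => hsep _ _ fun W hW c => ?_⟩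
  obtain ⟨d, hd⟩ := hp ⟨⟨W, hW⟩, c⟩ hW.1
  change d ≫ ι i ≫ f = c at hd
  rw [← hd]
  simp [e]

end Category

/-! ### Galois objects in terms of splitting -/

section Gal

variable {T : Type (w + 1)} [LargeCategory.{w} T] [IsTopos T]

/-- `Y` is connected, not initial, a sum of locally constant objects, and splits itself. -/
structure IsGal (Y : T) : Prop where
  isConn : IsConn Y
  slc : isSLC T Y
  splits : Splits Y Y

omit [IsTopos T] in
-- Splitting along `φ` itself provides `ψ` with `φ ≫ ψ = 𝟙`. A monoid in which every element is
-- invertible on the same side is a group.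
lemma IsGal.isIso {Y : T} (hY : IsGal Y) (φ : Y ⟶ Y) : IsIso φ := by
  obtain ⟨ψ, hψ⟩ := (hY.splits Y hY.isConn φ).2 (𝟙 Y)
  refine ⟨ψ, hψ, ?_⟩
  obtain ⟨χ, hχ⟩ := (hY.splits Y hY.isConn ψ).2 (𝟙 Y)
  dsimp only at hψ hχ
  have : φ = χ := by rw [← Category.comp_id φ, ← hχ, reassoc_of% hψ]
  rw [this, hχ]

omit [IsTopos T] in
/-- The automorphism group of a Galois object acts simply transitively on its points. -/
lemma IsGal.existsUnique_aut {Y : T} (hY : IsGal Y) {V : T} (hV : IsConn V) (s t : V ⟶ Y) :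
    ∃! φ : Aut Y, s ≫ φ.hom = t := by
  obtain ⟨φ, hφ⟩ := (hY.splits V hV s).2 t
  have := hY.isIso φ
  refine ⟨asIso φ, hφ, fun ψ hψ => ?_⟩
  ext
  exact (hY.splits V hV s).1 (hψ.trans hφ.symm)

variable [hl : Fact (IsLocallyConnectedTopos T)]

/-- A pair of points with values in a connected object lies in the graph of a single automorphism.
The initial object has to be excluded, as it satisfies the definition of a Galois object. -/
lemma isGal_of_isGaloisObject {Y : SLC T} (hY : IsGaloisObject Y)
    (h0 : ¬ Nonempty (IsInitial Y)) : IsGal Y.obj := by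
  have hc : IsConn Y.obj := isConn_slc_iff.1 ⟨hY.connected, h0⟩
  refine ⟨hc, Y.2, fun V hV f => ⟨Y.2.hasInjectiveRestrictions hl.out _ _ hV hc f, fun s => ?_⟩⟩
  obtain ⟨P, fst, snd, h, hcol⟩ := hY.exists_product
  obtain ⟨hcol'⟩ := isColimit_cofan_slc_iff.1 hcol
  have hP : IsLimit (BinaryFan.mk fst.hom snd.hom) :=
    isLimitMapConeBinaryFanEquiv (isSLC T).ι _ _ (isLimitOfPreserves (isSLC T).ι h)
  obtain ⟨⟨φ, a⟩, ha⟩ := (hV.bijective_cofan hcol').2 (hP.lift (BinaryFan.mk f s))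
  have h1 : hP.lift (BinaryFan.mk f s) ≫ fst.hom = f := hP.fac _ ⟨WalkingPair.left⟩
  have h2 : hP.lift (BinaryFan.mk f s) ≫ snd.hom = s := hP.fac _ ⟨WalkingPair.right⟩
  have h3 : h.lift (BinaryFan.mk (𝟙 Y) φ.hom) ≫ fst = 𝟙 Y := h.fac _ ⟨WalkingPair.left⟩
  have h4 : h.lift (BinaryFan.mk (𝟙 Y) φ.hom) ≫ snd = φ.hom := h.fac _ ⟨WalkingPair.right⟩
  dsimp only at ha
  rw [← ha, Category.assoc, ← ObjectProperty.FullSubcategory.comp_hom, h3] at h1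
  rw [← ha, Category.assoc, ← ObjectProperty.FullSubcategory.comp_hom, h4] at h2
  exact ⟨φ.hom.hom, by rw [← h1, ObjectProperty.FullSubcategory.id_hom]; simpa using h2⟩

end Gal

/-! ### Paths and monodromy -/

section UniversalCover

variable {T : Type (w + 1)} [LargeCategory.{w} T] {κ : Type w} (u : κ → T)

/-- The homomorphisms in the free groupoid on the full subcategory given by the family `u`. -/
abbrev Path (k l : κ) : Type w :=
  (FreeGroupoid.of (InducedCategory T u)).obj k ⟶ (FreeGroupoid.of (InducedCategory T u)).obj l

/-- The path given by a morphism. -/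
def path {k l : κ} (f : u k ⟶ u l) : Path u k l :=
  (FreeGroupoid.of (InducedCategory T u)).map (X := k) (Y := l) ⟨f⟩

@[simp] lemma path_id (k : κ) : path u (𝟙 (u k)) = 𝟙 _ :=
  (FreeGroupoid.of (InducedCategory T u)).map_id k

@[simp] lemma path_comp {k l m : κ} (f : u k ⟶ u l) (g : u l ⟶ u m) :
    path u (f ≫ g) = path u f ≫ path u g :=
  (FreeGroupoid.of (InducedCategory T u)).map_comp (X := k) (Y := l) (Z := m) ⟨f⟩ ⟨g⟩

/-- A path is a zigzag of morphisms, so a property which can be carried along morphisms in both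
directions reaches every path from the trivial one. -/
lemma Path.induction {k₀ : κ} (P : ∀ k, Path u k k₀ → Prop) (h₀ : P k₀ (𝟙 _))
    (h : ∀ k l (f : u k ⟶ u l) (a : Path u l k₀), P l a ↔ P k (path u f ≫ a)) (k : κ)
    (a : Path u k k₀) : P k a := by
  let L := FreeGroupoid.of (InducedCategory T u)
  refine Localization.induction_costructuredArrow (C := InducedCategory T u) L ⊤ (Y := (k₀ : InducedCategory T u)) (fun φ => P φ.left φ.hom) h₀
    (fun X₁ X₂ f φ hφ => (h X₁ X₂ f.hom φ).1 hφ) (fun X₁ X₂ f hf φ hφ => ?_)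
    (CostructuredArrow.mk (C := InducedCategory T u) (S := L) (Y := k) a)
  refine (h X₁ X₂ f.hom _).2 ?_
  have : path u f.hom ≫ (Localization.isoOfHom L ⊤ f hf).inv ≫ φ = φ :=
    (Localization.isoOfHom L ⊤ f hf).hom_inv_id_assoc φ
  exact (congrArg (P X₁) this).mpr hφ

/-- The monodromy action: objects split by all the `u k` are representations of the groupoid of
paths. -/
lemma exists_monodromy {X : T} (hu : ∀ k, IsConn (u k)) (hX : ∀ k, Splits (u k) X) {n : κ}
    {k₀ : κ} (a : Path u n k₀) (x₀ : u n ⟶ X) :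
    ∃ x : ∀ k, Path u k k₀ → (u k ⟶ X), (∀ k l (f : u k ⟶ u l) b, f ≫ x l b = x k (path u f ≫ b)) ∧
      x n a = x₀ := by
  -- Restriction of points along `f` is bijective; its inverse makes Hom(u k, X) a covariant functor
  -- to sets and bijections, which extends to the groupoid of paths.
  let E {k l : κ} (f : u k ⟶ u l) : (u k ⟶ X) ≃ (u l ⟶ X) :=
    (Equiv.ofBijective _ (hX l _ (hu k) f)).symm
  have hE {k l : κ} (f : u k ⟶ u l) (x) : f ≫ E f x = x :=
    (Equiv.ofBijective _ (hX l _ (hu k) f)).apply_symm_apply x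
  let Φ₀ : InducedCategory T u ⥤ Core (Type w) :=
    { obj := fun k => .mk (u k ⟶ X)
      map := fun f => .mk (E f.hom).toIso
      map_id := fun k => by
        ext x
        change E (𝟙 (u k)) x = x
        rw [← Category.id_comp (E (𝟙 (u k)) x), hE]
      map_comp := fun {k l m} f g => by
        ext x
        change E (f.hom ≫ g.hom) x = E g.hom (E f.hom x)
        apply (hX m _ (hu k) (f.hom ≫ g.hom)).1
        dsimp only
        rw [hE, Category.assoc, hE, hE] }
  let Φ := FreeGroupoid.lift Φ₀
  have hΦ {k l : κ} (f : u k ⟶ u l) (x : u k ⟶ X) : f ≫ (Φ.map (path u f)).iso.hom x = x := by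
    have : Φ.map (path u f) = Φ₀.map (X := k) (Y := l) ⟨f⟩ := FreeGroupoid.lift_map_homMk Φ₀ _
    rw [this]
    exact hE f x
  -- The point `x₀` is transported to `k₀` along `a`, then back to `k` along `b`.
  refine ⟨fun k b => (Φ.map b).iso.inv ((Φ.map a).iso.hom x₀), fun k l f b => ?_, ?_⟩
  · have hc : Φ.map (path u f ≫ b) = Φ.map (path u f) ≫ Φ.map b := Φ.map_comp _ _
    have h := hΦ f ((Φ.map (path u f ≫ b)).iso.inv ((Φ.map a).iso.hom x₀))
    rw [hc] at h
    change f ≫ (Φ.map b).iso.inv ((Φ.map a).iso.hom x₀) =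
      (Φ.map (path u f ≫ b)).iso.inv ((Φ.map a).iso.hom x₀)
    refine Eq.trans ?_ (h.trans (congrArg (fun t : Φ.obj _ ⟶ Φ.obj _ => t.iso.inv
      ((Φ.map a).iso.hom x₀)) hc.symm))
    refine congrArg (fun t => f ≫ t) ?_
    exact (ConcreteCategory.congr_hom (Φ.map (path u f)).iso.inv_hom_id
      ((Φ.map b).iso.inv ((Φ.map a).iso.hom x₀))).symm
  · exact ConcreteCategory.congr_hom (Φ.map a).iso.hom_inv_id x₀

end UniversalCover

/-! ### Invariants of objects presented by generators and relations -/

section Glue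

variable {D : Type (w + 1)} [LargeCategory.{w} D] [IsTopos D]

/-- If `Y` is presented by generators and relations, so is `A × Y`, for all objects `A`. -/
theorem exists_glue_prod {Y : D} {I R : Type*} {U : I → D} {V : R → D} {ι : ∀ i, U i ⟶ Y}
    {s t : R → I} (p : ∀ r, V r ⟶ U (s r)) (q : ∀ r, V r ⟶ U (t r))
    (hι : ∀ (W : D) (x : ∀ i, U i ⟶ W), (∀ r, p r ≫ x (s r) = q r ≫ x (t r)) →
      ∃ g : Y ⟶ W, ∀ i, ι i ≫ g = x i) {A W : D}
    (φ : ∀ i Z, (Z ⟶ A) → (Z ⟶ U i) → (Z ⟶ W))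
    (hφ : ∀ i Z Z' (c : Z' ⟶ Z) a b, φ i Z' (c ≫ a) (c ≫ b) = c ≫ φ i Z a b)
    (hpq : ∀ r Z a b, φ (s r) Z a (b ≫ p r) = φ (t r) Z a (b ≫ q r)) :
    ∃ ψ : ∀ Z, (Z ⟶ A) → (Z ⟶ Y) → (Z ⟶ W), ∀ i Z a b, ψ Z a (b ≫ ι i) = φ i Z a b := by
  obtain ⟨⟨_, _⟩⟩ := nonempty_cartesianClosed D
  open MonoidalCategory CartesianMonoidalCategory in
  -- Transposing the universal instance of `φ i` gives morphisms to the exponential object W^A,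
  -- where the presentation of `Y` alone can be used.
  obtain ⟨g, hg⟩ := hι _ (fun i => MonoidalClosed.curry (φ i (A ⊗ U i) (fst _ _) (snd _ _)))
    (fun r => by
      rw [← MonoidalClosed.curry_natural_left, ← MonoidalClosed.curry_natural_left, ← hφ, ← hφ,
        whiskerLeft_fst, whiskerLeft_snd, whiskerLeft_fst, whiskerLeft_snd, hpq])
  open MonoidalCategory CartesianMonoidalCategory in
  refine ⟨fun Z a y => lift a y ≫ MonoidalClosed.uncurry g, fun i Z a b => ?_⟩
  open MonoidalCategory CartesianMonoidalCategory in
  have h : A ◁ ι i ≫ MonoidalClosed.uncurry g = φ i (A ⊗ U i) (fst _ _) (snd _ _) := by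
    rw [← MonoidalClosed.uncurry_natural_left, hg, MonoidalClosed.uncurry_curry]
  open MonoidalCategory CartesianMonoidalCategory in
  dsimp only
  open MonoidalCategory CartesianMonoidalCategory in
  rw [show lift a (b ≫ ι i) = lift a b ≫ A ◁ ι i by
    ext <;> simp, Category.assoc, h, ← hφ, lift_fst, lift_snd]

lemma exists_hom_of_jointlyEpi {κ : Type*} {u : κ → D}
    (hu : ∀ X, JointlyEpi (fun p : Σ k, (u k ⟶ X) => p.2)) {V : D}
    (hV : ¬ Nonempty (IsInitial V)) : ∃ k, Nonempty (u k ⟶ V) := by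
  by_contra! H
  exact binaryCofan_disjoint (coprodIsCoprod (⊤_ D) (⊤_ D)) hV (terminal.from _)
    (terminal.from _) (hu V _ _ fun p => ((H p.1).false p.2).elim)

lemma exists_hom_sigma_const {κ : Type*} {u : κ → D}
    (hu : ∀ X, JointlyEpi (fun p : Σ k, (u k ⟶ X) => p.2)) {S : Type w} {X : D}
    (s : ∀ k, (u k ⟶ X) → S) (hs : ∀ k l (f : u k ⟶ u l) c, s k (f ≫ c) = s l c) :
    ∃ g : X ⟶ ∐ fun _ : S => ⊤_ D, ∀ k c,
      c ≫ g = terminal.from _ ≫ Sigma.ι (fun _ : S => ⊤_ D) (s k c) := by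
  obtain ⟨g, hg⟩ := (hu X).exists_glue (W := ∐ fun _ : S => ⊤_ D)
    (fun p => terminal.from _ ≫ Sigma.ι (fun _ : S => ⊤_ D) (s p.1 p.2)) (by
      intro Z i j a b h
      refine hu Z _ _ fun p => ?_
      rw [← hs _ _ (p.2 ≫ a) i.2, ← hs _ _ (p.2 ≫ b) j.2, Category.assoc, Category.assoc, h]
      simp only [← Category.assoc]
      congr 1
      exact Subsingleton.elim _ _)
  exact ⟨g, fun k c => hg ⟨k, c⟩⟩

/-- Invariance under the relations implies invariance under the equivalence relation which they
generate. -/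
theorem eq_of_glue {κ : Type*} {u : κ → D}
    (hu : ∀ X, JointlyEpi (fun p : Σ k, (u k ⟶ X) => p.2)) (hc : ∀ k, IsConn (u k))
    {Y : D} {I R : Type*} {U : I → D} {V : R → D} {ι : ∀ i, U i ⟶ Y}
    {s t : R → I} (p : ∀ r, V r ⟶ U (s r)) (q : ∀ r, V r ⟶ U (t r))
    (hι : ∀ (W : D) (x : ∀ i, U i ⟶ W), (∀ r, p r ≫ x (s r) = q r ≫ x (t r)) →
      ∃ g : Y ⟶ W, ∀ i, ι i ≫ g = x i) {A : D} {S : Type w}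
    (φ : ∀ i k, (u k ⟶ A) → (u k ⟶ U i) → S)
    (hφ : ∀ i k l (c : u k ⟶ u l) a b, φ i k (c ≫ a) (c ≫ b) = φ i l a b)
    (hpq : ∀ r k a b, φ (s r) k a (b ≫ p r) = φ (t r) k a (b ≫ q r))
    {k : κ} (a : u k ⟶ A) {i j : I} (b : u k ⟶ U i) (b' : u k ⟶ U j) (h : b ≫ ι i = b' ≫ ι j) :
    φ i k a b = φ j k a b' := by
  -- The invariant `φ` becomes a morphism to the constant object on `S` and descends to `Y`, with
  -- parameters in `A`; evaluating at the identity of `u k` recovers its value. The relations need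
  -- not form an equivalence relation.
  choose g hg using fun (i : I) (Z : D) (a : Z ⟶ A) (b : Z ⟶ U i) =>
    exists_hom_sigma_const hu (fun k (c : u k ⟶ Z) => φ i k (c ≫ a) (c ≫ b))
      (fun k l f c => by simp only [Category.assoc, hφ])
  obtain ⟨ψ, hψ⟩ := exists_glue_prod p q hι g
    (fun i Z Z' c a b => hu _ _ _ fun p => by
      dsimp only
      rw [hg, ← Category.assoc p.2 c (g i Z a b), hg]; simp only [Category.assoc])
    (fun r Z a b => hu _ _ _ fun p => by
      rw [hg, hg]; simp only [← Category.assoc, hpq])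
  have h1 := hg i _ a b k (𝟙 _)
  have h2 := hg j _ a b' k (𝟙 _)
  rw [← hψ, h, hψ, h2] at h1
  have := cofan_disjoint (coproductIsCoproduct (fun _ : S => ⊤_ D)) (hc k).not_isInitial _ _ h1
  simpa using this.symm

end Glue

/-! ### The universal cover as a colimit over paths, and its points -/

section UniversalCover

variable {T : Type (w + 1)} [LargeCategory.{w} T] {κ : Type w} (u : κ → T) {k₀ : κ}

/-- `Y` is the colimit of the `u k`, indexed by the paths from `k` to `k₀`. -/
structure IsUniversalCover {Y : T} (ι : ∀ k, Path u k k₀ → (u k ⟶ Y)) : Prop where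
  w {k l : κ} (f : u k ⟶ u l) (b : Path u l k₀) : f ≫ ι l b = ι k (path u f ≫ b)
  exists_desc (W : T) (x : ∀ k, Path u k k₀ → (u k ⟶ W))
    (hx : ∀ k l (f : u k ⟶ u l) b, f ≫ x l b = x k (path u f ≫ b)) :
    ∃ g : Y ⟶ W, ∀ k b, ι k b ≫ g = x k b
  jointlyEpi : JointlyEpi (fun p : Σ k, Path u k k₀ => ι p.1 p.2)

variable [IsTopos T]

lemma exists_isUniversalCover (k₀ : κ) :
    ∃ (Y : T) (ι : ∀ k, Path u k k₀ → (u k ⟶ Y)), IsUniversalCover u ι := by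
  let L := FreeGroupoid.of (InducedCategory T u)
  let F := CostructuredArrow.proj L (L.obj k₀) ⋙ inducedFunctor u
  let m (k : κ) (b : Path u k k₀) : CostructuredArrow L (L.obj k₀) :=
    CostructuredArrow.mk (C := InducedCategory T u) (S := L) (Y := k) b
  have hw {k l : κ} (f : u k ⟶ u l) (b : Path u l k₀) :
      f ≫ colimit.ι F (m l b) = colimit.ι F (m k (path u f ≫ b)) :=
    colimit.w F (CostructuredArrow.homMk (C := InducedCategory T u) ⟨f⟩ rfl :
      m k (path u f ≫ b) ⟶ m l b)
  refine ⟨colimit F, fun k b => colimit.ι F (m k b), hw, fun W x hx => ?_, fun Z g h H => ?_⟩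
  · refine ⟨colimit.desc F ⟨W, ⟨fun φ => x φ.left φ.hom, fun φ ψ f => ?_⟩⟩,
      fun k b => colimit.ι_desc _ _⟩
    have h1 := hx φ.left ψ.left f.left.hom ψ.hom
    have h2 : path u f.left.hom ≫ ψ.hom = φ.hom := CostructuredArrow.w f
    rw [h2] at h1
    exact h1.trans (Category.comp_id _).symm
  · exact colimit.hom_ext fun φ => H ⟨φ.left, φ.hom⟩

variable {u}
variable (hu : ∀ X, JointlyEpi (fun p : Σ k, (u k ⟶ X) => p.2)) (hc : ∀ k, IsConn (u k))
variable {Y : T} {ι : ∀ k, Path u k k₀ → (u k ⟶ Y)} (h : IsUniversalCover u ι)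
include hu hc h

/-- The invariant of a point `b` of the copy of `u l` indexed by a path is the path from `k` to `k₀`
through this point. The additional point `a` of `u k` fixes the origin: without it, the path would
start at the varying source and could not be an invariant. -/
lemma IsUniversalCover.eq_of_eq {k l m : κ} (b : Path u l k₀) (b' : Path u m k₀)
    (c : u k ⟶ u l) (c' : u k ⟶ u m) (e : c ≫ ι l b = c' ≫ ι m b') :
    path u c ≫ b = path u c' ≫ b' := by
  have := eq_of_glue hu hc (Y := Y) (I := Σ k, Path u k k₀)
    (R := Σ (k : κ) (l : κ), (u k ⟶ u l) × Path u l k₀) (U := fun i => u i.1)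
    (V := fun r => u r.1) (ι := fun i => ι i.1 i.2) (s := fun r => ⟨r.1, path u r.2.2.1 ≫ r.2.2.2⟩)
    (t := fun r => ⟨r.2.1, r.2.2.2⟩)
    (fun r => 𝟙 (u r.1)) (fun r => r.2.2.1)
    (fun W x hx => by
      obtain ⟨g, hg⟩ := h.exists_desc W (fun k b => x ⟨k, b⟩) (fun k l f b => by
        have := hx ⟨k, l, f, b⟩
        exact this.symm.trans (Category.id_comp _))
      exact ⟨g, fun i => hg _ _⟩)
    (A := u k) (S := Path u k k₀)
    (fun i m a b => Groupoid.inv (path u a) ≫ path u b ≫ i.2)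
    (fun i m m' f a b => by
      simp only [path_comp, Groupoid.inv_eq_inv]
      simp) (fun r m a b => by simp) (𝟙 _) (i := ⟨l, b⟩) (j := ⟨m, b'⟩) c c' e
  simpa [Groupoid.inv_eq_inv] using this

/-- A point `y` of `Y` on `V` is locally of the form `ι m b`. Going from `k` back through the source
of this local point and then along `b` is a locally constant function on `V` with values in paths
from `k` to `k₀`; its constant value is the path sought. -/
lemma IsUniversalCover.bijective {V : T} (hV : IsConn V) (hl : IsLocallyConnectedTopos T) {k : κ}
    (c : V ⟶ u k) : Function.Bijective (fun b => c ≫ ι k b) := by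
  constructor
  · intro b b' e
    obtain ⟨m, ⟨d⟩⟩ := exists_hom_of_jointlyEpi hu hV.not_isInitial
    have := h.eq_of_eq hu hc b b' (d ≫ c) (d ≫ c) (by simpa using congrArg (d ≫ ·) e)
    exact (cancel_epi _).1 this
  · intro y
    let Ix := {p : Σ m, (u m ⟶ V) × Path u m k₀ // p.2.1 ≫ y = ι p.1 p.2.2}
    have hI : JointlyEpi (fun p : Ix => p.1.2.1) := by
      intro Z g g' H
      refine h.jointlyEpi.pullback y _ _ fun p => hu _ _ _ fun q => ?_
      obtain ⟨W, ⟨l, b⟩, ⟨a, d⟩, e⟩ := p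
      obtain ⟨m, f⟩ := q
      dsimp only at e f ⊢
      have := H ⟨⟨m, f ≫ a, path u (f ≫ d) ≫ b⟩, by
        dsimp only
        rw [← h.w, Category.assoc, Category.assoc, e]⟩
      simpa using this
    obtain ⟨s₀, hs⟩ := hV.exists_eq_of_locally_const hl hI
      (fun p => Groupoid.inv (path u (p.1.2.1 ≫ c)) ≫ p.1.2.2) (by
        rintro W hW ⟨⟨m, w, b⟩, e⟩ ⟨⟨m', w', b'⟩, e'⟩ a a' ha
        dsimp only at e e' a a' ha ⊢
        obtain ⟨n, ⟨d⟩⟩ := exists_hom_of_jointlyEpi hu hW.not_isInitial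
        have h1 := h.eq_of_eq hu hc b b' (d ≫ a) (d ≫ a') (by
          rw [← e, ← e', Category.assoc, Category.assoc, reassoc_of% ha])
        have h2 : path u (d ≫ a) ≫ path u (w ≫ c) = path u (d ≫ a') ≫ path u (w' ≫ c) := by
          rw [← path_comp, ← path_comp]
          simp [reassoc_of% ha]
        rw [Groupoid.inv_eq_inv, Groupoid.inv_eq_inv, IsIso.inv_comp_eq,
          ← cancel_epi (path u (d ≫ a)), h1, reassoc_of% h2, IsIso.hom_inv_id_assoc])
    refine ⟨s₀, hI _ _ fun p => ?_⟩
    have := hs p (hc _)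
    dsimp only at this ⊢
    rw [← Category.assoc, h.w, p.2, ← this, Groupoid.inv_eq_inv, IsIso.hom_inv_id_assoc]

end UniversalCover

/-! ### The universal cover is a Galois object -/

section UniversalCover

variable {T : Type (w + 1)} [LargeCategory.{w} T] [IsTopos T] {κ : Type w} {u : κ → T} {k₀ : κ}
  (hu : ∀ X, JointlyEpi (fun p : Σ k, (u k ⟶ X) => p.2)) (hc : ∀ k, IsConn (u k))
  {Y : T} {ι : ∀ k, Path u k k₀ → (u k ⟶ Y)} (h : IsUniversalCover u ι)
  (hl : IsLocallyConnectedTopos T)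
include hu hc h hl

lemma IsUniversalCover.splits_self (k : κ) : Splits (u k) Y := by
  intro W hW f
  have h1 := h.bijective hu hc (hc k) hl (𝟙 (u k))
  refine (Function.Bijective.of_comp_iff _ h1).1 ?_
  convert h.bijective hu hc hW hl f using 2 with b
  simp

lemma IsUniversalCover.isLocallyConstantObject : IsLocallyConstantObject Y :=
  (isLocallyConstantObject_iff hl).2 fun X _ _ _ H => hu X _ _ fun p =>
    H _ ⟨hc _, h.splits_self hu hc hl p.1⟩ _

-- The paths whose copy lands in `Y₁` are stable under composition with morphisms in both
-- directions, since each copy lies entirely in `Y₁` or in `Y₂`. By `Path.induction` they are all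
-- the paths, and no point is left for `Y₂`.
omit hc in
lemma IsUniversalCover.isInitial_of_binaryCofan {Y₁ Y₂ : T} {i₁ : Y₁ ⟶ Y} {i₂ : Y₂ ⟶ Y}
    (hi : IsColimit (BinaryCofan.mk i₁ i₂)) {a : u k₀ ⟶ Y₁} (ha : a ≫ i₁ = ι k₀ (𝟙 _))
    (hc : ∀ k, IsConn (u k)) : Nonempty (IsInitial Y₂) := by
  have key := Path.induction u (fun k b => ∃ a, a ≫ i₁ = ι k b) ⟨a, ha⟩ (by
    refine fun k l f b => ⟨fun ⟨a, ha⟩ => ⟨f ≫ a, by rw [Category.assoc, ha, h.w]⟩, fun ⟨a, ha⟩ => ?_⟩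
    rcases (hc l).binaryCofan_factor hi (ι l b) with h' | ⟨c, hc'⟩
    · exact h'
    · refine (binaryCofan_disjoint hi (hc k).not_isInitial a (f ≫ c) ?_).elim
      rw [Category.assoc, hc', h.w, ha])
  by_contra h2
  obtain ⟨m, ⟨c⟩⟩ := exists_hom_of_jointlyEpi hu h2
  obtain ⟨b, hb⟩ := (h.bijective hu hc (hc m) hl (𝟙 (u m))).2 (c ≫ i₂)
  obtain ⟨a, ha⟩ := key m b
  refine binaryCofan_disjoint hi (hc m).not_isInitial a c ?_
  exact ha.trans ((Category.id_comp _).symm.trans hb)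

lemma IsUniversalCover.isConn : IsConn Y := by
  refine ⟨fun Y₁ Y₂ i₁ i₂ ⟨hi⟩ => ?_, IsConn.of_hom (hc k₀).not_isInitial (ι k₀ (𝟙 _))⟩
  rcases (hc k₀).binaryCofan_factor hi (ι k₀ (𝟙 _)) with ⟨a, ha⟩ | ⟨a, ha⟩
  · exact .inr (h.isInitial_of_binaryCofan hu hl hi ha hc)
  · exact .inl (h.isInitial_of_binaryCofan hu hl (BinaryCofan.isColimitFlip hi) ha hc)

/-- Monodromy extends one local value of `x₀` to a compatible family on all the copies of the `u k`,
hence to `Y`; unique continuation shows that this extends `x₀` itself. -/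
lemma IsUniversalCover.splits {X : T} (hX : ∀ k, Splits (u k) X)
    (hX' : HasInjectiveRestrictions X) : Splits Y X := by
  intro W hW f
  refine ⟨hX' W Y hW (h.isConn hu hc hl) f, fun x₀ => ?_⟩
  obtain ⟨n, ⟨d⟩⟩ := exists_hom_of_jointlyEpi hu hW.not_isInitial
  obtain ⟨a, ha⟩ := (h.bijective hu hc (hc n) hl (𝟙 (u n))).2 (d ≫ f)
  obtain ⟨x, hx, hxa⟩ := exists_monodromy u hc hX a (d ≫ x₀)
  obtain ⟨g, hg⟩ := h.exists_desc X x hx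
  refine ⟨g, hX' (u n) W (hc n) hW d ?_⟩
  dsimp only at ha ⊢
  rw [← Category.assoc, ← ha, Category.id_comp, hg, hxa]

lemma IsUniversalCover.isGal : IsGal Y where
  isConn := h.isConn hu hc hl
  slc := .of_isLocallyConstantObject (h.isLocallyConstantObject hu hc hl)
  splits := h.splits hu hc hl (h.splits_self hu hc hl)
    (.of_isLocallyConstantObject hl (h.isLocallyConstantObject hu hc hl))

end UniversalCover

/-! ### A small generating family of Galois objects -/

section Generators

variable {T : Type (w + 1)} [LargeCategory.{w} T] [IsTopos T]

/-- For any small separating family of connected objects, there is a Galois object which splits all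
that they split. -/
theorem exists_isGal_of_family {κ : Type w} {u : κ → T}
    (hu : ∀ X, JointlyEpi (fun p : Σ k, (u k ⟶ X) => p.2)) (hc : ∀ k, IsConn (u k))
    (hl : IsLocallyConnectedTopos T) (k₀ : κ) :
    ∃ Y : T, IsGal Y ∧ Nonempty (u k₀ ⟶ Y) ∧ ∀ X, (∀ k, Splits (u k) X) →
      HasInjectiveRestrictions X → Splits Y X := by
  obtain ⟨Y, ι, h⟩ := exists_isUniversalCover u k₀
  exact ⟨Y, h.isGal hu hc hl, ⟨ι k₀ (𝟙 _)⟩, fun X => h.splits hu hc hl⟩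

variable (T) in
lemma exists_small_isConn (hl : IsLocallyConnectedTopos T) :
    ∃ (κ : Type w) (u : κ → T), (∀ k, IsConn (u k)) ∧
      ∀ X, JointlyEpi (fun p : Σ k, (u k ⟶ X) => p.2) := by
  obtain ⟨κ, G, hG⟩ := exists_small_separating T
  choose κ' r hr using fun k => (hl.isConn_isSeparating.jointlyEpi (G k)).exists_small
  refine ⟨Σ k, κ' k, fun p => (r p.1 p.2).1.1, fun p => (r p.1 p.2).1.2, fun X Z g h H => ?_⟩
  refine hG _ _ fun k c => hr k _ _ fun i => ?_
  simpa using H ⟨⟨k, i⟩, (r k i).2 ≫ c⟩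

variable (T) [hl : Fact (IsLocallyConnectedTopos T)]

/-- `SLC T` is generated by a small family of Galois objects. -/
theorem exists_small_isGal : ∃ (Λ : Type w) (G : Λ → T), (∀ i, IsGal (G i)) ∧
    ∀ K, isSLC T K → JointlyEpi (fun p : Σ i, (G i ⟶ K) => p.2) := by
  obtain ⟨κ, u, hc, hu⟩ := exists_small_isConn T hl.out
  -- There is one universal cover for each separating subfamily of `u` and each base index in it,
  -- hence only a small set of them.
  choose G hG hG' hG'' using fun (i : {p : Set κ × κ // p.2 ∈ p.1 ∧ ∀ X, JointlyEpi
    (fun q : Σ k : p.1, (u k ⟶ X) => q.2)}) =>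
    exists_isGal_of_family i.2.2 (fun k => hc _) hl.out (⟨i.1.2, i.2.1⟩ : i.1.1)
  refine ⟨_, G, hG, ?_⟩
  rintro K ⟨I, Z, ι, hZ, ⟨hι⟩⟩ X g h H
  refine Cofan.IsColimit.hom_ext hι _ _ fun i => ?_
  have hsep := (isLocallyConstantObject_iff hl.out).1 (hZ i)
  -- The members of `u` which split `Z i` still separate, so they have a universal cover `G j`. It
  -- splits `Z i`, so every point of `Z i` on a member factors through the universal cover based
  -- there.
  have hsub (X : T) : JointlyEpi (fun q : Σ k : {k | Splits (u k) (Z i)}, (u k ⟶ X) => q.2) := by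
    intro W g h H
    refine hsep _ _ fun V hV c => hu _ _ _ fun p => ?_
    simpa using H ⟨⟨p.1, hV.2.of_hom (hc _) p.2⟩, p.2 ≫ c⟩
  refine hsub _ _ _ fun q => ?_
  obtain ⟨⟨k, hk⟩, c⟩ := q
  let j : {p : Set κ × κ // p.2 ∈ p.1 ∧ ∀ X, JointlyEpi
    (fun q : Σ k : p.1, (u k ⟶ X) => q.2)} := ⟨({k | Splits (u k) (Z i)}, k), hk, hsub⟩
  obtain ⟨s, hs⟩ := (hG'' j (Z i) (fun k => k.2) (.of_isLocallyConstantObject hl.out (hZ i)) (u k)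
    (hc k) (hG' j).some).2 c
  dsimp only at hs ⊢
  have := H ⟨j, s ≫ ι i⟩
  rw [← hs]
  simp only [Category.assoc] at this ⊢
  exact congrArg _ this

variable {T}

theorem exists_isGal_hom {K : T} (hK : isSLC T K) (hK' : ¬ Nonempty (IsInitial K)) :
    ∃ G : T, IsGal G ∧ Nonempty (G ⟶ K) := by
  obtain ⟨Λ, G, hG, h⟩ := exists_small_isGal T
  by_contra! H
  exact binaryCofan_disjoint (coprodIsCoprod (⊤_ T) (⊤_ T)) hK' (terminal.from _)
    (terminal.from _) (h K hK _ _ fun p => ((H _ (hG p.1)).false p.2).elim)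

/-- For any covering sieve `R` of the final object, there is a Galois object which splits all that the
connected objects of `R` trivialize. -/
theorem exists_isGal_of_coveringSieve (ht : ¬ Nonempty (IsInitial (⊤_ T))) (R : CoveringSieve T) :
    ∃ Y : T, IsGal Y ∧ ∀ X, isSLC T X → isLC R X → Splits Y X := by
  obtain ⟨κ, u, hc, hu⟩ := exists_small_isConn T hl.out
  -- The members of `u` which belong to `R` still separate, because `R` is covering.
  have hsub (X : T) : JointlyEpi
      (fun q : Σ k : {k // R.1 (terminal.from (u k))}, (u k.1 ⟶ X) => q.2) := by
    intro W g h H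
    refine (jointlyEpi_of_mem_canonicalTopology R.2).pullback (terminal.from X) _ _ fun p =>
      hu _ _ _ fun q => ?_
    obtain ⟨V, ⟨W', f, hf⟩, ⟨a, b⟩, e⟩ := p
    obtain ⟨k, c⟩ := q
    have := H ⟨⟨k, by
      have := R.1.downward_closed hf (c ≫ b)
      rwa [show terminal.from (u k) = (c ≫ b) ≫ f from Subsingleton.elim _ _]⟩, c ≫ a⟩
    simpa using this
  obtain ⟨k₀, -⟩ := exists_hom_of_jointlyEpi hsub ht
  obtain ⟨Y, hY, -, h⟩ := exists_isGal_of_family hsub (fun k => hc _) hl.out k₀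
  exact ⟨Y, hY, fun X hX hR => h X (fun k => (hR _ _ k.2 (hc _).1).splits (hc _) (𝟙 _))
    (hX.hasInjectiveRestrictions hl.out)⟩

end Generators

/-! ### A recognition criterion for sheaves on an atomic site -/

section Site

open Opposite

/-- Conditions under which `E` is the topos of sheaves on a category `C` for the atomic topology,
where `C` is a full subcategory of `E`. -/
structure IsGaloisSite {E : Type (w + 1)} [LargeCategory.{w} E] {C : Type w} [SmallCategory C]
    (L : C ⥤ E) : Prop where
  full : L.Full
  faithful : L.Faithful
  hom_ext {X W : E} (g h : X ⟶ W) (H : ∀ i (c : L.obj i ⟶ X), c ≫ g = c ≫ h) : g = h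
  exists_hom {X W : E} (x : ∀ i, (L.obj i ⟶ X) → (L.obj i ⟶ W))
    (hx : ∀ i j (f : i ⟶ j) c, x i (L.map f ≫ c) = L.map f ≫ x j c) :
    ∃ g : X ⟶ W, ∀ i c, c ≫ g = x i c
  ore : GrothendieckTopology.RightOreCondition C
  epi {i j : C} (f : i ⟶ j) : Epi (L.map f)
  exists_desc {i j : C} (f : i ⟶ j) {W : E} (x : L.obj i ⟶ W)
    (hx : ∀ φ : i ⟶ i, φ ≫ f = f → L.map φ ≫ x = x) : ∃ g, L.map f ≫ g = x
  exists_aut {i j : C} (e e' : i ⟶ j) : ∃ φ : Aut j, e ≫ φ.hom = e'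
  exists_quotient {i : C} (H : Subgroup (Aut i)) : ∃ (Q : E) (q : L.obj i ⟶ Q),
    (∀ h ∈ H, L.map h.hom ≫ q = q) ∧
    (∀ m (e e' : m ⟶ i), L.map e ≫ q = L.map e' ≫ q → ∃ h ∈ H, e ≫ h.hom = e') ∧
    ∀ j (c : L.obj j ⟶ Q), ∃ (m : C) (g : m ⟶ j) (f : m ⟶ i), L.map f ≫ q = L.map g ≫ c
  exists_sum {I : Type w} (Z : I → E) : ∃ (X : E) (ι : ∀ a, Z a ⟶ X),
    ∀ j, Function.Bijective (fun p : Σ a, (L.obj j ⟶ Z a) => p.2 ≫ ι p.1)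

namespace IsGaloisSite

variable {E : Type (w + 1)} [LargeCategory.{w} E] {C : Type w} [SmallCategory C]
  {L : C ⥤ E} (hL : IsGaloisSite L)

/-- The restriction of a representable presheaf. -/
abbrev nerve (L : C ⥤ E) : E ⥤ Cᵒᵖ ⥤ Type w :=
  yoneda ⋙ (Functor.whiskeringLeft _ _ (Type w)).obj L.op

include hL

/-- The elements of `A`, identified when they have a common restriction, form orbits. The orbit of
an element is the quotient of its object of definition by its stabilizer, and `X` is the sum of
these quotients. The two hypotheses on `A` are the sheaf condition for single arrows. -/
lemma exists_nerve_iso (A : Cᵒᵖ ⥤ Type w)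
    (hinj : ∀ {i j : C} (f : i ⟶ j), Function.Injective (A.map f.op))
    (hdesc : ∀ {i j : C} (f : i ⟶ j) (y : A.obj (op i)),
      (∀ (m : C) (e e' : m ⟶ i), e ≫ f = e' ≫ f → A.map e.op y = A.map e'.op y) →
      ∃ x, A.map f.op x = y) :
    ∃ X : E, Nonempty ((nerve L).obj X ≅ A) := by
  have hcomp {i j k : C} (f : i ⟶ j) (g : j ⟶ k) (x : A.obj (op k)) :
      A.map (f ≫ g).op x = A.map f.op (A.map g.op x) := by
    rw [op_comp, Functor.map_comp_apply]
  let r : Setoid (Σ j : C, A.obj (op j)) :=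
    { r := fun p q => ∃ (m : C) (f : m ⟶ p.1) (g : m ⟶ q.1), A.map f.op p.2 = A.map g.op q.2
      iseqv :=
        { refl := fun p => ⟨p.1, 𝟙 _, 𝟙 _, rfl⟩
          symm := fun ⟨m, f, g, h⟩ => ⟨m, g, f, h.symm⟩
          trans := fun ⟨m, f, g, h⟩ ⟨m', f', g', h'⟩ => by
            obtain ⟨n, a, b, e⟩ := hL.ore g f'
            refine ⟨n, a ≫ f, b ≫ g', ?_⟩
            rw [hcomp, hcomp, h, ← h', ← hcomp, ← hcomp, e] } }
  let o (α : Quotient r) : C := α.out.1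
  let a (α : Quotient r) : A.obj (op (o α)) := α.out.2
  let H (α : Quotient r) : Subgroup (Aut (o α)) :=
    { carrier := {φ | A.map φ.hom.op (a α) = a α}
      one_mem' := by
        change A.map (𝟙 (o α)).op (a α) = a α
        simp
      mul_mem' := fun {φ ψ} hφ hψ => by
        change A.map (ψ.hom ≫ φ.hom).op (a α) = a α
        rw [hcomp, hφ.out, hψ.out]
      inv_mem' := fun {φ} hφ => by
        change A.map φ.inv.op (a α) = a α
        conv_lhs => rw [← hφ.out]
        rw [← hcomp, φ.inv_hom_id]
        simp }
  choose Q q hq hq' hq'' using fun α => hL.exists_quotient (H α)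
  obtain ⟨X, ι, hι⟩ := hL.exists_sum Q
  -- `b` and `c` correspond if over some common object both come from the same morphism to the
  -- chosen representative of an orbit. This relation is shown to be the graph of a natural
  -- bijection.
  let Rel (j : C) (b : A.obj (op j)) (c : L.obj j ⟶ X) : Prop :=
    ∃ (α : Quotient r) (m : C) (f : m ⟶ o α) (g : m ⟶ j),
      A.map f.op (a α) = A.map g.op b ∧ L.map f ≫ q α ≫ ι α = L.map g ≫ c
  have hrel (α : Quotient r) {m : C} (f f' : m ⟶ o α) :
      A.map f.op (a α) = A.map f'.op (a α) ↔ L.map f ≫ q α = L.map f' ≫ q α := by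
    constructor
    · intro h
      obtain ⟨φ, rfl⟩ := hL.exists_aut f f'
      rw [hcomp] at h
      have hφ : φ ∈ H α := (hinj f h).symm
      rw [L.map_comp, Category.assoc, hq α φ hφ]
    · intro h
      obtain ⟨φ, hφ, rfl⟩ := hq' α m f f' h
      rw [hcomp, show A.map φ.hom.op (a α) = a α from hφ]
  have ex1 (j : C) (b : A.obj (op j)) : ∃ c, Rel j b c := by
    obtain ⟨m, f, g, h⟩ := Quotient.mk_out (s := r) ⟨j, b⟩
    let α : Quotient r := Quotient.mk r ⟨j, b⟩
    obtain ⟨c, hc⟩ := hL.exists_desc g (L.map (show m ⟶ o α from f) ≫ q α ≫ ι α) fun φ hφ => by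
      have h1 : A.map (φ ≫ f).op (a α) = A.map f.op (a α) := by
        refine (hcomp _ _ _).trans (Eq.trans ?_ h.symm)
        refine (congrArg _ h).trans ?_
        rw [← hcomp, hφ]
      have h2 := (hrel α _ _).1 h1
      rw [L.map_comp, Category.assoc] at h2
      simp only [← Category.assoc]
      congr 1
      simpa using h2
    exact ⟨c, α, m, f, g, h, hc.symm⟩
  have ex2 (j : C) (c : L.obj j ⟶ X) : ∃ b, Rel j b c := by
    obtain ⟨⟨α, c⟩, rfl⟩ := (hι j).2 c
    obtain ⟨m, g, f, h⟩ := hq'' α j c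
    obtain ⟨b, hb⟩ := hdesc g (A.map f.op (a α)) fun n e e' he => by
      rw [← hcomp, ← hcomp, hrel, L.map_comp, L.map_comp, Category.assoc, Category.assoc, h,
        ← Category.assoc, ← Category.assoc, ← L.map_comp, ← L.map_comp, he]
    refine ⟨b, α, m, f, g, hb.symm, ?_⟩
    dsimp only
    rw [← Category.assoc, h, Category.assoc]
  have un1 (j : C) (b : A.obj (op j)) (c c' : L.obj j ⟶ X) (h : Rel j b c) (h' : Rel j b c') :
      c = c' := by
    obtain ⟨α, m, f, g, h1, h2⟩ := h
    obtain ⟨α', m', f', g', h1', h2'⟩ := h'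
    obtain ⟨n, k, k', e⟩ := hL.ore g g'
    have h3 : A.map (k ≫ f).op (a α) = A.map (k' ≫ f').op (a α') := by
      rw [hcomp, hcomp, h1, h1', ← hcomp, ← hcomp, e]
    obtain rfl : α = α' := by
      rw [← Quotient.out_eq α, ← Quotient.out_eq α']
      exact Quotient.sound ⟨n, _, _, h3⟩
    have h4 := (hrel α _ _).1 h3
    have := hL.epi (k ≫ g)
    rw [← cancel_epi (L.map (k ≫ g))]
    conv_rhs => rw [e]
    simp only [L.map_comp, Category.assoc] at h4 ⊢
    rw [← h2, ← h2', reassoc_of% h4]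
  have un2 (j : C) (b b' : A.obj (op j)) (c : L.obj j ⟶ X) (h : Rel j b c) (h' : Rel j b' c) :
      b = b' := by
    obtain ⟨α, m, f, g, h1, h2⟩ := h
    obtain ⟨α', m', f', g', h1', h2'⟩ := h'
    obtain ⟨n, k, k', e⟩ := hL.ore g g'
    have h3 : (L.map (k ≫ f) ≫ q α) ≫ ι α = (L.map (k' ≫ f') ≫ q α') ≫ ι α' := by
      simp only [L.map_comp, Category.assoc, h2, h2']
      rw [← Category.assoc, ← L.map_comp, e, L.map_comp, Category.assoc]
    have h4 := (hι n).1 (a₁ := ⟨α, _⟩) (a₂ := ⟨α', _⟩) h3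
    obtain ⟨rfl, h4⟩ := Sigma.mk.inj h4
    have h5 := (hrel α _ _).2 (eq_of_heq h4)
    refine hinj (k ≫ g) ?_
    conv_rhs => rw [e]
    rw [hcomp, hcomp, ← h1, ← h1', ← hcomp, ← hcomp, h5]
  have nat {i j : C} (t : i ⟶ j) (b : A.obj (op j)) (c : L.obj j ⟶ X) (h : Rel j b c) :
      Rel i (A.map t.op b) (L.map t ≫ c) := by
    obtain ⟨α, m, f, g, h1, h2⟩ := h
    obtain ⟨n, k, k', e⟩ := hL.ore g t
    refine ⟨α, n, k ≫ f, k', ?_, ?_⟩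
    · rw [hcomp, h1, ← hcomp, e, hcomp]
    · rw [L.map_comp, Category.assoc, h2, ← Category.assoc, ← L.map_comp, e, L.map_comp,
        Category.assoc]
  choose F hF using ex2
  have hF' (j : C) : Function.Bijective (F j) := by
    refine ⟨fun c c' e => un1 j (F j c) c c' (hF j c) (e ▸ hF j c'), fun b => ?_⟩
    obtain ⟨c, hc⟩ := ex1 j b
    exact ⟨c, un2 j _ _ c (hF j c) hc⟩
  refine ⟨X, ⟨NatIso.ofComponents (fun j => (Equiv.ofBijective _ (hF' j.unop)).toIso) ?_⟩⟩
  intro j i t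
  ext c
  exact un2 i.unop _ _ _ (hF i.unop _) (nat t.unop _ _ (hF j.unop c))

/-- One arrow `f` of the sieve suffices: the value on it descends, being invariant under the
endomorphisms over `f`, and the Ore condition compares the result with the other arrows. -/
lemma nerve_isSheafFor (X : E) {j : C} (S : Sieve j) (hS : ∃ (i : C) (f : i ⟶ j), S f) :
    Presieve.IsSheafFor ((nerve L).obj X) S.arrows := by
  obtain ⟨i, f, hf⟩ := hS
  intro x hx
  have hx' {i i' m : C} (g : i ⟶ j) (g' : i' ⟶ j) (hg : S g) (hg' : S g') (e : m ⟶ i)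
      (e' : m ⟶ i') (h : e ≫ g = e' ≫ g') :
      L.map e ≫ (show L.obj i ⟶ X from x g hg) = L.map e' ≫ (show L.obj i' ⟶ X from x g' hg') :=
    hx e e' hg hg' h
  obtain ⟨g, hg⟩ := hL.exists_desc f (show L.obj i ⟶ X from x f hf) fun φ hφ => by
    simpa using hx' f f hf hf φ (𝟙 i) (by simpa using hφ)
  refine ⟨g, fun i' f' hf' => ?_, fun g' hg' => ?_⟩
  · obtain ⟨m, k, k', e⟩ := hL.ore f f'
    have := hL.epi k'
    rw [← cancel_epi (L.map k')]
    refine Eq.trans ?_ (hx' f f' hf hf' k k' e)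
    rw [← hg, ← Category.assoc, ← L.map_comp, e, L.map_comp, Category.assoc]
    rfl
  · have := hL.epi f
    rw [← cancel_epi (L.map f), hg]
    exact hg' f hf

theorem isTopos : IsTopos E := by
  let J := GrothendieckTopology.atomic hL.ore
  have hsh (X : E) : Presheaf.IsSheaf J ((nerve L).obj X) := by
    rw [isSheaf_iff_isSheaf_of_type]
    exact fun j S hS => hL.nerve_isSheafFor X S hS
  let N : E ⥤ Sheaf J (Type w) := ObjectProperty.lift _ (nerve L) hsh
  have : (nerve L).Faithful := ⟨fun {X W g h} e => hL.hom_ext g h fun i c =>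
    ConcreteCategory.congr_hom (NatTrans.congr_app e (op i)) c⟩
  have : (nerve L).Full := ⟨fun {X W} φ => by
    obtain ⟨g, hg⟩ := hL.exists_hom (fun i c => φ.app (op i) c) (fun i j f c =>
      NatTrans.naturality_apply φ f.op c)
    refine ⟨g, ?_⟩
    ext i c
    exact hg i.unop c⟩
  have : N.Faithful := inferInstance
  have : N.Full := inferInstance
  have : N.EssSurj := ⟨fun A => by
    have hA := (isSheaf_iff_isSheaf_of_type J _).1 A.2
    have hA' {i j : C} (f : i ⟶ j) : Presieve.IsSheafFor A.obj (.singleton f) := by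
      rw [Presieve.isSheafFor_iff_generate]
      exact hA _ ⟨i, f, Sieve.le_generate (Presieve.singleton f) _ _ (Presieve.singleton_self f)⟩
    obtain ⟨X, ⟨e⟩⟩ := hL.exists_nerve_iso A.obj (fun {i j} f x y h => by
      obtain ⟨z, -, hz⟩ := Presieve.isSheafFor_singleton.1 (hA' f) (A.obj.map f.op x)
        (fun p₁ p₂ e => by
          rw [← Functor.map_comp_apply, ← Functor.map_comp_apply, ← op_comp, ← op_comp, e])
      exact (hz x rfl).trans (hz y h.symm).symm) (fun {i j} f y hy => by
      obtain ⟨z, hz, -⟩ := Presieve.isSheafFor_singleton.1 (hA' f) y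
        (fun {m} p₁ p₂ e => hy m p₁ p₂ e)
      exact ⟨z, hz⟩)
    exact ⟨X, ⟨ObjectProperty.isoMk _ e⟩⟩⟩
  have : N.IsEquivalence := {}
  exact ⟨C, _, J, ⟨N.asEquivalence⟩⟩

end IsGaloisSite
end Site

/-! ### Quotients of Galois objects by groups of automorphisms -/

section Quotient

variable {T : Type (w + 1)} [LargeCategory.{w} T] [IsTopos T] [hl : Fact (IsLocallyConnectedTopos T)]

lemma jointlyEpi_unit {D : Type*} [Category* D] {X Y : D} (f : X ⟶ Y) [Epi f] :
    JointlyEpi (fun _ : Unit => f) :=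
  fun _ _ _ H => (cancel_epi f).1 (H ⟨⟩)

omit hl in
lemma not_isInitial_pullback {A B C : T} (f : A ⟶ C) [Epi f] (g : B ⟶ C)
    (hB : ¬ Nonempty (IsInitial B)) : ¬ Nonempty (IsInitial (pullback f g)) := by
  rintro ⟨h⟩
  refine binaryCofan_disjoint (coprodIsCoprod (⊤_ T) (⊤_ T)) hB (terminal.from _)
    (terminal.from _) ((jointlyEpi_unit f).pullback g _ _ ?_)
  rintro ⟨W, ⟨⟩, ⟨a, b⟩, e⟩
  have hW : Nonempty (IsInitial W) := by
    by_contra hW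
    exact IsConn.of_hom hW (pullback.lift b a e.symm) ⟨h⟩
  exact hW.some.hom_ext _ _

lemma IsGal.epi {G A : T} (hG : IsGal G) (hA : IsGal A) (f : A ⟶ G) : Epi f :=
  epi_of_isConn f hA.slc hA.isConn.not_isInitial hG.isConn (hG.slc.hasInjectiveRestrictions hl.out)

/-- The quotients of a Galois object by the groups of its automorphisms. -/
theorem IsGal.exists_quotient {G : T} (hG : IsGal G) (H : Subgroup (Aut G)) :
    ∃ (Q : T) (q : G ⟶ Q), isSLC T Q ∧ Epi q ∧ (∀ h ∈ H, h.hom ≫ q = q) ∧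
      (∀ (W : T) (x : G ⟶ W), (∀ h ∈ H, h.hom ≫ x = x) → ∃ g, q ≫ g = x) ∧
      ∀ V, IsConn V → ∀ s t : V ⟶ G, s ≫ q = t ≫ q → ∃ h ∈ H, s ≫ h.hom = t := by
  have hG' := hG.slc.hasInjectiveRestrictions hl.out
  let a : (∐ fun _ : H => G) ⟶ G := Sigma.desc fun _ => 𝟙 G
  let b : (∐ fun _ : H => G) ⟶ G := Sigma.desc fun h => h.1.hom
  let q : G ⟶ coequalizer a b := coequalizer.π a b
  have hq (h) (hh : h ∈ H) : h.hom ≫ q = q := by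
    have := congrArg (fun t => Sigma.ι (fun _ : H => G) ⟨h, hh⟩ ≫ t) (coequalizer.condition a b)
    simpa [a, b] using this.symm
  have hdesc (W : T) (x : G ⟶ W) (hx : ∀ h ∈ H, h.hom ≫ x = x) : ∃ g, q ≫ g = x :=
    ⟨coequalizer.desc x (Sigma.hom_ext _ _ fun h => by simp [a, b, hx h.1 h.2]),
      coequalizer.π_desc _ _⟩
  have horb (V : T) (hV : IsConn V) (s t : V ⟶ G) (e : s ≫ q = t ≫ q) :
      ∃ h ∈ H, s ≫ h.hom = t := by
    have := eq_of_glue (u := fun V : {V : T // IsConn V} => V.1)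
      (hl.out.isConn_isSeparating.jointlyEpi) (fun V => V.2)
      (I := Unit) (R := H) (U := fun _ => G) (V := fun _ => G) (ι := fun _ => q) (s := fun _ => ⟨⟩)
      (t := fun _ => ⟨⟩) (fun _ => 𝟙 G) (fun h => h.1.hom)
      (fun W x hx => by
        obtain ⟨g, hg⟩ := hdesc W (x ⟨⟩) fun h hh => by simpa using (hx ⟨h, hh⟩).symm
        exact ⟨g, fun _ => hg⟩)
      (A := G) (S := Set (Aut G))
      -- The invariant of a point `b`, relative to an auxiliary point `a`, is the coset of
      -- automorphisms which carry `a` into the `H`-orbit of `b`.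
      (fun _ k a b => {χ | ∃ h ∈ H, a ≫ χ.hom = b ≫ h.hom})
      (fun _ k l c a b => by
        ext χ
        refine exists_congr fun h => and_congr_right fun _ => ⟨fun e => hG' _ _ k.2 l.2 c ?_,
          fun e => ?_⟩
        · simpa using e
        · simp [e])
      (fun r k a b => by
        ext χ
        constructor
        · rintro ⟨h, hh, e⟩
          refine ⟨h * r.1⁻¹, H.mul_mem hh (H.inv_mem r.2), ?_⟩
          change a ≫ χ.hom = (b ≫ r.1.hom) ≫ r.1.inv ≫ h.hom
          rw [Category.assoc, Iso.hom_inv_id_assoc r.1, e, Category.comp_id]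
        · rintro ⟨h, hh, e⟩
          refine ⟨h * r.1, H.mul_mem hh r.2, ?_⟩
          change a ≫ χ.hom = (b ≫ 𝟙 _) ≫ r.1.hom ≫ h.hom
          simpa using e)
      (k := ⟨V, hV⟩) t (i := ⟨⟩) (j := ⟨⟩) s t e
    have h1 : (1 : Aut G) ∈ {χ : Aut G | ∃ h ∈ H, t ≫ χ.hom = t ≫ h.hom} := ⟨1, H.one_mem, rfl⟩
    rw [← this] at h1
    obtain ⟨h, hh, e⟩ := h1
    exact ⟨h, hh, e.symm.trans (Category.comp_id t)⟩
  have hepi : Epi q := inferInstance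
  -- A local lift of `y` extends to `s` on `V` because `V` splits `G`. Local lifts differ by
  -- elements of `H`, so the condition that `s` lifts `y` is locally constant on `V`.
  have hlift (V : T) (hV : IsConn V) (hVG : Splits V G) (y : V ⟶ coequalizer a b) :
      ∃ s, s ≫ q = y := by
    let Ix := {p : Σ W : {W : T // IsConn W}, (W.1 ⟶ V) × (W.1 ⟶ G) // p.2.1 ≫ y = p.2.2 ≫ q}
    have hI : JointlyEpi (fun p : Ix => p.1.2.1) := by
      intro Z g g' H
      refine (jointlyEpi_unit q).pullback y _ _ fun p => ?_
      refine hl.out.isConn_isSeparating _ _ fun W hW c => ?_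
      have := H ⟨⟨⟨W, hW⟩, c ≫ p.2.2.1.1, c ≫ p.2.2.1.2⟩, by
        dsimp only
        rw [Category.assoc, Category.assoc, p.2.2.2]⟩
      simpa using this
    obtain ⟨i₀⟩ : Nonempty Ix := by
      by_contra! hE
      exact binaryCofan_disjoint (coprodIsCoprod (⊤_ T) (⊤_ T)) hV.not_isInitial (terminal.from _)
        (terminal.from _) (hI _ _ fun p => (hE.false p).elim)
    obtain ⟨s, hs⟩ := (hVG _ i₀.1.1.2 i₀.1.2.1).2 i₀.1.2.2
    dsimp only at hs
    have := hV.forall_of_locally_const hl.out hI (fun p => p.1.2.1 ≫ y = p.1.2.1 ≫ s ≫ q) (by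
      intro W hW i j c d e h
      rw [i.2, ← Category.assoc] at h
      obtain ⟨k, hk, h⟩ := horb _ i.1.1.2 _ _ h
      have h2 : (c ≫ i.1.2.2) ≫ q = (d ≫ j.1.2.2) ≫ q := by
        rw [Category.assoc, Category.assoc, ← i.2, ← j.2, reassoc_of% e]
      obtain ⟨k', hk', h'⟩ := horb _ hW _ _ h2
      have h3 : j.1.2.2 ≫ (k'⁻¹).hom ≫ k.hom = j.1.2.1 ≫ s := by
        apply hG' _ _ hW j.1.1.2 d
        dsimp only
        rw [← Category.assoc, ← h', ← reassoc_of% e, ← h]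
        refine (Category.assoc _ k'.hom _).trans (Eq.trans ?_ (Category.assoc _ _ _))
        exact congrArg (fun t => (c ≫ i.1.2.2) ≫ t) (Iso.hom_inv_id_assoc k' k.hom)
      rw [j.2, ← Category.assoc, ← h3]
      simp only [Category.assoc, hq k hk, hq _ (H.inv_mem hk')]) (i₀ := i₀) i₀.1.1.2
      (by rw [i₀.2, ← hs, Category.assoc])
    exact ⟨s, hI _ _ fun p => (this p p.1.1.2).symm⟩
  refine ⟨coequalizer a b, q, ?_, hepi, hq, hdesc, horb⟩
  refine .of_isLocallyConstantObject ((isLocallyConstantObject_iff hl.out).2 ?_)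
  obtain ⟨I, Z, ι, hZ, ⟨hι⟩⟩ := hG.slc
  -- Being connected, `G` equals one of its locally constant summands.
  obtain ⟨⟨i, s⟩, hs⟩ := (hG.isConn.bijective_cofan hι).2 (𝟙 G)
  have hsep := (isLocallyConstantObject_iff hl.out).1 (hZ i)
  have hGi : IsIso (ι i) := by
    have := mono_of_isColimit_cofan hι i
    have : IsSplitEpi (ι i) := ⟨⟨s, hs⟩⟩
    exact isIso_of_mono_of_isSplitEpi _
  intro A B g g' hgg
  refine hsep _ _ fun V hV c => hgg V ⟨hV.1, ?_⟩ c
  have hVG : Splits V G := by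
    intro W hW f
    have := hV.2 W hW f
    refine ⟨fun x y e => ?_, fun y => ?_⟩
    · rw [← cancel_mono (inv (ι i))]
      refine this.1 ?_
      dsimp only at e ⊢
      rw [reassoc_of% e]
    · obtain ⟨x, hx⟩ := this.2 (y ≫ inv (ι i))
      refine ⟨x ≫ ι i, ?_⟩
      dsimp only at hx ⊢
      rw [reassoc_of% hx, IsIso.inv_hom_id, Category.comp_id]
  intro W hW f
  refine ⟨fun x y e => ?_, fun y => ?_⟩
  · obtain ⟨s, rfl⟩ := hlift V hV.1 hVG x
    obtain ⟨t, rfl⟩ := hlift V hV.1 hVG y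
    dsimp only at e
    rw [← Category.assoc, ← Category.assoc] at e
    obtain ⟨h, hh, e'⟩ := horb W hW _ _ e
    obtain rfl : s ≫ h.hom = t := hG' _ _ hW hV.1 f (by simpa using e')
    rw [Category.assoc, hq h hh]
  · obtain ⟨s, rfl⟩ := hlift W hW (hVG.of_hom hW f) y
    obtain ⟨t, rfl⟩ := (hVG W hW f).2 s
    exact ⟨t ≫ q, (Category.assoc _ _ _).symm⟩

end Quotient

/-! ### The slice of `SLC T` over `Y` as an atomic topos -/

section Slice

variable {T : Type (w + 1)} [LargeCategory.{w} T] [IsTopos T] [hl : Fact (IsLocallyConnectedTopos T)]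
  {Λ : Type w} {G : Λ → SLC T} (hG : ∀ i, IsGal (G i).obj)
  (hΛ : ∀ K, isSLC T K → JointlyEpi (fun p : Σ i, ((G i).obj ⟶ K) => p.2)) (Y : SLC T)

/-- The objects of the slice over `Y` given by a family of objects. -/
abbrev overFamily (G : Λ → SLC T) (Y : SLC T) (p : Σ i, (G i ⟶ Y)) : Over Y := Over.mk p.2

/-- The inclusion in the slice over `Y` of the full subcategory given by a family of objects. -/
abbrev overFamilyFunctor (G : Λ → SLC T) (Y : SLC T) :
    InducedCategory (Over Y) (overFamily G Y) ⥤ Over Y := inducedFunctor _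

include hΛ in
omit hl in
lemma exists_hom_of_not_isInitial {K : T} (hK : isSLC T K) (hK' : ¬ Nonempty (IsInitial K)) :
    ∃ i, Nonempty ((G i).obj ⟶ K) := by
  by_contra! H
  exact binaryCofan_disjoint (coprodIsCoprod (⊤_ T) (⊤_ T)) hK' (terminal.from _)
    (terminal.from _) (hΛ K hK _ _ fun p => ((H p.1).false p.2).elim)

include hG hΛ

omit hG hl [IsTopos T] in
lemma over_hom_ext {X W : Over Y} (g h : X ⟶ W)
    (H : ∀ i (c : (overFamilyFunctor G Y).obj i ⟶ X), c ≫ g = c ≫ h) : g = h := by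
  ext
  refine hΛ _ X.left.2 _ _ fun p => ?_
  let i : Σ i, (G i ⟶ Y) := ⟨p.1, ⟨p.2⟩ ≫ X.hom⟩
  have := H i (Over.homMk ⟨p.2⟩)
  exact congrArg (fun t => t.left.hom) this

omit hG in
lemma over_exists_hom {X W : Over Y}
    (x : ∀ i, ((overFamilyFunctor G Y).obj i ⟶ X) → ((overFamilyFunctor G Y).obj i ⟶ W))
    (hx : ∀ i j (f : i ⟶ j) c,
      x i ((overFamilyFunctor G Y).map f ≫ c) = (overFamilyFunctor G Y).map f ≫ x j c) :
    ∃ g : X ⟶ W, ∀ i c, c ≫ g = x i c := by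
  let I (i : Λ) (c : (G i).obj ⟶ X.left.obj) : InducedCategory (Over Y) (overFamily G Y) :=
    (⟨i, ⟨c⟩ ≫ X.hom⟩ : Σ i, (G i ⟶ Y))
  let x' (i : Λ) (c : (G i).obj ⟶ X.left.obj) : (G i).obj ⟶ W.left.obj :=
    (x (I i c) (Over.homMk ⟨c⟩)).left.hom
  have hx' {i j : Λ} (r : (G i).obj ⟶ (G j).obj) (c : (G j).obj ⟶ X.left.obj) :
      x' i (r ≫ c) = r ≫ x' j c := by
    let f : I i (r ≫ c) ⟶ I j c := InducedCategory.homMk (Over.homMk ⟨r⟩ (by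
      ext; simp [I]))
    let C : (overFamilyFunctor G Y).obj (I j c) ⟶ X := Over.homMk ⟨c⟩
    have h1 := hx _ _ f C
    have h2 : (overFamilyFunctor G Y).map f ≫ C =
        (Over.homMk ⟨r ≫ c⟩ : overFamily G Y (I i (r ≫ c)) ⟶ X) := by
      ext; rfl
    rw [h2] at h1
    exact congrArg (fun t => t.left.hom) h1
  obtain ⟨g, hg⟩ := (hΛ _ X.left.2).exists_glue (fun p => x' p.1 p.2) (by
    intro Z p q a b e
    -- `Z` is an arbitrary object of `T`, on which the Galois objects need not be jointly
    -- epimorphic. The pair `(a, b)` factors through a fiber product in `SLC`, where they are.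
    have hP := isSLC.of_isPullback hl.out (IsPullback.of_hasPullback p.2 q.2) (G p.1).2 (G q.1).2
      X.left.2
    refine (hΛ _ hP).pullback (pullback.lift a b e) _ _ fun r => ?_
    obtain ⟨V, ⟨i, c⟩, ⟨d, d'⟩, e'⟩ := r
    dsimp only at e' ⊢
    have ha : d ≫ a = d' ≫ c ≫ pullback.fst _ _ := by
      rw [← reassoc_of% e', pullback.lift_fst]
    have hb : d ≫ b = d' ≫ c ≫ pullback.snd _ _ := by
      rw [← reassoc_of% e', pullback.lift_snd]
    rw [reassoc_of% ha, reassoc_of% hb]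
    congr 1
    rw [← Category.assoc, ← hx', ← Category.assoc, ← hx', Category.assoc, Category.assoc,
      pullback.condition])
  refine ⟨Over.homMk ⟨g⟩ ?_, fun i c => ?_⟩
  · ext
    refine hΛ _ X.left.2 _ _ fun p => ?_
    have h1 := hg p
    have h2 := congrArg (fun t => t.hom) (Over.w (x (I p.1 p.2) (Over.homMk ⟨p.2⟩)))
    change p.2 ≫ g ≫ W.hom.hom = _
    rw [← Category.assoc, h1]
    exact h2
  · ext
    have h1 := hg ⟨i.1, c.left.hom⟩
    let f : I i.1 c.left.hom ⟶ i := InducedCategory.homMk (Over.homMk (𝟙 _) (by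
      exact (Category.id_comp _).trans (Over.w c).symm))
    have h2 := hx _ _ f c
    have h3 : (overFamilyFunctor G Y).map f ≫ c =
        (Over.homMk ⟨c.left.hom⟩ : overFamily G Y (I i.1 c.left.hom) ⟶ X) := by
      ext; exact Category.id_comp _
    rw [h3] at h2
    refine h1.trans ((congrArg (fun t => t.left.hom) h2).trans ?_)
    exact Category.id_comp _

lemma isGaloisSite_overFamilyFunctor : IsGaloisSite (overFamilyFunctor G Y) := by
  have hG' (i) := (hG i).slc.hasInjectiveRestrictions hl.out
  have hepi {i j : Σ i, (G i ⟶ Y)} (f : overFamily G Y i ⟶ overFamily G Y j) : Epi f.left.hom :=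
    (hG j.1).epi (hG i.1) f.left.hom
  refine
  { full := inferInstance
    faithful := inferInstance
    hom_ext := over_hom_ext hΛ Y
    exists_hom := over_exists_hom hΛ Y
    ore := ?_
    epi := ?_
    exists_desc := ?_
    exists_aut := ?_
    exists_quotient := ?_
    exists_sum := ?_ }
  -- The fiber product is a non-initial sum of locally constant objects, so it receives a morphism
  -- from a Galois object.
  · intro k i j f g
    have hP := isSLC.of_isPullback hl.out (IsPullback.of_hasPullback f.hom.left.hom g.hom.left.hom)
      (G i.1).2 (G j.1).2 (G k.1).2
    have := hepi f.hom
    obtain ⟨m, ⟨c⟩⟩ := exists_hom_of_not_isInitial hΛ hP (not_isInitial_pullback f.hom.left.hom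
      g.hom.left.hom (hG j.1).isConn.not_isInitial)
    let m' : InducedCategory (Over Y) (overFamily G Y) :=
      (⟨m, ⟨c ≫ pullback.fst _ _⟩ ≫ i.2⟩ : Σ i, (G i ⟶ Y))
    have e : (⟨c ≫ pullback.fst f.hom.left.hom g.hom.left.hom⟩ : G m ⟶ G i.1) ≫ f.hom.left =
        (⟨c ≫ pullback.snd f.hom.left.hom g.hom.left.hom⟩ : G m ⟶ G j.1) ≫ g.hom.left := by
      ext
      simp [pullback.condition]
    refine ⟨m', InducedCategory.homMk (Over.homMk ⟨c ≫ pullback.fst _ _⟩ rfl),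
      InducedCategory.homMk (Over.homMk ⟨c ≫ pullback.snd _ _⟩ ?_), ?_⟩
    · have h1 : f.hom.left ≫ k.2 = i.2 := Over.w f.hom
      have h2 : g.hom.left ≫ k.2 = j.2 := Over.w g.hom
      change _ ≫ j.2 = _ ≫ i.2
      rw [← h1, ← h2, reassoc_of% e]
    · ext
      exact congrArg (fun t => t.hom) e
  · intro i j f
    have := hepi f.hom
    exact (Over.forget Y ⋙ (isSLC T).ι).epi_of_epi_map this
  -- Two points of the source with the same image in the target differ by an automorphism, which
  -- lies over the target by unique continuation; so `x` does not separate them.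
  · intro i j f W x hx
    have := hepi f.hom
    obtain ⟨g, hg⟩ := (jointlyEpi_unit f.hom.left.hom).exists_glue (fun _ => x.left.hom) (by
      intro Z _ _ a b e
      refine hl.out.isConn_isSeparating _ _ fun V hV c => ?_
      obtain ⟨φ, hφ, -⟩ := (hG i.1).existsUnique_aut hV (c ≫ a) (c ≫ b)
      have h1 : φ.hom ≫ f.hom.left.hom = f.hom.left.hom := by
        refine hG' _ _ _ hV (hG i.1).isConn (c ≫ a) ?_
        dsimp only
        rw [← Category.assoc, hφ, Category.assoc, Category.assoc, e]
      have h2 : (⟨φ.hom⟩ : G i.1 ⟶ G i.1) ≫ i.2 = i.2 := by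
        have : f.hom.left ≫ j.2 = i.2 := Over.w f.hom
        rw [← this, ← Category.assoc]
        congr 1
        ext
        exact h1
      have h3 := hx (InducedCategory.homMk (Over.homMk ⟨φ.hom⟩ h2)) (by
        ext
        exact h1)
      have h4 : φ.hom ≫ x.left.hom = x.left.hom := congrArg (fun t => t.left.hom) h3
      rw [← Category.assoc, ← Category.assoc, ← hφ]
      exact ((Category.assoc (c ≫ a) φ.hom _).trans (congrArg _ h4)).symm)
    refine ⟨Over.homMk ⟨g⟩ ?_, ?_⟩
    · ext
      have h1 := congrArg (fun t => t.hom) (Over.w f.hom)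
      have h2 := congrArg (fun t => t.hom) (Over.w x)
      rw [← cancel_epi f.hom.left.hom]
      change f.hom.left.hom ≫ g ≫ W.hom.hom = _
      rw [← Category.assoc, hg ⟨⟩]
      exact h2.trans h1.symm
    · ext
      exact hg ⟨⟩
  · intro i j e e'
    obtain ⟨φ, hφ, -⟩ := (hG j.1).existsUnique_aut (hG i.1).isConn e.hom.left.hom e'.hom.left.hom
    have h : ((isSLC T).isoMk φ).hom ≫ j.2 = j.2 := by
      ext
      have := hepi e.hom
      rw [← cancel_epi e.hom.left.hom]
      have h1 := congrArg (fun t => t.hom) (Over.w e.hom)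
      have h2 := congrArg (fun t => t.hom) (Over.w e'.hom)
      change e.hom.left.hom ≫ φ.hom ≫ j.2.hom = _
      rw [← Category.assoc, hφ]
      exact h2.trans h1.symm
    refine ⟨InducedCategory.isoMk (Over.isoMk ((isSLC T).isoMk φ) h), ?_⟩
    ext
    exact hφ
  · intro i H
    let U := overFamilyFunctor G Y ⋙ Over.forget Y ⋙ (isSLC T).ι
    obtain ⟨Q, q, hQ, hqe, hq, hdesc, horb⟩ := (hG i.1).exists_quotient (H.map (U.mapAut i))
    obtain ⟨p, hp⟩ := hdesc _ i.2.hom (by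
      rintro _ ⟨h, hh, rfl⟩
      exact congrArg (fun t => t.hom) (Over.w h.hom.hom))
    refine ⟨Over.mk (Y := ⟨Q, hQ⟩) ⟨p⟩, Over.homMk ⟨q⟩ (by ext; exact hp), ?_, ?_, ?_⟩
    · intro h hh
      ext
      exact hq _ ⟨h, hh, rfl⟩
    · intro m e e' h
      obtain ⟨_, ⟨h, hh, rfl⟩, e⟩ := horb _ (hG m.1).isConn e.hom.left.hom e'.hom.left.hom
        (congrArg (fun t => t.left.hom) h)
      refine ⟨h, hh, ?_⟩
      ext
      exact e
    · intro j c
      have hP := isSLC.of_isPullback hl.out (IsPullback.of_hasPullback q c.left.hom)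
        (G i.1).2 (G j.1).2 hQ
      obtain ⟨m, ⟨d⟩⟩ := exists_hom_of_not_isInitial hΛ hP (not_isInitial_pullback q
        c.left.hom (hG j.1).isConn.not_isInitial)
      let m' : InducedCategory (Over Y) (overFamily G Y) :=
        (⟨m, ⟨d ≫ pullback.snd _ _⟩ ≫ j.2⟩ : Σ i, (G i ⟶ Y))
      have hc : c.left.hom ≫ p = j.2.hom := congrArg (fun t => t.hom) (Over.w c)
      refine ⟨m', InducedCategory.homMk (Over.homMk ⟨d ≫ pullback.snd _ _⟩ rfl),
        InducedCategory.homMk (Over.homMk ⟨d ≫ pullback.fst _ _⟩ ?_), ?_⟩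
      · ext
        change (d ≫ pullback.fst _ _) ≫ i.2.hom = (d ≫ pullback.snd _ _) ≫ j.2.hom
        rw [← hp, ← hc, Category.assoc, pullback.condition_assoc, Category.assoc]
      · ext
        change (d ≫ pullback.fst _ _) ≫ q = (d ≫ pullback.snd _ _) ≫ c.left.hom
        rw [Category.assoc, pullback.condition, Category.assoc]
  · intro I Z
    let X : T := ∐ fun a => (Z a).left.obj
    have hX : isSLC T X := isSLC.of_cofan (coproductIsCoproduct _) fun a => (Z a).left.2
    refine ⟨Over.mk (Y := ⟨X, hX⟩) ⟨Sigma.desc fun a => (Z a).hom.hom⟩,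
      fun a => Over.homMk ⟨Sigma.ι (fun a => (Z a).left.obj) a⟩ (by
        ext
        exact Sigma.ι_desc _ _), fun j => ?_⟩
    have hb := (hG j.1).isConn.bijective_cofan (coproductIsCoproduct fun a => (Z a).left.obj)
    constructor
    · rintro ⟨a, c⟩ ⟨b, d⟩ e
      have h := hb.1 (a₁ := ⟨a, c.left.hom⟩) (a₂ := ⟨b, d.left.hom⟩)
        (congrArg (fun t => t.left.hom) e)
      obtain ⟨rfl, h⟩ := Sigma.mk.inj h
      have h := eq_of_heq h
      congr 1
      ext
      exact h
    · intro c
      obtain ⟨⟨a, d⟩, hd⟩ := hb.2 c.left.hom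
      dsimp only at hd
      refine ⟨⟨a, Over.homMk ⟨d⟩ ?_⟩, ?_⟩
      · ext
        have := congrArg (fun t => t.hom) (Over.w c)
        refine Eq.trans ?_ this
        change d ≫ (Z a).hom.hom = c.left.hom ≫ Sigma.desc fun a => (Z a).hom.hom
        rw [← hd]
        simp
      · ext
        exact hd

omit hG hΛ in
theorem isTopos_over : IsTopos (Over Y) := by
  obtain ⟨Λ, G, hG, hΛ⟩ := exists_small_isGal T
  exact (isGaloisSite_overFamilyFunctor (G := fun i => ⟨G i, (hG i).slc⟩) hG hΛ Y).isTopos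

end Slice

/-! ### Splitting, local constancy and Galois objects in the slice -/

section GaloisSlice

theorem isGaloisObject_of_isGal {D : Type (w + 1)} [LargeCategory.{w} D] [IsTopos D]
    (hl : IsLocallyConnectedTopos D) {Z : D} (hZ : IsGal Z) (hZ' : IsLocallyConstantObject Z) :
    IsGaloisObject Z := by
  obtain ⟨P, fst, snd, ⟨hP⟩⟩ := exists_binaryProduct Z Z
  have h1 (φ : Aut Z) : hP.lift (BinaryFan.mk (𝟙 Z) φ.hom) ≫ fst = 𝟙 Z :=
    hP.fac _ ⟨WalkingPair.left⟩
  have h2 (φ : Aut Z) : hP.lift (BinaryFan.mk (𝟙 Z) φ.hom) ≫ snd = φ.hom :=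
    hP.fac _ ⟨WalkingPair.right⟩
  refine ⟨hZ.isConn.connected, hZ', P, fst, snd, hP,
    nonempty_isColimit_cofan hl _ fun V hV => ⟨?_, fun x => ?_⟩⟩
  · rintro ⟨φ, a⟩ ⟨ψ, b⟩ e
    obtain rfl : a = b := by
      have := congrArg (· ≫ fst) e
      simp only [Category.assoc, h1] at this
      exact (Category.comp_id _).symm.trans (this.trans (Category.comp_id _))
    have e' : a ≫ φ.hom = a ≫ ψ.hom := by
      simpa only [Category.assoc, h2] using congrArg (· ≫ snd) e
    rw [(hZ.existsUnique_aut hV a (a ≫ ψ.hom)).unique e' rfl]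
  · obtain ⟨φ, hφ, -⟩ := hZ.existsUnique_aut hV (x ≫ fst) (x ≫ snd)
    refine ⟨⟨φ, x ≫ fst⟩, BinaryFan.IsLimit.hom_ext hP ?_ ?_⟩
    · exact (Category.assoc _ _ _).trans ((congrArg _ (h1 φ)).trans (Category.comp_id _))
    · exact (Category.assoc _ _ _).trans ((congrArg _ (h2 φ)).trans hφ)

section

variable {E : Type (w + 1)} [LargeCategory.{w} E] {Y : E}

lemma isColimit_binaryCofan_over_iff [HasBinaryCoproducts E] {X₁ X₂ Z : Over Y} {i : X₁ ⟶ Z}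
    {j : X₂ ⟶ Z} : Nonempty (IsColimit (BinaryCofan.mk i j)) ↔
      Nonempty (IsColimit (BinaryCofan.mk i.left j.left)) := by
  constructor
  · rintro ⟨h⟩
    exact ⟨isColimitMapCoconeBinaryCofanEquiv (Over.forget Y) _ _
      (isColimitOfPreserves (Over.forget Y) h)⟩
  · rintro ⟨h⟩
    exact ⟨isColimitOfReflects (Over.forget Y)
      ((isColimitMapCoconeBinaryCofanEquiv (Over.forget Y) _ _).symm h)⟩

lemma nonempty_isInitial_over_iff [HasInitial E] {Z : Over Y} :
    Nonempty (IsInitial Z) ↔ Nonempty (IsInitial Z.left) := by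
  constructor
  · rintro ⟨h⟩
    exact ⟨IsInitial.isInitialObj (Over.forget Y) _ h⟩
  · rintro ⟨h⟩
    exact ⟨IsInitial.ofUniqueHom (fun W => Over.homMk (h.to _) (h.hom_ext _ _)) fun W m => by
      ext; exact h.hom_ext _ _⟩

lemma isConnectedObject_over_iff [HasBinaryCoproducts E] [HasInitial E] {Z : Over Y} :
    IsConnectedObject Z ↔ IsConnectedObject Z.left := by
  constructor
  · intro h X₁ X₂ i₁ i₂ hi
    have := h (Over.mk (i₁ ≫ Z.hom)) (Over.mk (i₂ ≫ Z.hom)) (Over.homMk i₁) (Over.homMk i₂)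
      (isColimit_binaryCofan_over_iff.2 hi)
    rwa [nonempty_isInitial_over_iff, nonempty_isInitial_over_iff] at this
  · intro h X₁ X₂ i₁ i₂ hi
    rw [nonempty_isInitial_over_iff, nonempty_isInitial_over_iff]
    exact h _ _ _ _ (isColimit_binaryCofan_over_iff.1 hi)

lemma isConn_over_iff [HasBinaryCoproducts E] [HasInitial E] {Z : Over Y} :
    IsConn Z ↔ IsConn Z.left :=
  ⟨fun h => ⟨isConnectedObject_over_iff.1 h.1, fun h' => h.2 (nonempty_isInitial_over_iff.2 h')⟩,
    fun h => ⟨isConnectedObject_over_iff.2 h.1, fun h' => h.2 (nonempty_isInitial_over_iff.1 h')⟩⟩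

end

section

variable {T : Type (w + 1)} [LargeCategory.{w} T] [IsTopos T] [hl : Fact (IsLocallyConnectedTopos T)]

instance : HasBinaryCoproducts (SLC T) :=
  hasColimitsOfShape_of_equivalence (Discrete.equivalence (Equiv.ulift.{w}.trans (Equiv.refl WalkingPair)))

instance : HasInitial (SLC T) :=
  hasColimitsOfShape_of_equivalence (Discrete.equivalence
    (Equiv.equivOfIsEmpty PEmpty.{w + 1} PEmpty.{1}))

/-- `SLC T` is equivalent to the slice over its final object, so it needs no site of its own. -/
instance isTopos_slc : IsTopos (SLC T) := by
  obtain ⟨C, _, J, ⟨e⟩⟩ := (isTopos_over (T := T) (⊤_ (SLC T))).exists_site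
  exact ⟨C, _, J, ⟨(Over.equivalenceOfIsTerminal terminalIsTerminal).symm.trans e⟩⟩

instance (Y : SLC T) : IsTopos (Over Y) := isTopos_over Y

lemma isLocallyConnectedTopos_over (Y : SLC T) : IsLocallyConnectedTopos (Over Y) := by
  obtain ⟨Λ, G, hG, hΛ⟩ := exists_small_isGal T
  intro X Z f g H
  refine over_hom_ext (G := fun i => ⟨G i, (hG i).slc⟩) hΛ Y f g fun i c => H _ ?_ c
  exact isConnectedObject_over_iff.2 (isConn_slc_iff.2 (hG i.1).isConn).connected

lemma isLocallyConnectedTopos_slc : IsLocallyConnectedTopos (SLC T) := by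
  obtain ⟨Λ, G, hG, hΛ⟩ := exists_small_isGal T
  intro X Z f g H
  ext
  refine hΛ _ X.2 _ _ fun p => ?_
  exact congrArg (fun t => t.hom) (H ⟨G p.1, (hG p.1).slc⟩ (isConn_slc_iff.2 (hG p.1).isConn).1
    ⟨p.2⟩)

/-- Splitting can be tested on the sums of locally constant objects. -/
theorem splits_slc_iff {V X : SLC T} (hV : IsConn V) : Splits V X ↔ Splits V.obj X.obj := by
  constructor
  -- Splitting in `SLC` tests fewer connected objects than splitting in `T`, but it already
  -- decomposes the product `X × V` as a sum, and both products and sums are those of `T`.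
  · intro h
    obtain ⟨P, fst, snd, ⟨hP⟩⟩ := exists_binaryProduct X V
    have hP' : IsLimit (BinaryFan.mk fst.hom snd.hom) :=
      isLimitMapConeBinaryFanEquiv (isSLC T).ι _ _ (isLimitOfPreserves (isSLC T).ι hP)
    have hc := isColimit_cofan_slc_iff.1 (h.nonempty_isColimit isLocallyConnectedTopos_slc hP)
    refine Trivializes.splits (trivializes_iff_exists_cofan.2 ⟨P.obj, fst.hom, snd.hom, hP', (V ⟶ X),
      _, fun s => ?_, hc⟩) (isConn_slc_iff.1 hV) (𝟙 _)
    exact congrArg (fun t : V ⟶ V => t.hom)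
      (hP.fac (BinaryFan.mk s (𝟙 V)) ⟨WalkingPair.right⟩)
  · intro h W hW f
    refine ⟨fun s t e => ?_, fun s => ?_⟩
    · ext
      exact (h W.obj (isConn_slc_iff.1 hW) f.hom).1 (congrArg (fun t => t.hom) e)
    · obtain ⟨t, ht⟩ := (h W.obj (isConn_slc_iff.1 hW) f.hom).2 s.hom
      exact ⟨⟨t⟩, by ext; exact ht⟩

/-- The extended morphism lies over `Y` automatically, by unique continuation in `Y`. -/
lemma splits_over {Y : SLC T} {V Z : Over Y} (hV : IsConn V) (h : Splits V.left.obj Z.left.obj) :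
    Splits V Z := by
  have hV' := isConn_over_iff.1 hV
  intro W hW f
  have hW' := isConn_over_iff.1 hW
  have hs := (splits_slc_iff hV').2 h _ hW' f.left
  refine ⟨fun s t e => ?_, fun s => ?_⟩
  · ext1
    exact hs.1 (congrArg (fun t => t.left) e)
  · obtain ⟨t, ht⟩ := hs.2 s.left
    dsimp only at ht
    refine ⟨Over.homMk t ?_, ?_⟩
    · ext
      refine Y.2.hasInjectiveRestrictions hl.out _ _ (isConn_slc_iff.1 hW') (isConn_slc_iff.1 hV')
        f.left.hom ?_
      change f.left.hom ≫ t.hom ≫ Z.hom.hom = f.left.hom ≫ V.hom.hom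
      have h1 : f.left.hom ≫ t.hom = s.left.hom := congrArg (fun t => t.hom) ht
      have h2 := congrArg (fun t => t.hom) (Over.w s)
      have h3 := congrArg (fun t => t.hom) (Over.w f)
      rw [← Category.assoc, h1]
      exact h2.trans h3.symm
    · ext1
      exact ht

variable (hc : IsConnectedTopos T)
include hc

lemma epi_terminal_from {A : T} (hA : isSLC T A) (hA' : ¬ Nonempty (IsInitial A)) :
    Epi (terminal.from A) :=
  epi_of_isConn _ hA hA' ⟨hc, IsConn.of_hom hA' (terminal.from A)⟩
    (isSLC_of_isTerminal hl.out terminalIsTerminal |>.hasInjectiveRestrictions hl.out)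

/-- As `T` is connected, the projection from `G × G'` to a Galois object `G'` is an epimorphism, and
the product is covered by Galois objects, all of which map to `G`. -/
theorem isSeparating_over (Y : SLC T) {G : T} (hG : IsGal G) :
    ObjectProperty.IsSeparating
      (fun V : Over Y => IsGal V.left.obj ∧ Nonempty (V.left.obj ⟶ G)) := by
  intro A B g h H
  obtain ⟨Λ, G', hG', hΛ⟩ := exists_small_isGal T
  refine over_hom_ext (G := fun i => ⟨G' i, (hG' i).slc⟩) hΛ Y g h fun i c => ?_
  have h1 := epi_terminal_from hc hG.slc hG.isConn.not_isInitial
  have h2 := not_isInitial_pullback (terminal.from G) (terminal.from (G' i.1))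
    (hG' i.1).isConn.not_isInitial
  have h3 := isSLC.of_isPullback hl.out (IsPullback.of_hasPullback (terminal.from G)
    (terminal.from (G' i.1))) hG.slc (hG' i.1).slc (isSLC_of_isTerminal hl.out terminalIsTerminal)
  have h4 := epi_of_isConn (pullback.snd (terminal.from G) (terminal.from (G' i.1)))
    h3 h2 (hG' i.1).isConn ((hG' i.1).slc.hasInjectiveRestrictions hl.out)
  ext
  refine (cancel_epi (pullback.snd (terminal.from G) (terminal.from (G' i.1)))).1
    (hΛ _ h3 _ _ fun p => ?_)
  let r : (⟨G' p.1, (hG' p.1).slc⟩ : SLC T) ⟶ ⟨G' i.1, (hG' i.1).slc⟩ := ⟨p.2 ≫ pullback.snd _ _⟩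
  let v : Over.mk (r ≫ i.2) ⟶ Over.mk i.2 := Over.homMk r
  have := H (Over.mk (r ≫ i.2)) ⟨hG' p.1, ⟨p.2 ≫ pullback.fst _ _⟩⟩ (v ≫ c)
  have := congrArg (fun t => t.left.hom) this
  simpa [v, r] using this

theorem isLocallyConstantObject_over {Y : SLC T} {Z : Over Y} {G : T} (hG : IsGal G)
    (hGZ : Splits G Z.left.obj) : IsLocallyConstantObject Z :=
  (isLocallyConstantObject_iff (isLocallyConnectedTopos_over Y)).2 fun _ _ _ _ H =>
    isSeparating_over hc Y hG _ _ fun V hV c =>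
      have hV' : IsConn V := isConn_over_iff.2 (isConn_slc_iff.2 hV.1.isConn)
      H V ⟨hV', splits_over hV' (hGZ.of_hom hV.1.isConn hV.2.some)⟩ c

/-- A Galois object in the slice category. -/
theorem isGaloisObject_over {Y : SLC T} {Z : Over Y} (hZ : IsGal Z.left.obj) :
    IsGaloisObject Z := by
  have hZc : IsConn Z := isConn_over_iff.2 (isConn_slc_iff.2 hZ.isConn)
  have hloc := isLocallyConstantObject_over hc hZ hZ.splits
  exact isGaloisObject_of_isGal (isLocallyConnectedTopos_over Y)
    ⟨hZc, .of_isLocallyConstantObject hloc, splits_over hZc hZ.splits⟩ hloc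

omit hc in
theorem exists_isGal_splits (ht : ¬ Nonempty (IsInitial (⊤_ T))) {Z : T}
    (hZ : IsLocallyConstantObject Z) : ∃ G, IsGal G ∧ Splits G Z := by
  -- The covering sieve consists of the objects which map to one trivializing `Z`.
  obtain ⟨G, hG, h⟩ := exists_isGal_of_coveringSieve ht ⟨_, hZ (⊤_ T)⟩
  refine ⟨G, hG, h Z (.of_isLocallyConstantObject hZ) ?_⟩
  rintro U f ⟨W, ⟨g⟩⟩ hU
  by_cases hU' : Nonempty (IsInitial U)
  · exact (splits_of_isInitial hU'.some).trivializes hl.out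
  · exact (W.2.splits ⟨hU, hU'⟩ g).trivializes hl.out

/-- All objects of the slice category are sums of locally constant objects. -/
theorem isSLC_over {Y : SLC T} (Z : Over Y) : isSLC (Over Y) Z := by
  -- The degenerate topos counts as connected, but has no non-initial Galois object; there every
  -- object is an empty sum.
  by_cases ht : Nonempty (IsInitial (⊤_ T))
  · have h0 : Nonempty (IsInitial Z.left.obj) := by
      by_contra h
      exact IsConn.of_hom h (terminal.from _) ht
    have hZ := nonempty_isInitial_over_iff.2 (nonempty_isInitial_slc_iff.2 h0)
    exact ⟨PEmpty, fun i => i.elim, fun i => i.elim, fun i => i.elim, ⟨Cofan.IsColimit.mk _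
      (fun _ => hZ.some.to _) (fun _ i => i.elim) (fun _ _ _ => hZ.some.hom_ext _ _)⟩⟩
  · obtain ⟨I, Z', ι, hZ', hι⟩ := Z.left.2
    let Z'' (i : I) : SLC T := ⟨Z' i, .of_isLocallyConstantObject (hZ' i)⟩
    let κ (i : I) : Z'' i ⟶ Z.left := ⟨ι i⟩
    refine ⟨I, fun i => Over.mk (κ i ≫ Z.hom), fun i => Over.homMk (κ i), fun i => ?_, ?_⟩
    · obtain ⟨G, hG, h⟩ := exists_isGal_splits ht (hZ' i)
      exact isLocallyConstantObject_over hc hG h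
    · obtain ⟨h⟩ := (isColimit_cofan_slc_iff (ι := κ)).2 hι
      exact ⟨isColimitOfReflects (Over.forget Y)
        ((isColimitMapCoconeCofanMkEquiv (Over.forget Y) (fun i => Over.mk (κ i ≫ Z.hom)) _).symm h)⟩

theorem isGaloisTopos_over (Y : SLC T) : IsGaloisTopos (Over Y) where
  isTopos := isTopos_over Y
  separating := by
    obtain ⟨Λ, G, hG, hΛ⟩ := exists_small_isGal T
    intro X Z f g H
    exact over_hom_ext (G := fun i => ⟨G i, (hG i).slc⟩) hΛ Y f g fun i c =>
      H _ (isGaloisObject_over hc (hG i.1)) c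

end

end GaloisSlice

/-! ### The point of the slice given by an element of the fiber -/

section Fiber

variable {E : Type (w + 1)} [LargeCategory.{w} E] [HasFiniteLimits E] {Y : E} (F : E ⥤ Type w)
  (a : F.obj Y)

/-- Pullbacks in the slice are those of `E`, and the fiber above `a` of the identity of `Y` is a
single point. -/
lemma fiberAt_preservesFiniteLimits [PreservesFiniteLimits F] :
    PreservesFiniteLimits (fiberAt F a) := by
  have : PreservesLimit (Functor.empty (Over Y)) (fiberAt F a) := by
    let e : ⊤_ (Over Y) ≅ Over.mk (𝟙 Y) := terminalIsTerminal.uniqueUpToIso Over.mkIdTerminal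
    have h1 : e.hom.left = (⊤_ (Over Y)).hom := (Category.comp_id _).symm.trans (Over.w e.hom)
    have h2 : (⊤_ (Over Y)).hom ≫ e.inv.left = 𝟙 _ := by
      rw [← h1, ← Over.comp_left, e.hom_inv_id]
      rfl
    have h3 : e.inv.left ≫ (⊤_ (Over Y)).hom = 𝟙 Y := Over.w e.inv
    have : IsIso (terminal.from ((fiberAt F a).obj (⊤_ (Over Y)))) := by
      let u : Unique ((fiberAt F a).obj (⊤_ (Over Y))) :=
        { default := ⟨F.map e.inv.left a, by
            rw [← Functor.map_comp_apply, h3]; simp⟩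
          uniq := fun z => Subtype.ext (by
            obtain ⟨z, rfl⟩ := z
            change z = F.map e.inv.left (F.map (⊤_ (Over Y)).hom z)
            rw [← Functor.map_comp_apply, h2]; simp) }
      exact isIso_of_isTerminal (Types.isTerminalEquivUnique _ |>.symm u) terminalIsTerminal _
    exact preservesTerminal_of_isIso _ (terminal.from _)
  have : PreservesLimitsOfShape (Discrete PEmpty.{1}) (fiberAt F a) :=
    preservesLimitsOfShape_pempty_of_preservesTerminal _
  have : PreservesLimitsOfShape WalkingCospan (fiberAt F a) := by
    refine ⟨fun {K} => ?_⟩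
    let f := K.map WalkingCospan.Hom.inl
    let g := K.map WalkingCospan.Hom.inr
    have : PreservesLimit (cospan f g) (fiberAt F a) := by
      have h := IsPullback.of_hasPullback f g
      have h' := (h.map (Over.forget Y)).map F
      have hF : IsPullback ((fiberAt F a).map (pullback.fst f g))
          ((fiberAt F a).map (pullback.snd f g)) ((fiberAt F a).map f) ((fiberAt F a).map g) := by
        refine (Types.isPullback_iff _ _ _ _).2 ⟨?_, fun x y hxy => ?_, fun x y hxy => ?_⟩
        · rw [← Functor.map_comp, ← Functor.map_comp, pullback.condition]
        · exact Subtype.ext (Types.ext_of_isPullback h' (congrArg Subtype.val hxy.1)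
            (congrArg Subtype.val hxy.2))
        · obtain ⟨z, hz1, hz2⟩ := Types.exists_of_isPullback h' x.1 y.1 (congrArg Subtype.val hxy)
          refine ⟨⟨z, ?_⟩, Subtype.ext hz1, Subtype.ext hz2⟩
          have : (pullback f g).hom = (pullback.fst f g).left ≫ (K.obj WalkingCospan.left).hom :=
            (Over.w (pullback.fst f g)).symm
          rw [this]
          exact (Functor.map_comp_apply F _ _ z).trans ((congrArg _ hz1).trans x.2)
      exact preservesLimit_of_preserves_limit_cone h.isLimit
        ((isLimitMapConePullbackConeEquiv _ h.w).symm hF.isLimit)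
    exact preservesLimit_of_iso_diagram _ (diagramIsoCospan K).symm
  exact preservesFiniteLimits_of_preservesTerminal_and_pullbacks _

variable {F} {R : Type w ⥤ E} (adj : F ⊣ R)

/-- The total space of the bundle on `F.obj Y` which is `S` above `a` and a point elsewhere. -/
abbrev SkyTotal (S : Type w) : Type w := Σ b : F.obj Y, (b = a → S)

/-- The projection of `SkyTotal`. -/
abbrev skyProj (S : Type w) : SkyTotal a S ⟶ F.obj Y := TypeCat.ofHom Sigma.fst

/-- The values on objects of the right adjoint to the fiber at a point. -/
def skyscraper (S : Type w) : Over Y :=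
  Over.mk (pullback.fst (adj.unit.app Y) (R.map (skyProj a S)))

/-- The morphism underlying a morphism to `skyscraper`. -/
def skyLeft {Z : Over Y} {S : Type w} (m : Z ⟶ skyscraper a adj S) :
    Z.left ⟶ pullback (adj.unit.app Y) (R.map (skyProj a S)) := m.left

lemma skyLeft_fst {Z : Over Y} {S : Type w} (m : Z ⟶ skyscraper a adj S) :
    skyLeft a adj m ≫ pullback.fst _ _ = Z.hom := Over.w m

/-- The map of bundles given by a morphism to `skyscraper`. -/
def skyMap {Z : Over Y} {S : Type w} (m : Z ⟶ skyscraper a adj S) :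
    F.obj Z.left ⟶ SkyTotal a S :=
  (adj.homEquiv _ _).symm (skyLeft a adj m ≫ pullback.snd _ _)

lemma skyMap_comp {Z Z' : Over Y} {S : Type w} (f : Z' ⟶ Z) (m : Z ⟶ skyscraper a adj S) :
    skyMap a adj (f ≫ m) = F.map f.left ≫ skyMap a adj m := by
  rw [skyMap, skyMap, ← adj.homEquiv_naturality_left_symm]
  congr 1
  exact Category.assoc _ _ _

/-- By adjunction, a morphism over `Y` to the skyscraper is a map to `SkyTotal` over the set `F Y`.
As `SkyTotal` is a point away from `a`, such a map is just an arbitrary function to `S` on the fiber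
above `a`. -/
lemma skyMap_proj {Z : Over Y} {S : Type w} (m : Z ⟶ skyscraper a adj S) :
    skyMap a adj m ≫ skyProj a S = F.map Z.hom := by
  rw [skyMap, ← adj.homEquiv_naturality_right_symm, Category.assoc, ← pullback.condition,
    reassoc_of% skyLeft_fst a adj m, Equiv.symm_apply_eq, adj.homEquiv_unit, adj.unit_naturality]

lemma exists_skyMap_eq {Z : Over Y} {S : Type w} (ψ : F.obj Z.left ⟶ SkyTotal a S)
    (hψ : ψ ≫ skyProj a S = F.map Z.hom) : ∃ m : Z ⟶ skyscraper a adj S, skyMap a adj m = ψ := by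
  have h : Z.hom ≫ adj.unit.app Y = adj.homEquiv _ _ ψ ≫ R.map (skyProj a S) := by
    rw [← adj.homEquiv_naturality_right, hψ, adj.homEquiv_unit, adj.unit_naturality]
  refine ⟨Over.homMk (pullback.lift _ _ h) (pullback.lift_fst _ _ _), ?_⟩
  rw [skyMap, Equiv.symm_apply_eq]
  exact pullback.lift_snd _ _ _

lemma skyMap_injective {Z : Over Y} {S : Type w} {m m' : Z ⟶ skyscraper a adj S}
    (h : skyMap a adj m = skyMap a adj m') : m = m' := by
  ext
  exact pullback.hom_ext ((skyLeft_fst a adj m).trans (skyLeft_fst a adj m').symm) ((adj.homEquiv _ _).symm.injective h)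

lemma skyMap_fst {Z : Over Y} {S : Type w} (m : Z ⟶ skyscraper a adj S) (z : F.obj Z.left) :
    (skyMap a adj m z).1 = F.map Z.hom z := by
  have := ConcreteCategory.congr_hom (skyMap_proj a adj m) z
  exact this

/-- The universal property of `skyscraper`. -/
def skyscraperEquiv (Z : Over Y) (S : Type w) :
    ((fiberAt F a).obj Z ⟶ S) ≃ (Z ⟶ skyscraper a adj S) := by
  refine (Equiv.ofBijective (fun m : Z ⟶ skyscraper a adj S => TypeCat.ofHom
    fun z : {z : F.obj Z.left // F.map Z.hom z = a} =>
      (skyMap a adj m z.1).2 ((skyMap_fst a adj m z.1).trans z.2)) ⟨fun m m' h => ?_,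
        fun φ => ?_⟩).symm
  · refine skyMap_injective a adj (ConcreteCategory.hom_ext _ _ fun z => ?_)
    have h1 := skyMap_fst a adj m z
    have h2 := skyMap_fst a adj m' z
    have h3 (e : F.map Z.hom z = a) :
      (skyMap a adj m z).2 (h1.trans e) = (skyMap a adj m' z).2 (h2.trans e) :=
      ConcreteCategory.congr_hom h ⟨z, e⟩
    revert h1 h2 h3
    generalize skyMap a adj m z = u
    generalize skyMap a adj m' z = v
    obtain ⟨b, s⟩ := u
    obtain ⟨b', s'⟩ := v
    intro h1 h2 h3
    obtain rfl : b = _ := h1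
    obtain rfl : b' = _ := h2
    exact congrArg _ (funext h3)
  · obtain ⟨m, hm⟩ := exists_skyMap_eq a adj (Z := Z) (S := S)
      (TypeCat.ofHom fun z => ⟨F.map Z.hom z, fun h => φ ⟨z, h⟩⟩) rfl
    refine ⟨m, ?_⟩
    ext ⟨z, hz⟩
    have h1 := skyMap_fst a adj m z
    have h2 : skyMap a adj m z = ⟨F.map Z.hom z, fun h => φ ⟨z, h⟩⟩ :=
      ConcreteCategory.congr_hom hm z
    change (skyMap a adj m z).2 (h1.trans hz) = φ ⟨z, hz⟩
    revert h1
    rw [h2]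
    exact fun _ => rfl

include adj in
/-- The fiber at a point of `F.obj Y` is the fiber functor of a point of the slice over `Y`. -/
theorem exists_point_fiberAt [PreservesFiniteLimits F] :
    ∃ q : Point (Over Y), q.inverseImage = fiberAt F a := by
  have he (Z' Z : Over Y) (S : Type w) (f : Z' ⟶ Z) (g : (fiberAt F a).obj Z ⟶ S) :
      skyscraperEquiv a adj Z' S ((fiberAt F a).map f ≫ g) = f ≫ skyscraperEquiv a adj Z S g := by
    obtain ⟨m, rfl⟩ := (skyscraperEquiv a adj Z S).symm.surjective g
    rw [Equiv.apply_symm_apply, ← Equiv.eq_symm_apply]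
    ext ⟨z, hz⟩
    have h1 := skyMap_fst a adj (f ≫ m) z
    have h2 : skyMap a adj (f ≫ m) z = skyMap a adj m (F.map f.left z) :=
      ConcreteCategory.congr_hom (skyMap_comp a adj f m) z
    have h3 := skyMap_fst a adj m (F.map f.left z)
    have h4 : F.map Z.hom (F.map f.left z) = a := ((fiberAt F a).map f ⟨z, hz⟩).2
    change (skyMap a adj m (F.map f.left z)).2 (h3.trans h4) =
      (skyMap a adj (f ≫ m) z).2 (h1.trans hz)
    revert h1
    rw [h2]
    exact fun _ => rfl
  exact ⟨⟨_, _, Adjunction.adjunctionOfEquivRight (skyscraperEquiv a adj) he,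
    fiberAt_preservesFiniteLimits F a⟩, rfl⟩

end Fiber

/-! ### Product with `Y` as an inverse image functor -/

section Product

variable {E : Type (w + 1)} [LargeCategory.{w} E] [IsTopos E]

/-- Cartesian closedness gives product with `Y` a right adjoint, the object of sections. It is left
exact because it is itself right adjoint to the forgetful functor. -/
theorem exists_productFunctor (Y : E) :
    ∃ P : ProductFunctor Y, ∃ m : ToposMorphism (Over Y) E, m.inverseImage = P.functor := by
  obtain ⟨⟨_, _⟩⟩ := nonempty_cartesianClosed E
  let : BraidedCategory E := .ofCartesianMonoidalCategory
  let : ChosenPullbacksAlong (curryRightUnitorHom Y) := .ofHasPullbacksAlong _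
  refine ⟨⟨toOver Y, fun X => CartesianMonoidalCategory.fst X Y, fun f => ?_, fun X => ?_⟩,
    ⟨_, _, Over.toOverSectionsAdj Y, ?_⟩, rfl⟩
  · rw [toOver_map]
    exact CartesianMonoidalCategory.whiskerRight_fst f Y
  · exact CartesianMonoidalCategory.tensorProductIsBinaryProduct X Y
  · have := (forgetAdjToOver Y).rightAdjoint_preservesLimits
    infer_instance

end Product

/-! ### Representing fiber functors by splitting objects -/

section FiberFunctor

variable {D : Type (w + 1)} [LargeCategory.{w} D] [IsTopos D] (F : D ⥤ Type w)
  [PreservesFiniteLimits F] [PreservesColimitsOfSize.{w, w} F]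

/-- If `G` splits `X`, the fiber of `X` is the set of morphisms from `G` to `X`. -/
theorem Splits.bijective_fiber (hl : IsLocallyConnectedTopos D) {G X : D} (h : Splits G X)
    (y : F.obj G) : Function.Bijective (fun s : G ⟶ X => F.map s y) := by
  obtain ⟨P, fst, snd, ⟨hP⟩⟩ := exists_binaryProduct X G
  -- The product `X × G` is the sum of the graphs of the morphisms from `G` to `X`. The functor `F`
  -- preserves both descriptions, and looking above `y` yields the bijection.
  obtain ⟨hc⟩ := h.nonempty_isColimit hl hP
  have h1 (s : G ⟶ X) : hP.lift (BinaryFan.mk s (𝟙 G)) ≫ fst = s := hP.fac _ ⟨WalkingPair.left⟩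
  have h2 (s : G ⟶ X) : hP.lift (BinaryFan.mk s (𝟙 G)) ≫ snd = 𝟙 G :=
    hP.fac _ ⟨WalkingPair.right⟩
  have hP' : IsLimit (BinaryFan.mk (F.map fst) (F.map snd)) :=
    isLimitMapConeBinaryFanEquiv F _ _ (isLimitOfPreserves F hP)
  have hc' : IsColimit (Cofan.mk (F.obj P) fun s => F.map (hP.lift (BinaryFan.mk s (𝟙 G)))) :=
    isColimitMapCoconeCofanMkEquiv F (fun _ : G ⟶ X => G) _ (isColimitOfPreserves F hc)
  constructor
  · intro s t e
    have e' : F.map (hP.lift (BinaryFan.mk s (𝟙 G))) y =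
        F.map (hP.lift (BinaryFan.mk t (𝟙 G))) y := by
      let k (s : G ⟶ X) : PUnit.{w + 1} ⟶ F.obj P :=
        TypeCat.ofHom fun _ => F.map (hP.lift (BinaryFan.mk s (𝟙 G))) y
      have : k s = k t := by
        refine BinaryFan.IsLimit.hom_ext hP' ?_ ?_
        · ext
          change F.map fst (F.map (hP.lift (BinaryFan.mk s (𝟙 G))) y) =
            F.map fst (F.map (hP.lift (BinaryFan.mk t (𝟙 G))) y)
          rw [← Functor.map_comp_apply, ← Functor.map_comp_apply, h1, h1]
          exact e
        · ext
          change F.map snd (F.map (hP.lift (BinaryFan.mk s (𝟙 G))) y) =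
            F.map snd (F.map (hP.lift (BinaryFan.mk t (𝟙 G))) y)
          rw [← Functor.map_comp_apply, ← Functor.map_comp_apply, h2, h2]
      exact ConcreteCategory.congr_hom this PUnit.unit
    by_contra hst
    -- The characteristic function of the summand indexed by `s` tells it apart from the one indexed
    -- by `t`.
    let r : F.obj P ⟶ ULift.{w} Prop :=
      Cofan.IsColimit.desc hc' fun s' => TypeCat.ofHom fun _ => ⟨s' = s⟩
    have hr (s' : G ⟶ X) : r (F.map (hP.lift (BinaryFan.mk s' (𝟙 G))) y) = ⟨s' = s⟩ :=
      ConcreteCategory.congr_hom (Cofan.IsColimit.fac hc' _ s') y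
    have := congrArg r e'
    rw [hr, hr] at this
    have := congrArg ULift.down this
    simp only [eq_self] at this
    exact hst (this.mp trivial).symm
  · intro ξ
    let c : BinaryFan (F.obj X) (F.obj G) :=
      BinaryFan.mk (P := PUnit.{w + 1}) (TypeCat.ofHom fun _ => ξ) (TypeCat.ofHom fun _ => y)
    let k : PUnit.{w + 1} ⟶ F.obj P := hP'.lift c
    have k1 : F.map fst (k PUnit.unit) = ξ :=
      ConcreteCategory.congr_hom (hP'.fac c ⟨WalkingPair.left⟩) PUnit.unit
    have k2 : F.map snd (k PUnit.unit) = y :=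
      ConcreteCategory.congr_hom (hP'.fac c ⟨WalkingPair.right⟩) PUnit.unit
    obtain ⟨⟨s⟩, y', hy'⟩ := Types.jointly_surjective_of_isColimit hc' (k PUnit.unit)
    change F.map (hP.lift (BinaryFan.mk s (𝟙 G))) y' = k PUnit.unit at hy'
    rw [← hy', ← Functor.map_comp_apply] at k1 k2
    rw [h2] at k2
    rw [h1] at k1
    refine ⟨s, ?_⟩
    have : y' = y := by simpa using k2
    rw [← this]
    exact k1

omit [IsTopos D] [PreservesFiniteLimits F] in
lemma surjective_map_of_epi {X Z : D} (f : X ⟶ Z) [Epi f] : Function.Surjective (F.map f) :=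
  (epi_iff_surjective _).1 inferInstance

end FiberFunctor

/-! ### Covering sieves generated by Galois objects -/

section LC

variable {T : Type (w + 1)} [LargeCategory.{w} T] [IsTopos T] [hl : Fact (IsLocallyConnectedTopos T)]
  (hc : IsConnectedTopos T)

omit [IsTopos T] hl in
lemma epi_slc {X Z : SLC T} (f : X ⟶ Z) [Epi f.hom] : Epi f :=
  (isSLC T).ι.epi_of_epi_map ‹_›

include hc

/-- The covering sieve of the final object which is generated by a Galois object. -/
def galSieve (Y : SLC T) (hY : IsGal Y.obj) : CoveringSieve T :=
  ⟨{ arrows := fun U _ => Nonempty (U ⟶ Y.obj)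
     downward_closed := fun {_ _ _} h g => ⟨g ≫ h.some⟩ }, by
    have := epi_terminal_from hc hY.slc hY.isConn.not_isInitial
    exact mem_canonicalTopology _ fun Z g h H => (cancel_epi (terminal.from Y.obj)).1
      (H ⟨Y.obj, terminal.from _, ⟨𝟙 _⟩⟩)⟩

lemma isLC_galSieve_iff {Y : SLC T} (hY : IsGal Y.obj) {X : T} :
    isLC (galSieve hc Y hY) X ↔ Splits Y.obj X := by
  refine ⟨fun h => (h Y.obj (terminal.from _) ⟨𝟙 _⟩ hY.isConn.1).splits hY.isConn (𝟙 _),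
    fun h U f hf hU => Splits.trivializes hl.out ?_⟩
  by_cases hU' : Nonempty (IsInitial U)
  · exact splits_of_isInitial hU'.some
  · exact h.of_hom ⟨hU, hU'⟩ hf.some

/-- The covering sieve of the final object of the slice over `Y` which is generated by the morphisms
from a Galois object to `Y`. -/
def galSieveOver (Y Y₁ : SLC T) (hY₁ : IsGal Y₁.obj) (hY : Splits Y₁.obj Y.obj) :
    CoveringSieve (Over Y) :=
  ⟨{ arrows := fun U _ => ∃ m : Y₁ ⟶ Y, Nonempty (U ⟶ Over.mk m)
     downward_closed := fun {_ _ _} h g => ⟨h.choose, ⟨g ≫ h.choose_spec.some⟩⟩ }, by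
    refine mem_canonicalTopology _ fun Z g h H =>
      isSeparating_over hc Y hY₁ _ _ fun V hV c => H ⟨V, c, ?_⟩
    obtain ⟨a⟩ := hV.2
    obtain ⟨m, hm⟩ := (hY _ hV.1.isConn a).2 V.hom.hom
    exact ⟨⟨m⟩, ⟨Over.homMk ⟨a⟩ (by ext; exact hm)⟩⟩⟩

lemma isLC_galSieveOver_iff {Y Y₁ : SLC T} (hY₁ : IsGal Y₁.obj) (hY : Splits Y₁.obj Y.obj)
    {Z : Over Y} : isLC (galSieveOver hc Y Y₁ hY₁ hY) Z ↔ Splits Y₁.obj Z.left.obj := by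
  have hY₁' : IsConn Y₁ := isConn_slc_iff.2 hY₁.isConn
  constructor
  · intro h
    refine (splits_slc_iff hY₁').1 fun W hW f => ⟨fun s t e => ?_, fun s => ?_⟩
    · ext
      exact Z.left.2.hasInjectiveRestrictions hl.out _ _ (isConn_slc_iff.1 hW) hY₁.isConn f.hom
        (congrArg (fun t => t.hom) e)
    -- The point `s` makes `W` an object over `Y`, and this structure extends to `Y₁`. This is why
    -- the sieve has to contain all the morphisms from `Y₁` to `Y`.
    · obtain ⟨m, hm⟩ := ((splits_slc_iff hY₁').2 hY W hW f).2 (s ≫ Z.hom)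
      have hU : IsConn (Over.mk m) := isConn_over_iff.2 hY₁'
      have hV : IsConn (Over.mk (f ≫ m)) := isConn_over_iff.2 hW
      have := (h (Over.mk m) (terminal.from _) ⟨m, ⟨𝟙 _⟩⟩ hU.1).splits hU (𝟙 _)
      obtain ⟨t, ht⟩ := (this (Over.mk (f ≫ m)) hV (Over.homMk f)).2 (Over.homMk s hm.symm)
      exact ⟨t.left, congrArg (fun t => t.left) ht⟩
  · rintro h U f ⟨m, ⟨g⟩⟩ hU
    refine Splits.trivializes (isLocallyConnectedTopos_over Y) ?_
    by_cases hU' : Nonempty (IsInitial U)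
    · exact splits_of_isInitial hU'.some
    · have hU'' : IsConn U := ⟨hU, hU'⟩
      exact splits_over hU'' (h.of_hom (isConn_slc_iff.1 (isConn_over_iff.1 hU'')) g.left.hom)

/-- The sieves generated by Galois objects are cofinal among the covering sieves of the final object
of the slice. -/
theorem exists_galSieveOver_le {Y : SLC T} (hY : IsGal Y.obj) (S : CoveringSieve (Over Y)) :
    ∃ (Y₁ : SLC T) (hY₁ : IsGal Y₁.obj) (h : Splits Y₁.obj Y.obj) (_ : Nonempty (Y₁ ⟶ Y)),
      galSieveOver hc Y Y₁ hY₁ h ≤ S := by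
  -- A covering sieve of a non-initial object contains some Galois object over `Y`.
  have hne : ∃ V : Over Y, IsGal V.left.obj ∧ S.1 (terminal.from V) := by
    by_contra! H
    have h1 := jointlyEpi_of_mem_canonicalTopology S.2
    have h0 : ¬ Nonempty (IsInitial (⊤_ (Over Y))) := by
      have : ¬ Nonempty (IsInitial (Over.mk (𝟙 Y))) := fun h =>
        hY.isConn.not_isInitial (nonempty_isInitial_slc_iff.1 (nonempty_isInitial_over_iff.1 h))
      exact IsConn.of_hom this (terminal.from _)
    refine binaryCofan_disjoint (coprodIsCoprod (⊤_ (Over Y)) (⊤_ (Over Y))) h0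
      (terminal.from _) (terminal.from _) (h1 _ _ fun p => isSeparating_over hc Y hY _ _
        fun V hV c => (H V hV.1 ?_).elim)
    have := S.1.downward_closed p.2.2 c
    rwa [show terminal.from V = c ≫ p.2.1 from Subsingleton.elim _ _]
  obtain ⟨V, hV, hVS⟩ := hne
  have hVY : Splits V.left.obj Y.obj := hY.splits.of_hom hV.isConn V.hom.hom
  refine ⟨V.left, hV, hVY, ⟨V.hom⟩, ?_⟩
  rintro U f ⟨m, ⟨g⟩⟩
  have : Epi m.hom := hY.epi hV m.hom
  obtain ⟨A, hA, ⟨a⟩⟩ := exists_hom_of_isSeparating hl.out.isConn_isSeparating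
    (not_isInitial_pullback m.hom V.hom.hom hV.isConn.not_isInitial)
  -- Any two morphisms from this Galois object to `Y` differ by one of its automorphisms, so one of
  -- them in `S` brings in all the others.
  obtain ⟨ψ, hψ, -⟩ := hV.existsUnique_aut hA (a ≫ pullback.fst _ _) (a ≫ pullback.snd _ _)
  have h1 : (⟨ψ.hom⟩ : V.left ⟶ V.left) ≫ V.hom = m := by
    ext
    refine Y.2.hasInjectiveRestrictions hl.out _ _ hA hV.isConn (a ≫ pullback.fst _ _) ?_
    change (a ≫ pullback.fst _ _) ≫ ψ.hom ≫ V.hom.hom = (a ≫ pullback.fst _ _) ≫ m.hom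
    rw [← Category.assoc, hψ, Category.assoc, Category.assoc, pullback.condition]
  have := S.1.downward_closed hVS (g ≫ (Over.homMk ⟨ψ.hom⟩ h1 : Over.mk m ⟶ V))
  rwa [show f = (g ≫ (Over.homMk ⟨ψ.hom⟩ h1 : Over.mk m ⟶ V)) ≫ terminal.from V from
    Subsingleton.elim _ _]

end LC

/-! ### Reindexing progroups, and exactness from a system of exact sequences -/

namespace ProGrp

lemma germ_map_comp (G : ProGrp.{w}) {i j : G.I} (u : i ⟶ j) {K : GrpCat.{w}}
    (φ : G.diagram.obj j ⟶ K) : G.germ (G.diagram.map u ≫ φ) = G.germ φ :=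
  ConcreteCategory.congr_hom (NatTrans.congr_app (colimit.w (G.diagram.op ⋙ coyoneda) u.op) K) φ

/-- The action of a morphism of progroups on the morphisms to a group. -/
def pull {G H : ProGrp.{w}} (f : G ⟶ H) {K : GrpCat.{w}} : H.homFrom.obj K → G.homFrom.obj K :=
  NatTrans.app (F := H.homFrom) (G := G.homFrom) f K

lemma pull_comp {G H L : ProGrp.{w}} (f : G ⟶ H) (g : H ⟶ L) {K : GrpCat.{w}}
    (x : L.homFrom.obj K) : pull (f ≫ g) x = pull f (pull g x) := rfl

lemma pull_inv_hom {G H : ProGrp.{w}} (e : G ≅ H) {K : GrpCat.{w}} (x : H.homFrom.obj K) :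
    pull e.inv (pull e.hom x) = x := by
  rw [← pull_comp, e.inv_hom_id]; rfl

section

variable {I J : Type w} [SmallCategory J] [IsCofiltered J] [SmallCategory I] [IsCofiltered I]

lemma pull_ofNatTrans {A B : J ⥤ GrpCat.{w}} (α : A ⟶ B) {j : J} {K : GrpCat.{w}}
    (φ : B.obj j ⟶ K) :
    pull (ofNatTrans α) ((of B).germ (i := j) φ) = (of A).germ (i := j) (α.app j ≫ φ) :=
  ConcreteCategory.congr_hom (NatTrans.congr_app (ι_colimMap
    (Functor.whiskerRight (NatTrans.op α) coyoneda) (Opposite.op j)) K) φ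

variable (K : J ⥤ I) (D : I ⥤ GrpCat.{w}) [K.Initial]

/-- A progroup can be reindexed along an initial functor. -/
def reindex : of D ≅ of (K ⋙ D) :=
  let e : colimit (K.op ⋙ D.op ⋙ coyoneda) ≅ colimit (D.op ⋙ coyoneda) :=
    @asIso _ _ _ _ (colimit.pre (D.op ⋙ coyoneda) K.op) (Functor.Final.colimit_pre_isIso K.op)
  { hom := e.hom
    inv := e.inv
    hom_inv_id := e.inv_hom_id
    inv_hom_id := e.hom_inv_id }

lemma pull_reindex {j : J} {L : GrpCat.{w}} (φ : D.obj (K.obj j) ⟶ L) :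
    pull (reindex K D).hom ((of (K ⋙ D)).germ (i := j) φ) = (of D).germ (i := K.obj j) φ :=
  ConcreteCategory.congr_hom (NatTrans.congr_app
    (colimit.ι_pre (D.op ⋙ coyoneda) K.op (Opposite.op j)) L) φ

lemma pull_reindex_inv {j : J} {L : GrpCat.{w}} (φ : D.obj (K.obj j) ⟶ L) :
    pull (reindex K D).inv ((of D).germ (i := K.obj j) φ) = (of (K ⋙ D)).germ (i := j) φ := by
  rw [← pull_reindex, pull_inv_hom]

end

/-- Initial functors bring the three progroups to the common index category `J`. Only `K ⋙ W` has to
be initial, not `K`: the middle progroup, indexed by `I₂`, is first rewritten over `I₃`, where the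
system `K ⋙ W` becomes cofinal. -/
theorem exists_isShortExact {J I₁ I₂ I₃ : Type w} [SmallCategory J] [IsCofiltered J]
    [SmallCategory I₁] [IsCofiltered I₁] [SmallCategory I₂] [IsCofiltered I₂] [SmallCategory I₃]
    [IsCofiltered I₃] (D₁ : I₁ ⥤ GrpCat.{w}) (D₃ : I₃ ⥤ GrpCat.{w}) (L : J ⥤ I₁) [L.Initial]
    (K : J ⥤ I₂) (W : I₂ ⥤ I₃) [W.Initial] [(K ⋙ W).Initial] {Q : GrpCat.{w}}
    (α : L ⋙ D₁ ⟶ K ⋙ W ⋙ D₃) (β : K ⋙ W ⋙ D₃ ⟶ (Functor.const J).obj Q)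
    (h : ∀ j, Function.Injective (α.app j).hom ∧ (α.app j).hom.range = (β.app j).hom.ker ∧
      Function.Surjective (β.app j).hom) :
    ∃ (f : of D₁ ⟶ of (W ⋙ D₃)) (g : of (W ⋙ D₃) ⟶ const Q), IsShortExact f g ∧
      (∀ (i : I₂) (j : J) (t : W.obj (K.obj j) ⟶ W.obj i),
        Represents f (i := L.obj j) (j := i) (α.app j ≫ D₃.map t)) ∧
      ∀ j : J, Represents g (i := K.obj j) (j := (⟨PUnit.unit⟩ : Discrete PUnit.{w + 1}))
        (β.app j) := by
  let p : J ⥤ Discrete PUnit.{w + 1} := (Functor.const J).obj ⟨PUnit.unit⟩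
  have : p.Initial := Functor.initial_of_exists_of_isCofiltered _
    (fun d => ⟨IsCofiltered.nonempty.some, ⟨eqToHom (by ext)⟩⟩)
    (fun {d c} s s' => ⟨c, 𝟙 c, Subsingleton.elim _ _⟩)
  let eG : of D₁ ≅ of (L ⋙ D₁) := reindex L D₁
  let eH : of (W ⋙ D₃) ≅ of (K ⋙ W ⋙ D₃) := (reindex W D₃).symm ≪≫ reindex (K ⋙ W) D₃
  let eK : const Q ≅ of ((Functor.const J).obj Q) :=
    reindex p ((Functor.const (Discrete PUnit.{w + 1})).obj Q)
  refine ⟨eG.hom ≫ ofNatTrans α ≫ eH.inv, eH.hom ≫ ofNatTrans β ≫ eK.inv,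
    ⟨J, inferInstance, inferInstance, _, _, _, α, β, eG, eH, eK, h, by simp, by simp⟩,
    fun i j t => ?_, fun j => ?_⟩
  · change pull (eG.hom ≫ ofNatTrans α ≫ eH.inv) ((of (W ⋙ D₃)).germ (i := i) (𝟙 _)) = _
    rw [pull_comp, pull_comp]
    have h1 : pull eH.inv ((of (W ⋙ D₃)).germ (i := i) (𝟙 (D₃.obj (W.obj i)))) =
        (of (K ⋙ W ⋙ D₃)).germ (i := j) (D₃.map t) := by
      change pull (reindex (K ⋙ W) D₃).inv (pull (reindex W D₃).hom _) = _
      rw [pull_reindex W D₃ (j := i) (𝟙 (D₃.obj (W.obj i)))]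
      rw [← germ_map_comp (of D₃) (i := W.obj (K.obj j)) (j := W.obj i) t (𝟙 (D₃.obj (W.obj i)))]
      rw [Category.comp_id]
      exact pull_reindex_inv (K ⋙ W) D₃ (j := j) (D₃.map t)
    refine (congrArg (fun x => pull eG.hom (pull (ofNatTrans α) x)) h1).trans ?_
    rw [pull_ofNatTrans α (j := j) (D₃.map t)]
    exact pull_reindex L D₁ (j := j) _
  · change pull (eH.hom ≫ ofNatTrans β ≫ eK.inv) ((const Q).germ (i := ⟨PUnit.unit⟩) (𝟙 Q)) = _
    rw [pull_comp, pull_comp]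
    have h1 : pull eK.inv ((const Q).germ (i := ⟨PUnit.unit⟩) (𝟙 Q)) =
        (of ((Functor.const J).obj Q)).germ (i := j) (𝟙 Q) :=
      pull_reindex_inv p ((Functor.const (Discrete PUnit.{w + 1})).obj Q) (j := j) (𝟙 Q)
    refine (congrArg (fun x => pull eH.hom (pull (ofNatTrans β) x)) h1).trans ?_
    refine (congrArg _ (pull_ofNatTrans β (j := j) (𝟙 Q))).trans ?_
    change pull (reindex W D₃).inv (pull (reindex (K ⋙ W) D₃).hom
      ((of (K ⋙ W ⋙ D₃)).germ (i := j) (β.app j ≫ 𝟙 Q))) = _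
    refine (congrArg _ (pull_reindex (K ⋙ W) D₃ (j := j) (β.app j ≫ 𝟙 Q))).trans ?_
    refine (congrArg (fun φ => pull (reindex W D₃).inv ((of D₃).germ (i := W.obj (K.obj j)) φ))
      (Category.comp_id (β.app j))).trans ?_
    exact pull_reindex_inv W D₃ (j := K.obj j) (β.app j)

end ProGrp

/-! ### Automorphism groups of fiber functors and their dependence on the sieve -/

section Level

variable {E : Type (w + 1)} [LargeCategory.{w} E] [HasTerminal E] {p : SLC E ⥤ Type w}
  {R : CoveringSieve E}

namespace pi1Level

lemma act_map (σ : pi1Level p R) {X X' : SLC E} (hX : isLC R X.obj) (hX' : isLC R X'.obj)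
    (f : X ⟶ X') (z : p.obj X) : act σ X' hX' (p.map f z) = p.map f (act σ X hX z) := by
  let g : (⟨X, hX⟩ : LC R) ⟶ ⟨X', hX'⟩ := ⟨f⟩
  have := (show Aut (LC.incl R ⋙ p) from σ).hom.naturality g
  exact ConcreteCategory.congr_hom this z

lemma act_mul (σ τ : pi1Level p R) (X : SLC E) (hX : isLC R X.obj) (z : p.obj X) :
    act (σ * τ) X hX z = act σ X hX (act τ X hX z) := rfl

lemma act_one (X : SLC E) (hX : isLC R X.obj) (z : p.obj X) :
    act (1 : pi1Level p R) X hX z = z := rfl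

lemma act_inv_act (σ : pi1Level p R) (X : SLC E) (hX : isLC R X.obj) (z : p.obj X) :
    act σ⁻¹ X hX (act σ X hX z) = z := by
  rw [← act_mul, inv_mul_cancel, act_one]

lemma act_act_inv (σ : pi1Level p R) (X : SLC E) (hX : isLC R X.obj) (z : p.obj X) :
    act σ X hX (act σ⁻¹ X hX z) = z := by
  rw [← act_mul, mul_inv_cancel, act_one]

lemma act_ext {σ τ : pi1Level p R} (h : ∀ X hX z, act σ X hX z = act τ X hX z) : σ = τ := by
  refine Iso.ext (NatTrans.ext (funext fun X => ?_))
  ext z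
  exact h X.obj X.property z

lemma exists_act (f : ∀ X : SLC E, isLC R X.obj → p.obj X → p.obj X)
    (hf : ∀ X hX, Function.Bijective (f X hX))
    (hn : ∀ (X X' : SLC E) (hX : isLC R X.obj) (hX' : isLC R X'.obj) (g : X ⟶ X') (z : p.obj X),
      f X' hX' (p.map g z) = p.map g (f X hX z)) :
    ∃ σ : pi1Level p R, ∀ X hX z, act σ X hX z = f X hX z := by
  let σ : LC.incl R ⋙ p ≅ LC.incl R ⋙ p := NatIso.ofComponents
    (fun X => (Equiv.ofBijective _ (hf X.obj X.property)).toIso) fun {X X'} g => by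
      ext z
      exact hn _ _ X.property X'.property g.hom z
  exact ⟨σ, fun X hX z => rfl⟩

/-- The restriction to the objects which are trivialized by a coarser sieve. -/
def coarsen (p : SLC E ⥤ Type w) {R' R : CoveringSieve E}
    (h : ∀ X : SLC E, isLC R X.obj → isLC R' X.obj) : pi1Level p R' ⟶ pi1Level p R :=
  GrpCat.ofHom (((Functor.whiskeringLeft _ _ (Type w)).obj (ObjectProperty.ιOfLE
    (P := (isLC R).inverseImage (isSLC E).ι) (P' := (isLC R').inverseImage (isSLC E).ι) h)).mapAut
    (LC.incl R' ⋙ p))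

end pi1Level

variable (E)

/-- The covering sieves of the final object, preordered by inclusion of the categories of the
objects which they trivialize. -/
def TrivializingSieve : Type (w + 1) := CoveringSieve E

variable {E}

/-- A covering sieve, seen as an element of `TrivializingSieve`. -/
def CoveringSieve.toTrivializing (R : CoveringSieve E) : TrivializingSieve E := R

/-- The covering sieve underlying an element of `TrivializingSieve`. -/
def TrivializingSieve.sieve (R : TrivializingSieve E) : CoveringSieve E := R

/-- The automorphism group depends on a sieve only through the objects which it trivializes. The
sieves generated by Galois objects of `T` need not be cofinal for inclusion, but they are for this
preorder. -/
instance : Preorder (TrivializingSieve E) where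
  le R' R := ∀ X : SLC E, isLC R.sieve X.obj → isLC R'.sieve X.obj
  le_refl _ _ h := h
  le_trans _ _ _ h h' X hX := h X (h' X hX)

lemma toTrivializing_mono : Monotone (CoveringSieve.toTrivializing (E := E)) :=
  fun _ _ h X hX => isLC_mono h X.obj hX

instance : IsCodirectedOrder (TrivializingSieve E) :=
  ⟨fun R R' => ⟨CoveringSieve.toTrivializing (R.sieve ⊓ R'.sieve),
    toTrivializing_mono inf_le_left, toTrivializing_mono inf_le_right⟩⟩

instance : Nonempty (TrivializingSieve E) := ⟨CoveringSieve.toTrivializing ⊤⟩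

variable (E) in
/-- The functor from the covering sieves to `TrivializingSieve`. -/
def trivializingFunctor : CoveringSieve E ⥤ TrivializingSieve E := toTrivializing_mono.functor

lemma initial_of_exists_le {I J : Type*} [Category* I] [IsCofiltered I] [Preorder J] (K : I ⥤ J)
    (h : ∀ j, ∃ i, K.obj i ≤ j) : K.Initial :=
  Functor.initial_of_exists_of_isCofiltered _ (fun j => (h j).imp fun _ h => ⟨homOfLE h⟩)
    fun {_ i} _ _ => ⟨i, 𝟙 _, Subsingleton.elim _ _⟩

instance : (trivializingFunctor E).Initial :=
  initial_of_exists_le _ fun R => ⟨R.sieve, le_rfl⟩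

variable (p)

/-- The projective system of the groups `pi1Level`, indexed by `TrivializingSieve`. -/
def levels : TrivializingSieve E ⥤ GrpCat.{w + 1} where
  obj R := pi1Level p R.sieve
  map h := pi1Level.coarsen p (leOfHom h)

end Level

/-! ### Products with `Y`, graphs and fibers -/

section Comparison

variable {E : Type (w + 1)} [LargeCategory.{w} E] {Y : E} (P : ProductFunctor Y) 

instance isIso_fiberComparison (F : E ⥤ Type w) [PreservesFiniteLimits F] (a : F.obj Y) :
    IsIso (P.fiberComparison F a) := by
  have (X : E) : IsIso ((P.fiberComparison F a).app X) := by
    have hP : IsLimit (BinaryFan.mk (F.map (P.fst X)) (F.map (P.functor.obj X).hom)) :=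
      isLimitMapConeBinaryFanEquiv F _ _ (isLimitOfPreserves F (P.isLimit X))
    refine (isIso_iff_bijective _).2 ⟨fun u v e => Subtype.ext ?_, fun z => ?_⟩
    · let k (u : F.obj (P.functor.obj X).left) : PUnit.{w + 1} ⟶ F.obj (P.functor.obj X).left :=
        TypeCat.ofHom fun _ => u
      have : k u.1 = k v.1 := by
        refine BinaryFan.IsLimit.hom_ext hP ?_ ?_
        · ext
          exact e
        · ext
          exact u.2.trans v.2.symm
      exact ConcreteCategory.congr_hom this PUnit.unit
    · let c : BinaryFan (F.obj X) (F.obj Y) :=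
        BinaryFan.mk (P := PUnit.{w + 1}) (TypeCat.ofHom fun _ => z) (TypeCat.ofHom fun _ => a)
      exact ⟨⟨hP.lift c PUnit.unit,
        ConcreteCategory.congr_hom (hP.fac c ⟨WalkingPair.right⟩) PUnit.unit⟩,
        ConcreteCategory.congr_hom (hP.fac c ⟨WalkingPair.left⟩) PUnit.unit⟩
  exact NatIso.isIso_of_isIso_app _

/-- The graph of a morphism to `Y`. -/
def ProductFunctor.graph (Z : Over Y) : Z ⟶ P.functor.obj Z.left :=
  Over.homMk ((P.isLimit Z.left).lift (BinaryFan.mk (𝟙 Z.left) Z.hom))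
    ((P.isLimit Z.left).fac _ ⟨WalkingPair.right⟩)

lemma ProductFunctor.graph_left_fst (Z : Over Y) : (P.graph Z).left ≫ P.fst Z.left = 𝟙 _ :=
  (P.isLimit Z.left).fac _ ⟨WalkingPair.left⟩

lemma ProductFunctor.map_fst_map_graph (F : E ⥤ Type w) (Z : Over Y) (z : F.obj Z.left) :
    F.map (P.fst Z.left) (F.map (P.graph Z).left z) = z := by
  rw [← Functor.map_comp_apply, P.graph_left_fst]
  simp

lemma Splits.productFunctor {G X : E} (hX : Splits G X) (hY : Splits G Y) :
    Splits G (P.functor.obj X).left := by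
  intro V hV f
  constructor
  · intro s t e
    refine BinaryFan.IsLimit.hom_ext (P.isLimit X) ((hX V hV f).1 ?_) ((hY V hV f).1 ?_)
    · exact (Category.assoc f s _).symm.trans ((congrArg (· ≫ P.fst X) e).trans
        (Category.assoc f t _))
    · exact (Category.assoc f s _).symm.trans ((congrArg (· ≫ (P.functor.obj X).hom) e).trans
        (Category.assoc f t _))
  · intro s
    obtain ⟨u, hu⟩ := (hX V hV f).2 (s ≫ P.fst X)
    obtain ⟨v, hv⟩ := (hY V hV f).2 (s ≫ (P.functor.obj X).hom)
    refine ⟨(P.isLimit X).lift (BinaryFan.mk u v),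
      BinaryFan.IsLimit.hom_ext (P.isLimit X) ?_ ?_⟩
    · exact (Category.assoc f _ _).trans ((congrArg (f ≫ ·)
        ((P.isLimit X).fac _ ⟨WalkingPair.left⟩)).trans hu)
    · exact (Category.assoc f _ _).trans ((congrArg (f ≫ ·)
        ((P.isLimit X).fac _ ⟨WalkingPair.right⟩)).trans hv)

end Comparison

/-! ### Morphisms of automorphism groups induced by an inverse image functor -/

section Induced

variable {E : Type (w + 1)} [LargeCategory.{w} E] [HasTerminal E]
  {E' : Type (w + 1)} [LargeCategory.{w} E'] [HasTerminal E'] {u : SLC E ⥤ E'}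
  {p : SLC E ⥤ Type w} {q : E' ⥤ Type w} (θ : u ⋙ q ⟶ p) [IsIso θ] (h : ∀ X, isSLC E' (u.obj X))
  {S : CoveringSieve E'} {R : CoveringSieve E}
  (hS : ∀ X : SLC E, isLC R X.obj → isLC S (u.obj X))

/-- The morphism between automorphism groups of points which is induced by a functor. -/
def inducedLevel : pi1Level ((isSLC E').ι ⋙ q) S ⟶ pi1Level p R :=
  let V : LC R ⥤ LC S :=
    { obj X := ⟨⟨u.obj X.obj, h X.obj⟩, hS X.obj X.property⟩
      map f := ⟨⟨u.map f.hom⟩⟩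
      map_id X := by
        ext
        exact u.map_id _
      map_comp f g := by
        ext
        exact u.map_comp _ _ }
  let θ' : V ⋙ LC.incl S ⋙ (isSLC E').ι ⋙ q ≅ LC.incl R ⋙ p :=
    Functor.isoWhiskerLeft (LC.incl R) (asIso θ)
  GrpCat.ofHom (θ'.conjAut.toMonoidHom.comp
    (((Functor.whiskeringLeft _ _ (Type w)).obj V).mapAut (LC.incl S ⋙ (isSLC E').ι ⋙ q)))

lemma act_inducedLevel (σ : pi1Level ((isSLC E').ι ⋙ q) S) (X : SLC E) (hX : isLC R X.obj)
    (z : q.obj (u.obj X)) :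
    θ.app X (pi1Level.act σ ⟨u.obj X, h X⟩ (hS X hX) z) =
      pi1Level.act ((inducedLevel θ h hS).hom σ) X hX (θ.app X z) := by
  have h1 : (inv θ).app X (θ.app X z) = z :=
    ConcreteCategory.congr_hom (NatTrans.congr_app (IsIso.hom_inv_id θ) X) z
  change _ = θ.app X (pi1Level.act σ ⟨u.obj X, h X⟩ (hS X hX) ((inv θ).app X (θ.app X z)))
  rw [h1]

end Induced

/-! ### The fundamental group of the slice as a stabilizer -/

section Exact

variable {T : Type (w + 1)} [LargeCategory.{w} T] [IsTopos T] [hl : Fact (IsLocallyConnectedTopos T)]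
  (hc : IsConnectedTopos T) (F : SLC T ⥤ Type w) {Y : SLC T} (a : F.obj Y) (P : ProductFunctor Y)
  {Y₁ : SLC T} (hY₁ : IsGal Y₁.obj) (hY : Splits Y₁.obj Y.obj)

include hc hY in
lemma isLC_productFunctor (X : SLC T) (hX : isLC (galSieve hc Y₁ hY₁) X.obj) :
    isLC (galSieveOver hc Y Y₁ hY₁ hY) (P.functor.obj X) := by
  have h : IsConn Y₁ := isConn_slc_iff.2 hY₁.isConn
  rw [isLC_galSieve_iff, ← splits_slc_iff h] at hX
  rw [isLC_galSieveOver_iff, ← splits_slc_iff h]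
  exact hX.productFunctor P ((splits_slc_iff h).2 hY)

variable [PreservesFiniteLimits F]

/-- The morphism from the group of automorphisms of the fiber functor of `a` to that of `F`, at the
level given by a Galois object. -/
def stabilizerInclusion : pi1Level ((isSLC (Over Y)).ι ⋙ fiberAt F a)
    (galSieveOver hc Y Y₁ hY₁ hY) ⟶ pi1Level F (galSieve hc Y₁ hY₁) :=
  inducedLevel (P.fiberComparison F a) (fun X => isSLC_over hc (P.functor.obj X))
    (isLC_productFunctor hc P hY₁ hY)

lemma isLC_left {Z : Over Y} (hZ : isLC (galSieveOver hc Y Y₁ hY₁ hY) Z) :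
    isLC (galSieve hc Y₁ hY₁) Z.left.obj :=
  (isLC_galSieve_iff hc hY₁).2 ((isLC_galSieveOver_iff hc hY₁ hY).1 hZ)

/-- The graph embeds `Z` into the product of its underlying object with `Y`, where the action is the
induced one by construction; naturality along the graph carries this back to `Z`. -/
lemma act_stabilizerInclusion
    (σ : pi1Level ((isSLC (Over Y)).ι ⋙ fiberAt F a) (galSieveOver hc Y Y₁ hY₁ hY))
    (Z : SLC (Over Y)) (hZ : isLC (galSieveOver hc Y Y₁ hY₁ hY) Z.obj)
    (z : (fiberAt F a).obj Z.obj) :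
    (pi1Level.act σ Z hZ z).1 = pi1Level.act ((stabilizerInclusion hc F a P hY₁ hY).hom σ)
      Z.obj.left (isLC_left hc hY₁ hY hZ) z.1 := by
  have hX := isLC_left hc hY₁ hY hZ
  have h1 := act_inducedLevel (P.fiberComparison F a) (fun X => isSLC_over hc (P.functor.obj X))
    (isLC_productFunctor hc P hY₁ hY) σ Z.obj.left hX ((fiberAt F a).map (P.graph Z.obj) z)
  have h2 : (P.fiberComparison F a).app Z.obj.left ((fiberAt F a).map (P.graph Z.obj) z) = z.1 :=
    P.map_fst_map_graph F Z.obj z.1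
  have h3 := pi1Level.act_map σ (X' := ⟨P.functor.obj Z.obj.left, isSLC_over hc _⟩) hZ
    (isLC_productFunctor hc P hY₁ hY _ hX) ⟨P.graph Z.obj⟩ z
  have h4 := P.map_fst_map_graph F Z.obj (pi1Level.act σ Z hZ z).1
  rw [h2] at h1
  rw [stabilizerInclusion, ← h1]
  exact h4.symm.trans (congrArg ((P.fiberComparison F a).app Z.obj.left) h3).symm

lemma stabilizerInclusion_injective :
    Function.Injective (stabilizerInclusion hc F a P hY₁ hY).hom := fun σ τ h =>
  pi1Level.act_ext fun Z hZ z => Subtype.ext (by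
    rw [act_stabilizerInclusion hc F a P, act_stabilizerInclusion hc F a P, h])

/-- The identity of `Y` has `{a}` as its fiber, so what comes from the slice fixes `a`. Conversely,
by naturality an automorphism fixing `a` preserves the fiber above `a` of every `Z` over `Y`. -/
lemma mem_range_stabilizerInclusion (τ : pi1Level F (galSieve hc Y₁ hY₁)) :
    τ ∈ (stabilizerInclusion hc F a P hY₁ hY).hom.range ↔
      pi1Level.act τ Y ((isLC_galSieve_iff hc hY₁).2 hY) a = a := by
  constructor
  · rintro ⟨σ, rfl⟩
    have h1 := act_stabilizerInclusion hc F a P hY₁ hY σ ⟨Over.mk (𝟙 Y), isSLC_over hc _⟩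
      ((isLC_galSieveOver_iff hc hY₁ hY).2 hY) ⟨a, by simp⟩
    have h2 := (pi1Level.act σ ⟨Over.mk (𝟙 Y), isSLC_over hc _⟩
      ((isLC_galSieveOver_iff hc hY₁ hY).2 hY) ⟨a, by simp⟩).2
    refine h1.symm.trans ((ConcreteCategory.congr_hom (F.map_id Y) _).symm.trans h2)
  · intro h
    have h' : pi1Level.act τ⁻¹ Y ((isLC_galSieve_iff hc hY₁).2 hY) a = a := by
      conv_lhs => rw [← h]
      exact pi1Level.act_inv_act _ _ _ _
    let f (τ : pi1Level F (galSieve hc Y₁ hY₁))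
        (h : pi1Level.act τ Y ((isLC_galSieve_iff hc hY₁).2 hY) a = a) (Z : SLC (Over Y))
        (hZ : isLC (galSieveOver hc Y Y₁ hY₁ hY) Z.obj) (z : (fiberAt F a).obj Z.obj) :
        (fiberAt F a).obj Z.obj :=
      ⟨pi1Level.act τ Z.obj.left (isLC_left hc hY₁ hY hZ) z.1, by
        rw [← pi1Level.act_map τ (isLC_left hc hY₁ hY hZ) ((isLC_galSieve_iff hc hY₁).2 hY), z.2, h]⟩
    obtain ⟨σ, hσ⟩ := pi1Level.exists_act (p := (isSLC (Over Y)).ι ⋙ fiberAt F a) (f τ h)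
      (fun Z hZ => Function.bijective_iff_has_inverse.2 ⟨f τ⁻¹ h' Z hZ,
        fun z => Subtype.ext (pi1Level.act_inv_act _ _ _ _),
        fun z => Subtype.ext (pi1Level.act_act_inv _ _ _ _)⟩)
      (fun Z Z' hZ hZ' g z => Subtype.ext (pi1Level.act_map τ _ _ g.hom.left z.1))
    refine ⟨σ, pi1Level.act_ext fun X hX z => ?_⟩
    obtain ⟨u, rfl⟩ : ∃ u, (P.fiberComparison F a).app X u = z :=
      ((isIso_iff_bijective _).1 (inferInstanceAs
        (IsIso ((P.fiberComparison F a).app X)))).2 z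
    refine (act_inducedLevel (P.fiberComparison F a) (fun X => isSLC_over hc (P.functor.obj X))
      (isLC_productFunctor hc P hY₁ hY) σ X hX u).symm.trans ?_
    refine (congrArg ((P.fiberComparison F a).app X) (hσ ⟨P.functor.obj X, isSLC_over hc _⟩
      (isLC_productFunctor hc P hY₁ hY X hX) u)).trans ?_
    exact (pi1Level.act_map τ _ hX (P.fst X) u.1).symm

end Exact

/-! ### The orbit morphism to `Aut Y` -/

section Orbit

variable {T : Type (w + 1)} [LargeCategory.{w} T] [IsTopos T] [hl : Fact (IsLocallyConnectedTopos T)]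
  {F : SLC T ⥤ Type w} [PreservesFiniteLimits F] [PreservesColimitsOfSize.{w, w} F]

lemma bijective_fiber_slc {G X : SLC T} (hG : IsConn G.obj) (h : Splits G.obj X.obj)
    (y : F.obj G) : Function.Bijective (fun s : G ⟶ X => F.map s y) :=
  ((splits_slc_iff (isConn_slc_iff.2 hG)).2 h).bijective_fiber F isLocallyConnectedTopos_slc y

/-- The group of automorphisms of a Galois object is simply transitive on the fiber. -/
lemma existsUnique_aut_map {Y : SLC T} (hY : IsGal Y.obj) (b a : F.obj Y) :
    ∃! φ : Aut Y, F.map φ.hom b = a := by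
  have h := bijective_fiber_slc (F := F) hY.isConn hY.splits b
  obtain ⟨s, hs⟩ := h.2 a
  have : IsIso ((isSLC T).ι.map s) := hY.isIso s.hom
  have : IsIso s := isIso_of_reflects_iso s (isSLC T).ι
  exact ⟨asIso s, hs, fun φ hφ => Iso.ext (h.1 (hφ.trans hs.symm))⟩

variable {Y : SLC T} (hY : IsGal Y.obj) (a : F.obj Y) {R : CoveringSieve T} (hR : isLC R Y.obj)

/-- The morphism which maps `σ` to the automorphism `φ` of `Y` which maps `σ a` to `a`. -/
def orbitLevel : pi1Level F R ⟶ GrpCat.of (ULift.{w + 1} (Aut Y)) :=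
  GrpCat.ofHom (MonoidHom.mk' (fun σ =>
    ULift.up (existsUnique_aut_map hY (pi1Level.act σ Y hR a) a).choose) fun σ τ => by
      refine congrArg ULift.up ((existsUnique_aut_map hY _ a).choose_spec.2 _ ?_).symm
      have h1 := (existsUnique_aut_map hY (pi1Level.act σ Y hR a) a).choose_spec.1
      have h2 := (existsUnique_aut_map hY (pi1Level.act τ Y hR a) a).choose_spec.1
      generalize (existsUnique_aut_map hY (pi1Level.act σ Y hR a) a).choose = φ at h1
      generalize (existsUnique_aut_map hY (pi1Level.act τ Y hR a) a).choose = ψ at h2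
      -- The product of `φ` and `ψ` in `Aut Y` applies `ψ` first. As `ψ` commutes with `σ`, it takes
      -- `σ (τ a)` to `σ a`, which `φ` takes to `a`.
      change F.map (ψ.hom ≫ φ.hom) (pi1Level.act σ Y hR (pi1Level.act τ Y hR a)) = a
      rw [Functor.map_comp_apply, ← pi1Level.act_map σ hR hR, h2, h1])

lemma map_orbitLevel (σ : pi1Level F R) :
    F.map ((orbitLevel hY a hR).hom σ).down.hom (pi1Level.act σ Y hR a) = a :=
  (existsUnique_aut_map hY (pi1Level.act σ Y hR a) a).choose_spec.1

lemma orbitLevel_eq_iff (σ : pi1Level F R) (φ : Aut Y) :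
    (orbitLevel hY a hR).hom σ = ULift.up φ ↔ F.map φ.hom (pi1Level.act σ Y hR a) = a := by
  refine ⟨fun h => ?_, fun h => congrArg ULift.up
    ((existsUnique_aut_map hY (pi1Level.act σ Y hR a) a).choose_spec.2 φ h).symm⟩
  have := map_orbitLevel hY a hR σ
  rwa [h] at this

lemma mem_ker_orbitLevel (σ : pi1Level F R) :
    σ ∈ (orbitLevel hY a hR).hom.ker ↔ pi1Level.act σ Y hR a = a := by
  refine (orbitLevel_eq_iff hY a hR σ 1).trans ?_
  change F.map (𝟙 Y) _ = a ↔ _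
  simp

/-- Two points `y`, `y'` of the fiber of `Y₁` identify the fiber functor with Hom(Y₁, -) in two
ways, which differ by an automorphism taking `y` to `y'`. It suffices to choose `y` above `a` and
`y'` above the image of `a` by the inverse of `φ`. -/
lemma orbitLevel_surjective (hc : IsConnectedTopos T) {Y₁ : SLC T} (hY₁ : IsGal Y₁.obj)
    (m : Y₁ ⟶ Y) (hR : isLC (galSieve hc Y₁ hY₁) Y.obj) :
    Function.Surjective (orbitLevel hY a hR).hom := by
  rintro ⟨φ⟩
  have : Epi m.hom := hY.epi hY₁ m.hom
  have : Epi m := epi_slc m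
  obtain ⟨y, hy⟩ := surjective_map_of_epi F m a
  obtain ⟨y', hy'⟩ := surjective_map_of_epi F m (F.map φ.inv a)
  have hb (X : SLC T) (hX : isLC (galSieve hc Y₁ hY₁) X.obj) (y : F.obj Y₁) :=
    bijective_fiber_slc (F := F) hY₁.isConn ((isLC_galSieve_iff hc hY₁).1 hX) y
  let e (X) (hX) (y) := Equiv.ofBijective _ (hb X hX y)
  have he (X hX) (y : F.obj Y₁) (s : Y₁ ⟶ X) : (e X hX y).symm (F.map s y) = s :=
    (e X hX y).symm_apply_apply s
  obtain ⟨σ, hσ⟩ := pi1Level.exists_act (fun X hX z => e X hX y' ((e X hX y).symm z))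
    (fun X hX => (e X hX y').bijective.comp (e X hX y).symm.bijective)
    (fun X X' hX hX' g z => by
      obtain ⟨s, rfl⟩ := (hb X hX y).2 z
      change F.map ((e X' hX' y).symm (F.map g (F.map s y))) y' =
        F.map g (F.map ((e X hX y).symm (F.map s y)) y')
      rw [← Functor.map_comp_apply, he X' hX', he X hX, Functor.map_comp_apply])
  refine ⟨σ, (orbitLevel_eq_iff hY a hR σ φ).2 ?_⟩
  rw [hσ]
  change F.map φ.hom (F.map ((e Y hR y).symm a) y') = a
  rw [← hy, he Y hR, hy', ← Functor.map_comp_apply, φ.inv_hom_id]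
  simp [hy]

end Orbit

/-! ### Passage to the limit over the Galois objects above `Y` -/

section Index

variable {T : Type (w + 1)} [LargeCategory.{w} T]

/-- The Galois objects above `Y`, preordered by existence of a morphism. -/
def GaloisAbove (Y : SLC T) : Type (w + 1) := {Y₁ : SLC T // IsGal Y₁.obj ∧ Nonempty (Y₁ ⟶ Y)}

instance (Y : SLC T) : Preorder (GaloisAbove Y) where
  le Y₁ Y₂ := Nonempty (Y₁.1 ⟶ Y₂.1)
  le_refl Y₁ := ⟨𝟙 _⟩
  le_trans _ _ _ f g := ⟨f.some ≫ g.some⟩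

variable [IsTopos T] [hl : Fact (IsLocallyConnectedTopos T)] (hc : IsConnectedTopos T)

include hc

lemma exists_isGal_hom_hom {A B : SLC T} (hA : IsGal A.obj) (hB : IsGal B.obj) :
    ∃ G : SLC T, IsGal G.obj ∧ Nonempty (G ⟶ A) ∧ Nonempty (G ⟶ B) := by
  have := epi_terminal_from hc hA.slc hA.isConn.not_isInitial
  let f := terminal.from A.obj
  let g := terminal.from B.obj
  obtain ⟨G, hG, ⟨u⟩⟩ := exists_isGal_hom (isSLC.of_isPullback hl.out (IsPullback.of_hasPullback f g)
    A.2 B.2 (isSLC_of_isTerminal hl.out terminalIsTerminal))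
    (not_isInitial_pullback f g hB.isConn.not_isInitial)
  exact ⟨⟨G, hG.slc⟩, hG, ⟨⟨u ≫ pullback.fst f g⟩⟩, ⟨⟨u ≫ pullback.snd f g⟩⟩⟩

lemma isCofiltered_galoisAbove {Y : SLC T} (hY : IsGal Y.obj) : IsCofiltered (GaloisAbove Y) := by
  have : Nonempty (GaloisAbove Y) := ⟨⟨Y, hY, ⟨𝟙 Y⟩⟩⟩
  have : IsCodirectedOrder (GaloisAbove Y) := ⟨fun A B => by
    obtain ⟨G, hG, hGA, hGB⟩ := exists_isGal_hom_hom hc A.2.1 B.2.1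
    exact ⟨⟨G, hG, ⟨hGA.some ≫ A.2.2.some⟩⟩, hGA, hGB⟩⟩
  infer_instance

lemma galSieve_mono {A B : SLC T} (hA : IsGal A.obj) (hB : IsGal B.obj) (u : A ⟶ B) :
    galSieve hc A hA ≤ galSieve hc B hB :=
  fun _ _ h => ⟨h.some ≫ u.hom⟩

lemma galSieveOver_mono {A B Y : SLC T} (hA : IsGal A.obj) (hB : IsGal B.obj)
    (hAY : Splits A.obj Y.obj) (hBY : Splits B.obj Y.obj) (u : A ⟶ B) :
    galSieveOver hc Y A hA hAY ≤ galSieveOver hc Y B hB hBY := by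
  rintro U f ⟨m, ⟨g⟩⟩
  obtain ⟨m', hm'⟩ := (hBY _ hA.isConn u.hom).2 m.hom
  exact ⟨⟨m'⟩, ⟨g ≫ Over.homMk u (by ext; exact hm')⟩⟩

omit hc [IsTopos T] hl in
lemma GaloisAbove.splits {Y : SLC T} (hY : IsGal Y.obj) (A : GaloisAbove Y) :
    Splits A.1.obj Y.obj :=
  hY.splits.of_hom A.2.1.isConn A.2.2.some.hom

/-- The covering sieves generated by the Galois objects above `Y`. -/
def galSieveFunctor (Y : SLC T) : GaloisAbove Y ⥤ CoveringSieve T where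
  obj A := galSieve hc A.1 A.2.1
  map f := homOfLE (galSieve_mono hc _ _ (leOfHom f).some)

variable {Y : SLC T} (hY : IsGal Y.obj)

/-- The covering sieves of the slice over `Y` generated by the Galois objects above `Y`. -/
def galSieveOverFunctor : GaloisAbove Y ⥤ CoveringSieve (Over Y) where
  obj A := galSieveOver hc Y A.1 A.2.1 (A.splits hY)
  map f := homOfLE (galSieveOver_mono hc _ _ _ _ (leOfHom f).some)

lemma initial_galSieveOverFunctor : (galSieveOverFunctor hc hY).Initial :=
  have := isCofiltered_galoisAbove hc hY
  initial_of_exists_le _ fun S => by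
    obtain ⟨A, hA, h, hAY, hS⟩ := exists_galSieveOver_le hc hY S
    exact ⟨⟨A, hA, hAY⟩, hS⟩

-- Some Galois object splits all that a given sieve trivializes, and a Galois object above both it
-- and `Y` still does.
include hY in
lemma initial_galSieveFunctor_comp :
    (galSieveFunctor hc Y ⋙ trivializingFunctor T).Initial :=
  have := isCofiltered_galoisAbove hc hY
  initial_of_exists_le _ fun R => by
    obtain ⟨A, hA, h⟩ := exists_isGal_of_coveringSieve
      (IsConn.of_hom hY.isConn.not_isInitial (terminal.from Y.obj)) R.sieve
    obtain ⟨G, hG, ⟨u⟩, hGY⟩ := exists_isGal_hom_hom hc (A := ⟨A, hA.slc⟩) hA hY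
    exact ⟨⟨G, hG, hGY⟩, fun X hX => (isLC_galSieve_iff hc hG).2
      ((h X.obj X.2 hX).of_hom hG.isConn u.hom)⟩

variable {F : SLC T ⥤ Type w} [PreservesFiniteLimits F] [PreservesColimitsOfSize.{w, w} F]
  (a : F.obj Y) (P : ProductFunctor Y)

/-- The projective system of the morphisms `stabilizerInclusion`. -/
def stabilizerInclusionNatTrans :
    galSieveOverFunctor hc hY ⋙ (pi1 ((isSLC (Over Y)).ι ⋙ fiberAt F a)).diagram ⟶
      galSieveFunctor hc Y ⋙ trivializingFunctor T ⋙ levels F where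
  app A := stabilizerInclusion hc F a P A.2.1 (A.splits hY)
  naturality A B f := by
    ext σ
    exact pi1Level.act_ext fun X hX z => rfl

/-- The projective system of the morphisms `orbitLevel`. -/
def orbitNatTrans : galSieveFunctor hc Y ⋙ trivializingFunctor T ⋙ levels F ⟶
    (Functor.const _).obj (GrpCat.of (ULift.{w + 1} (Aut Y))) where
  app A := orbitLevel hY a ((isLC_galSieve_iff hc A.2.1).2 (A.splits hY))
  naturality A B f := by
    ext σ
    rfl

include hY in
/-- The exact sequence of fundamental progroups of a Galois object. -/
theorem exists_exact_sequence :
    ∃ (f : pi1 ((isSLC (Over Y)).ι ⋙ fiberAt F a) ⟶ pi1 F) (g : pi1 F ⟶ autProGrp Y),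
      IsInducedBy P.functor F (fiberAt F a) (P.fiberComparison F a) f ∧
      IsOrbitMorphism F Y a g ∧ ProGrp.IsShortExact f g := by
  have := isCofiltered_galoisAbove hc hY
  have := initial_galSieveOverFunctor hc hY
  have hK := initial_galSieveFunctor_comp hc hY
  let D : CoveringSieve (Over Y) ⥤ GrpCat.{w + 1} :=
    (pi1 ((isSLC (Over Y)).ι ⋙ fiberAt F a)).diagram
  obtain ⟨f, g, hfg, hf, hg⟩ := ProGrp.exists_isShortExact D (levels F) (galSieveOverFunctor hc hY)
    (galSieveFunctor hc Y) (trivializingFunctor T) (stabilizerInclusionNatTrans hc hY a P)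
    (orbitNatTrans hc hY a) fun A => ⟨stabilizerInclusion_injective hc F a P _ _, by
      ext τ
      exact (mem_range_stabilizerInclusion hc F a P _ _ τ).trans (mem_ker_orbitLevel hY a _ τ).symm,
      orbitLevel_surjective hY a hc A.2.1 A.2.2.some _⟩
  refine ⟨f, g, fun R => ?_, ?_, hfg⟩
  · obtain ⟨⟨t, _, u⟩⟩ : Nonempty (CostructuredArrow (galSieveFunctor hc Y ⋙ trivializingFunctor T)
      ((trivializingFunctor T).obj R)) := (hK.out _).is_nonempty
    have ht : ∀ X : SLC T, isLC R X.obj → isLC (galSieve hc t.1 t.2.1) X.obj := leOfHom u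
    refine ⟨_, _, hf R t u, fun X hX => ⟨isSLC_over hc _, isLC_productFunctor hc P t.2.1
      (t.splits hY) X (ht X hX), fun σ z => ?_⟩⟩
    exact act_inducedLevel (P.fiberComparison F a) (fun X => isSLC_over hc (P.functor.obj X))
      (isLC_productFunctor hc P t.2.1 (t.splits hY)) σ X (ht X hX) z
  -- The level of `Y` itself suffices, since `Y` splits itself.
  · exact ⟨_, (isLC_galSieve_iff hc hY).2 hY.splits, _, hg ⟨Y, hY, ⟨𝟙 Y⟩⟩,
      fun σ => map_orbitLevel hY a _ σ⟩

end Index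

end GaloisTopos

end

open GaloisTopos in
theorem theorem6p1 {T : Type (w + 1)} [LargeCategory.{w} T] [IsTopos T]
    (hc : IsConnectedTopos T) (hl : IsLocallyConnectedTopos T)
    (x : Point (SLC T)) (Y : SLC T) (hY : IsGaloisObject Y) :
    -- (i)
    IsGaloisTopos (Over Y) ∧
    (∀ a : x.inverseImage.obj Y,
      ∃ q : Point (Over Y), q.inverseImage = fiberAt x.inverseImage a) ∧
    -- (ii)
    ∃ P : ProductFunctor Y,
      (∃ m : ToposMorphism (Over Y) (SLC T), m.inverseImage = P.functor) ∧
    -- (iii)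
      ∀ a : x.inverseImage.obj Y,
        IsIso (P.fiberComparison x.inverseImage a) ∧
        ∃ (f : pi1 ((isSLC (Over Y)).ι ⋙ fiberAt x.inverseImage a) ⟶ pi1 x.inverseImage)
          (g : pi1 x.inverseImage ⟶ autProGrp Y),
          IsInducedBy P.functor x.inverseImage (fiberAt x.inverseImage a)
            (P.fiberComparison x.inverseImage a) f ∧
          IsOrbitMorphism x.inverseImage Y a g ∧
          ProGrp.IsShortExact f g := by
  have : Fact (IsLocallyConnectedTopos T) := ⟨hl⟩
  have := x.preservesFiniteLimits
  have : PreservesColimitsOfSize.{w, w} x.inverseImage := x.adj.leftAdjoint_preservesColimits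
  obtain ⟨P, hP⟩ := exists_productFunctor Y
  refine ⟨isGaloisTopos_over hc Y, fun a => exists_point_fiberAt a x.adj, P, hP, fun a =>
    ⟨inferInstance, exists_exact_sequence hc (isGal_of_isGaloisObject hY ?_) a P⟩⟩
  -- The inverse image functor preserves initial objects, so the existence of `a` in the fiber
  -- prevents `Y` from being initial.
  rintro ⟨h⟩
  have h' : IsInitial (x.inverseImage.obj Y) := IsInitial.isInitialObj x.inverseImage Y h
  exact (h'.to PEmpty.{w + 1} a).elim
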